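/- Let $(X,\omega)$ be a compact connected Kähler manifold of dimension $n\ge 1$ and let $E$ be a holomorphic vector bundle on $X$ with a smooth Hermitian metric $h_0$. For a holomorphic subbundle $S\subseteq E$ of positive rank write $\deg S=\int_X c_1(S)\wedge\omega^{n-1}$ and $\mu_S=\deg S/\mathrm{rk}\,S$. For a smooth $h_0$-self-adjoint endomorphism $w$ of $E$ let $$\mathcal M(w)=\int_0^1\!\int_X \mathrm{tr}\big(w\,\Theta(e^{sw}h_0)\big)\wedge\omega^{n-1}\,ds-\gamma\int_X\mathrm{tr}(w)\,\omega^n,\qquad \gamma=\frac{2\pi\mu_E}{\int_X\omega^n},$$ be the Donaldson functional of $e^{w}h_0$ relative to $h_0$, where $e^{w}h_0$ denotes the metric $(u,v)\mapsto h_0(e^{w}u,v)$ and $\Theta(h)=\sqrt{-1}\,\bar\partial((\partial h)h^{-1})$ is the Chern curvature of $h$. Let $m\ge 2$, let $E=E_1\supsetneq E_2\supsetneq\dots\supsetneq E_m\supsetneq E_{m+1}=0$ be a filtration by holomorphic subbundles, and let $\lambda_1>\dots>\lambda_m$ be real numbers. Let $G_i$ be the $h_0$-orthogonal complement of $E_{i+1}$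 in $E_i$, let $w$ be the endomorphism of $E=\bigoplus_{i=1}^m G_i$ that acts on $G_i$ as multiplication by $\lambda_i$, and let $h_t=e^{tw}h_0$, $t\ge 0$, be the corresponding geodesic ray, so that $\mathcal M(h_t)=\mathcal M(tw)$. If $\mathcal M$ has non-positive asymptotic slope along $h_t$, that is, if $\lim_{t\to\infty}\frac{d}{dt}\mathcal M(tw)\le 0$, then $\mu_{E_i}\ge\mu_E$ for some $i$ with $2\le i\le m$. -/

import Mathlib

open scoped Manifold ContDiff Topology Bundle
open Set Filter MeasureTheory

noncomputable section

namespace DonaldsonRay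

/-! ## Linear algebra -/

/-- The wedge product of `n` two-forms `α 0, …, α (n-1)` on a real vector space `V`, as a `2n`-form:
`(α₀ ∧ … ∧ αₙ₋₁)(v) = 2⁻ⁿ ∑_σ sgn(σ) ∏ₖ αₖ(v_{σ(k,0)}, v_{σ(k,1)})`. The `2n` arguments are indexed
by pairs `(k, b)` and ordered as `(0,0), (0,1), (1,0), (1,1), …`; with this normalization
`(dx₁ ∧ dy₁) ∧ … ∧ (dxₙ ∧ dyₙ)` takes the value `1` on the basis dual to `x₁, y₁, …, xₙ, yₙ`. -/
def wedge {V : Type*} {n : ℕ} (α : Fin n → V → V → ℂ) (v : Fin n × Fin 2 → V) : ℂ :=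
  (1 / 2 ^ n : ℂ) * ∑ σ : Equiv.Perm (Fin n × Fin 2),
    ((Equiv.Perm.sign σ : ℤ) : ℂ) * ∏ k : Fin n, α k (v (σ (k, 0))) (v (σ (k, 1)))

/-- The orthogonal complement of `S` for a sesquilinear form `B` (linear in the first variable). -/
def orth {V : Type*} [AddCommGroup V] [Module ℂ V] (B : V →ₗ[ℂ] V →ₗ⋆[ℂ] ℂ)
    (S : Submodule ℂ V) : Submodule ℂ V where
  carrier := {v | ∀ t ∈ S, B v t = 0}
  add_mem' := by
    intro a b ha hb t ht
    simp [ha t ht, hb t ht]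
  zero_mem' := by
    intro t _
    simp
  smul_mem' := by
    intro c v hv t ht
    simp [hv t ht]

theorem isCompl_orth {V : Type*} [AddCommGroup V] [Module ℂ V] (B : V →ₗ[ℂ] V →ₗ⋆[ℂ] ℂ)
    (hB : ∀ v, v ≠ 0 → 0 < (B v v).re) (S : Submodule ℂ V) [FiniteDimensional ℂ S] :
    IsCompl S (orth B S) := by
  have hker : ∀ v ∈ S, (∀ t ∈ S, B v t = 0) → v = 0 := by
    intro v hv h
    by_contra hne
    have := hB v hne
    rw [h v hv] at this
    simp at this
  refine ⟨Submodule.disjoint_def.2 fun v hv h => hker v hv h, ?_⟩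
  rw [codisjoint_iff, eq_top_iff]
  intro v _
  let b := Module.finBasis ℂ S
  let f : S →ₗ[ℂ] (Fin (Module.finrank ℂ S) → ℂ) :=
    { toFun := fun s a => B s (b a)
      map_add' := by intro s t; ext a; simp
      map_smul' := by intro c s; ext a; simp }
  have key : ∀ u : V, (∀ a, B u (b a) = 0) → ∀ t ∈ S, B u t = 0 := by
    intro u hu t ht
    have h1 : (⟨t, ht⟩ : S) = ∑ a, b.repr ⟨t, ht⟩ a • b a := (b.sum_repr _).symm
    have h2 : t = ∑ a, b.repr ⟨t, ht⟩ a • (b a : V) := by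
      have h3 := congrArg S.subtype h1
      rw [map_sum] at h3
      exact h3
    rw [h2, map_sum]
    refine Finset.sum_eq_zero fun a _ => ?_
    rw [LinearMap.map_smulₛₗ, hu a, smul_zero]
  have hinj : Function.Injective f := by
    rw [← LinearMap.ker_eq_bot, LinearMap.ker_eq_bot']
    intro s hs
    have : (s : V) = 0 := hker s s.2 (key s fun a => congrFun hs a)
    exact Subtype.ext this
  have hsurj : Function.Surjective f :=
    (LinearMap.injective_iff_surjective_of_finrank_eq_finrank (by simp)).1 hinj
  obtain ⟨s, hs⟩ := hsurj fun a => B v (b a)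
  have hmem : v - s ∈ orth B S := by
    refine key _ fun a => ?_
    have := congrFun hs a
    simp only [f, LinearMap.coe_mk, AddHom.coe_mk] at this
    simp [this]
  rw [show v = s + (v - s) by abel]
  exact Submodule.add_mem_sup s.2 hmem

/-! ## Calculus on `ℂⁿ` -/

/-- `(∂f)(u)` at `z`, for the constant tangent vector `u`. -/
def del {n : ℕ} (f : (Fin n → ℂ) → ℂ) (z u : Fin n → ℂ) : ℂ :=
  (fderiv ℝ f z u - Complex.I * fderiv ℝ f z (Complex.I • u)) / 2

/-- `(∂̄f)(u)` at `z`, for the constant tangent vector `u`. -/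
def delbar {n : ℕ} (f : (Fin n → ℂ) → ℂ) (z u : Fin n → ℂ) : ℂ :=
  (fderiv ℝ f z u + Complex.I * fderiv ℝ f z (Complex.I • u)) / 2

/-! ## Forms on a complex manifold and their integrals -/

section Manifold

variable {n : ℕ} {X : Type*} [TopologicalSpace X] [ChartedSpace (Fin n → ℂ) X]

/-- The holomorphic tangent space at `x`. As a real vector space it is the tangent space of the
underlying real manifold; multiplication by `Complex.I` is the complex structure. -/
abbrev Tan (x : X) : Type := TangentSpace 𝓘(ℂ, Fin n → ℂ) x

variable (n X) in
/-- Complex-valued two-forms (on the underlying real tangent spaces). -/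
abbrev TwoForm : Type _ := ∀ x : X, Tan (n := n) x → Tan (n := n) x → ℂ

variable (n X) in
/-- Complex-valued forms of top degree `2n`. -/
abbrev TopForm : Type _ := ∀ x : X, (Fin n × Fin 2 → Tan (n := n) x) → ℂ

/-- The image in the tangent space of `X` of the coordinate vector `u` at the point `z` of the
target of the chart at `p`. -/
def chartVec (p : X) (z u : Fin n → ℂ) : Tan (n := n) ((chartAt (Fin n → ℂ) p).symm z) :=
  mfderiv 𝓘(ℂ, Fin n → ℂ) 𝓘(ℂ, Fin n → ℂ) (chartAt (Fin n → ℂ) p).symm z u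

/-- The density of a top form with respect to `dx₁ dy₁ ⋯ dxₙ dyₙ` in the chart at `p`, that is, its
value on `∂/∂x₁, ∂/∂y₁, …, ∂/∂xₙ, ∂/∂yₙ`. -/
def TopForm.density (θ : TopForm n X) (p : X) (z : Fin n → ℂ) : ℂ :=
  θ ((chartAt (Fin n → ℂ) p).symm z)
    fun kb => chartVec p z (Pi.single kb.1 (if kb.2 = 0 then 1 else Complex.I))

variable (n X) in
theorem exists_partition [CompactSpace X] [T2Space X] :
    ∃ ρ : PartitionOfUnity X X univ,
      ρ.IsSubordinate fun p => (chartAt (Fin n → ℂ) p).source :=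
  PartitionOfUnity.exists_isSubordinate isClosed_univ _
    (fun p => (chartAt (Fin n → ℂ) p).open_source)
    fun p _ => mem_iUnion.2 ⟨p, mem_chart_source _ p⟩

/-- `∫_X θ` for a continuous top form on a compact complex manifold with its complex orientation,
through a partition of unity subordinate to the charts (the sum has finitely many nonzero terms, and
the value does not depend on the partition). -/
def TopForm.integral [CompactSpace X] [T2Space X] (θ : TopForm n X) : ℂ :=
  ∑ᶠ p : X, ∫ z in (chartAt (Fin n → ℂ) p).target,
    (((exists_partition n X).choose p ((chartAt (Fin n → ℂ) p).symm z) : ℝ) : ℂ) * θ.density p z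

end Manifold

/-! ## Holomorphic bundles, Hermitian metrics, curvature -/

section Bundle

variable {n r : ℕ} {X : Type*} [TopologicalSpace X] [ChartedSpace (Fin n → ℂ) X]
  {E : X → Type*} [∀ x, AddCommGroup (E x)] [∀ x, Module ℂ (E x)] [∀ x, TopologicalSpace (E x)]
  [TopologicalSpace (Bundle.TotalSpace (Fin r → ℂ) E)] [FiberBundle (Fin r → ℂ) E]

variable (n r) in
/-- `s` is a holomorphic section of `E` over `U`. -/
def IsHolOn (s : ∀ x, E x) (U : Set X) : Prop :=
  ContMDiffOn 𝓘(ℂ, Fin n → ℂ) (𝓘(ℂ, Fin n → ℂ).prod 𝓘(ℂ, Fin r → ℂ)) ω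
    (fun x => Bundle.TotalSpace.mk' (Fin r → ℂ) x (s x)) U

variable (n r) in
/-- A holomorphic frame, defined on a neighbourhood of `x₀`, of a family `S` of subspaces of the
fibres of `E`: holomorphic sections of `E` that form a basis of `S y` for all `y` near `x₀`. -/
structure HolFrame (S : ∀ x, Submodule ℂ (E x)) (k : ℕ) (x₀ : X) where
  dom : Set X
  isOpen_dom : IsOpen dom
  mem_dom : x₀ ∈ dom
  sec : Fin k → ∀ x, E x
  hol : ∀ a, IsHolOn n r (sec a) dom
  linearIndependent : ∀ y ∈ dom, LinearIndependent ℂ fun a => sec a y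
  span_eq : ∀ y ∈ dom, Submodule.span ℂ (range fun a => sec a y) = S y

variable (n r E) in
/-- A holomorphic subbundle of `E` (of constant rank). -/
structure HolSubbundle where
  fiber : ∀ x, Submodule ℂ (E x)
  rank : ℕ
  exists_frame : ∀ x, Nonempty (HolFrame n r fiber rank x)

/-- Some holomorphic frame of `S` near `x`. -/
def HolSubbundle.frame (S : HolSubbundle n r E) (x : X) : HolFrame n r S.fiber S.rank x :=
  (S.exists_frame x).some

theorem HolSubbundle.finiteDimensional (S : HolSubbundle n r E) (x : X) :
    FiniteDimensional ℂ (S.fiber x) := by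
  rw [← (S.frame x).span_eq x (S.frame x).mem_dom]
  exact FiniteDimensional.span_of_finite ℂ (finite_range _)

variable (n r E) in
/-- A smooth Hermitian metric on `E`, linear in the first and conjugate-linear in the second
variable. -/
structure HermitianMetric where
  form : ∀ x, E x →ₗ[ℂ] E x →ₗ⋆[ℂ] ℂ
  conj_symm : ∀ x u v, (starRingEnd ℂ) (form x u v) = form x v u
  pos : ∀ x v, v ≠ 0 → 0 < (form x v v).re
  smooth : ∀ (U : Set X), IsOpen U → ∀ s t : ∀ x, E x, IsHolOn n r s U → IsHolOn n r t U →
    ContMDiffOn 𝓘(ℝ, Fin n → ℂ) 𝓘(ℝ, ℂ) ∞ (fun x => form x (s x) (t x)) U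

/-- The Gram matrix `H_{ab} = h(s_a, s_b)` of the sections `s`, in the coordinates of the chart
at `x`. -/
def gram {k : ℕ} (h : ∀ x, E x → E x → ℂ) (s : Fin k → ∀ x, E x) (x : X) (z : Fin n → ℂ) :
    Matrix (Fin k) (Fin k) ℂ :=
  Matrix.of fun a b =>
    h ((chartAt (Fin n → ℂ) x).symm z) (s a ((chartAt (Fin n → ℂ) x).symm z))
      (s b ((chartAt (Fin n → ℂ) x).symm z))

/-- The connection form `(∂H) H⁻¹` of the Chern connection in the holomorphic frame `s`, in the
coordinates of the chart at `x`, evaluated on the constant vector field `u`. -/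
def connForm {k : ℕ} (h : ∀ x, E x → E x → ℂ) (s : Fin k → ∀ x, E x) (x : X) (z u : Fin n → ℂ) :
    Matrix (Fin k) (Fin k) ℂ :=
  (Matrix.of fun a b => del (fun z' => gram h s x z' a b) z u) * (gram h s x z)⁻¹

/-- The curvature `Θ = √-1 ∂̄((∂H) H⁻¹)` of `h` in the holomorphic frame `s` as a matrix of
two-forms at `x`: `Θ s_a = ∑_b Θ_{ab} s_b`. Since `A = (∂H) H⁻¹` is of type `(1,0)`,
`(∂̄A)(u,v) = ∂̄(A(v))(u) - ∂̄(A(u))(v)` for constant fields `u, v`. The tangent space of `X` at `x`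
is identified with `ℂⁿ` by the chart at `x`. -/
def curvMatrix {k : ℕ} (h : ∀ x, E x → E x → ℂ) (s : Fin k → ∀ x, E x) (x : X)
    (u v : Tan (n := n) x) : Matrix (Fin k) (Fin k) ℂ :=
  Matrix.of fun a b => Complex.I *
    (delbar (fun z => connForm h s x z v a b) (chartAt (Fin n → ℂ) x x) u
      - delbar (fun z => connForm h s x z u a b) (chartAt (Fin n → ℂ) x x) v)

/-- The trace of the curvature of the metric that `h` induces on the subbundle `S`. It does not
depend on the frame. -/
def traceCurv (h : HermitianMetric n r E) (S : HolSubbundle n r E) : TwoForm n X :=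
  fun x u v => (curvMatrix (fun y a b => h.form y a b) (S.frame x).sec x u v).trace

/-- The first Chern form `c₁(S, h) = (1/2π) tr Θ` of the metric that `h` induces on `S`. -/
def chernForm (h : HermitianMetric n r E) (S : HolSubbundle n r E) : TwoForm n X :=
  fun x u v => (1 / (2 * Real.pi) : ℂ) * traceCurv h S x u v

variable [VectorBundle ℂ (Fin r → ℂ) E]

variable (n E) in
/-- The holomorphic frame of `E` near `x` given by the preferred trivialization. -/
def trivFrame [ContMDiffVectorBundle ω (Fin r → ℂ) E 𝓘(ℂ, Fin n → ℂ)] (x : X) :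
    HolFrame n r (fun y => (⊤ : Submodule ℂ (E y))) r x where
  dom := (trivializationAt (Fin r → ℂ) E x).baseSet
  isOpen_dom := (trivializationAt (Fin r → ℂ) E x).open_baseSet
  mem_dom := FiberBundle.mem_baseSet_trivializationAt' x
  sec := (trivializationAt (Fin r → ℂ) E x).localFrame (Pi.basisFun ℂ (Fin r))
  hol := fun a => (trivializationAt (Fin r → ℂ) E x).contMDiffOn_localFrame_baseSet
    (I := 𝓘(ℂ, Fin n → ℂ)) ω (Pi.basisFun ℂ (Fin r)) a
  linearIndependent := fun _ hy =>
    ((trivializationAt (Fin r → ℂ) E x).isLocalFrameOn_localFrame_baseSet 𝓘(ℂ, Fin n → ℂ) ω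
      (Pi.basisFun ℂ (Fin r))).linearIndependent hy
  span_eq := fun _ hy => top_le_iff.1
    (((trivializationAt (Fin r → ℂ) E x).isLocalFrameOn_localFrame_baseSet 𝓘(ℂ, Fin n → ℂ) ω
      (Pi.basisFun ℂ (Fin r))).generating hy)

variable (n r E) in
/-- `E` as a subbundle of itself. -/
def HolSubbundle.whole [ContMDiffVectorBundle ω (Fin r → ℂ) E 𝓘(ℂ, Fin n → ℂ)] :
    HolSubbundle n r E where
  fiber := fun _ => ⊤
  rank := r
  exists_frame := fun x => ⟨trivFrame n E x⟩

/-- The basis of `E x` given by the frame of `trivFrame`. -/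
def trivBasis [ContMDiffVectorBundle ω (Fin r → ℂ) E 𝓘(ℂ, Fin n → ℂ)] (x : X) :
    Module.Basis (Fin r) ℂ (E x) :=
  Module.Basis.mk ((trivFrame n E x).linearIndependent x (trivFrame n E x).mem_dom)
    ((trivFrame n E x).span_eq x (trivFrame n E x).mem_dom).ge

/-- The curvature `Θ(h)` as a two-form with values in `End E`. (The transpose turns
`Θ s_a = ∑_b Θ_{ab} s_b` into the column convention of `Matrix.toLin`.) -/
def curvature (r : ℕ) {E : X → Type*} [∀ x, AddCommGroup (E x)] [∀ x, Module ℂ (E x)]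
    [∀ x, TopologicalSpace (E x)] [TopologicalSpace (Bundle.TotalSpace (Fin r → ℂ) E)]
    [FiberBundle (Fin r → ℂ) E] [VectorBundle ℂ (Fin r → ℂ) E]
    [ContMDiffVectorBundle ω (Fin r → ℂ) E 𝓘(ℂ, Fin n → ℂ)] (h : ∀ x, E x → E x → ℂ)
    (x : X) (u v : Tan (n := n) x) : Module.End ℂ (E x) :=
  Matrix.toLin (trivBasis (n := n) (r := r) x) (trivBasis (n := n) (r := r) x)
    (curvMatrix h (trivFrame (r := r) n E x).sec x u v).transpose

/-- `e^w h`, that is, `(u, v) ↦ h(e^w u, v)`, with `e^w` given by its power series. -/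
def expForm (h : HermitianMetric n r E) (w : ∀ x, Module.End ℂ (E x)) (x : X) (u v : E x) : ℂ :=
  ∑' k : ℕ, ((k.factorial : ℂ))⁻¹ * h.form x ((w x ^ k) u) v

end Bundle

/-! ## Kähler metrics, slopes, the Donaldson functional -/

section Kahler

variable {n : ℕ} {X : Type*} [TopologicalSpace X] [ChartedSpace (Fin n → ℂ) X]
  [IsManifold 𝓘(ℂ, Fin n → ℂ) ω X]

variable (n X) in
/-- A Hermitian metric on the holomorphic tangent bundle of `X`. -/
abbrev TangentMetric : Type _ :=
  HermitianMetric n n (fun x : X => TangentSpace 𝓘(ℂ, Fin n → ℂ) x)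

/-- The fundamental form `ω(u, v) = -Im g(u, v)`, the real `(1,1)`-form with `ω(u, iu) = g(u, u)`. -/
def TangentMetric.fundForm (g : TangentMetric n X) : TwoForm n X :=
  fun x u v => ((-(g.form x u v).im : ℝ) : ℂ)

variable (n X) in
/-- A Kähler metric: a Hermitian metric whose fundamental form is closed. In a chart,
`dω(u,v,w) = ∂ᵤ(ω(v,w)) + ∂ᵥ(ω(w,u)) + ∂_w(ω(u,v))` for constant fields `u, v, w`. -/
structure KahlerMetric where
  metric : TangentMetric n X
  closed : ∀ p : X, ∀ z ∈ (chartAt (Fin n → ℂ) p).target, ∀ u v w : Fin n → ℂ,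
    fderiv ℝ (fun z => metric.fundForm _ (chartVec p z v) (chartVec p z w)) z u
      + fderiv ℝ (fun z => metric.fundForm _ (chartVec p z w) (chartVec p z u)) z v
      + fderiv ℝ (fun z => metric.fundForm _ (chartVec p z u) (chartVec p z v)) z w = 0

/-- The Kähler form. -/
def KahlerMetric.form (g : KahlerMetric n X) : TwoForm n X := g.metric.fundForm

/-- `ωⁿ`. -/
def KahlerMetric.top (g : KahlerMetric n X) : TopForm n X :=
  fun x v => wedge (fun _ : Fin n => g.form x) v

/-- `α ∧ ωⁿ⁻¹` (for `n ≥ 1`). -/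
def KahlerMetric.wedgePow (g : KahlerMetric n X) (α : TwoForm n X) : TopForm n X :=
  fun x v => wedge (fun k : Fin n => if k.val = 0 then α x else g.form x) v

variable [CompactSpace X] [T2Space X] {r : ℕ}
  {E : X → Type*} [∀ x, AddCommGroup (E x)] [∀ x, Module ℂ (E x)] [∀ x, TopologicalSpace (E x)]
  [TopologicalSpace (Bundle.TotalSpace (Fin r → ℂ) E)] [FiberBundle (Fin r → ℂ) E]

open Classical in
/-- The degree `∫_X c₁(S) ∧ ωⁿ⁻¹` of a subbundle `S` of `E`. The class `c₁(S)` is represented by the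
Chern form of an arbitrary Hermitian metric on `S`, here one that is induced by a metric on `E` (every
metric on `S` is); such metrics exist, and since `ω` is closed the integral does not depend on the
choice. -/
def degree (g : KahlerMetric n X) (S : HolSubbundle n r E) : ℝ :=
  if hE : Nonempty (HermitianMetric n r E) then
    (g.wedgePow (chernForm hE.some S)).integral.re
  else 0

/-- The slope `μ_S = deg(S) / rk(S)`. -/
def slope (g : KahlerMetric n X) (S : HolSubbundle n r E) : ℝ :=
  degree g S / S.rank

variable [VectorBundle ℂ (Fin r → ℂ) E] [ContMDiffVectorBundle ω (Fin r → ℂ) E 𝓘(ℂ, Fin n → ℂ)]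

/-- The Hermite-Einstein constant `γ = 2π μ_E / ∫_X ωⁿ`, the constant for which
`Θ ∧ ωⁿ⁻¹ = γ ωⁿ Id_E` is compatible with `2π c₁(E) = [tr Θ]`. -/
def heConst (g : KahlerMetric n X) (r : ℕ) (E : X → Type*)
    [∀ x, AddCommGroup (E x)] [∀ x, Module ℂ (E x)] [∀ x, TopologicalSpace (E x)]
    [TopologicalSpace (Bundle.TotalSpace (Fin r → ℂ) E)] [FiberBundle (Fin r → ℂ) E]
    [VectorBundle ℂ (Fin r → ℂ) E] [ContMDiffVectorBundle ω (Fin r → ℂ) E 𝓘(ℂ, Fin n → ℂ)] : ℝ :=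
  2 * Real.pi * slope g (HolSubbundle.whole n r E) / g.top.integral.re

/-- The Donaldson functional
`M(w) = ∫₀¹ ∫_X tr(w Θ(e^{sw} h₀)) ∧ ωⁿ⁻¹ ds - γ ∫_X tr(w) ωⁿ` of the metric `e^w h₀` relative to `h₀`,
for a smooth `h₀`-self-adjoint endomorphism `w`. The second term vanishes if `w` is trace-free. -/
def donaldson (g : KahlerMetric n X) (h₀ : HermitianMetric n r E) (w : ∀ x, Module.End ℂ (E x)) :
    ℝ :=
  (∫ s in (0 : ℝ)..1, (g.wedgePow fun x u v =>
      LinearMap.trace ℂ (E x) (w x * curvature r (expForm h₀ (fun y => (s : ℂ) • w y)) x u v)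
    ).integral.re)
  - heConst g r E * (TopForm.integral fun x v => LinearMap.trace ℂ (E x) (w x) * g.top x v).re

end Kahler

/-! ## Filtrations and rays -/

section Filtration

variable {n r : ℕ} {X : Type*} [TopologicalSpace X] [ChartedSpace (Fin n → ℂ) X]
  {E : X → Type*} [∀ x, AddCommGroup (E x)] [∀ x, Module ℂ (E x)] [∀ x, TopologicalSpace (E x)]
  [TopologicalSpace (Bundle.TotalSpace (Fin r → ℂ) E)] [FiberBundle (Fin r → ℂ) E]

variable (n r E) in
/-- A filtration `E = E₁ ⊋ E₂ ⊋ … ⊋ E_m ⊋ E_{m+1} = 0` by holomorphic subbundles. Only the terms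
`sub i` with `1 ≤ i ≤ m + 1` are part of it. -/
structure SubbundleFiltration (m : ℕ) where
  sub : ℕ → HolSubbundle n r E
  first : ∀ x, (sub 1).fiber x = ⊤
  last : ∀ x, (sub (m + 1)).fiber x = ⊥
  strict : ∀ i, 1 ≤ i → i ≤ m → ∀ x, (sub (i + 1)).fiber x < (sub i).fiber x

/-- The `h`-orthogonal projection of `E x` onto the fibre of `S`. -/
def orthProj (h : HermitianMetric n r E) (S : HolSubbundle n r E) (x : X) : Module.End ℂ (E x) :=
  haveI := S.finiteDimensional x
  (S.fiber x).projection (orth (h.form x) (S.fiber x))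
    (isCompl_orth (h.form x) (h.pos x) (S.fiber x))

/-- The endomorphism `w = ∑ᵢ λᵢ (P_{Eᵢ} - P_{Eᵢ₊₁})`, where `P` denotes `h`-orthogonal projections. -/
def rayEnd {m : ℕ} (h : HermitianMetric n r E) (F : SubbundleFiltration n r E m) (lam : ℕ → ℝ)
    (x : X) : Module.End ℂ (E x) :=
  ∑ i ∈ Finset.Icc 1 m, (lam i : ℂ) • (orthProj h (F.sub i) x - orthProj h (F.sub (i + 1)) x)

theorem SubbundleFiltration.fiber_le {m : ℕ} (F : SubbundleFiltration n r E m) {i j : ℕ}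
    (hi : 1 ≤ i) (hij : i ≤ j) (hj : j ≤ m + 1) (x : X) :
    (F.sub j).fiber x ≤ (F.sub i).fiber x := by
  induction j, hij using Nat.le_induction with
  | base => exact le_rfl
  | succ j hij ih => exact (F.strict j (by omega) (by omega) x).le.trans (ih (by omega))

/-- `w` acts as multiplication by `λᵢ` on the orthogonal complement `Gᵢ` of `Eᵢ₊₁` in `Eᵢ`. -/
theorem rayEnd_apply {m : ℕ} (h : HermitianMetric n r E) (F : SubbundleFiltration n r E m)
    (lam : ℕ → ℝ) {i : ℕ} (hi : 1 ≤ i) (him : i ≤ m) (x : X) {v : E x}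
    (hv : v ∈ (F.sub i).fiber x) (hv' : v ∈ orth (h.form x) ((F.sub (i + 1)).fiber x)) :
    rayEnd h F lam x v = (lam i : ℂ) • v := by
  have hin : ∀ j, 1 ≤ j → j ≤ i → orthProj h (F.sub j) x v = v := fun j hj hji => by
    have := (F.sub j).finiteDimensional x
    exact Submodule.projection_apply_of_mem_left _ (F.fiber_le hj hji (by omega) x hv)
  have hout : ∀ j, i < j → j ≤ m + 1 → orthProj h (F.sub j) x v = 0 := fun j hij hj => by
    have := (F.sub j).finiteDimensional x
    have : v ∈ orth (h.form x) ((F.sub j).fiber x) :=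
      fun t ht => hv' t (F.fiber_le (by omega) hij hj x ht)
    unfold orthProj
    rw [Submodule.projection_apply,
      (Submodule.projectionOnto_apply_eq_zero_iff _).2 this, ZeroMemClass.coe_zero]
  unfold rayEnd
  rw [LinearMap.sum_apply, Finset.sum_eq_single i]
  · simp [hin i hi le_rfl, hout (i + 1) (by omega) (by omega)]
  · intro j hj hne
    rw [Finset.mem_Icc] at hj
    rcases lt_or_gt_of_ne hne with hlt | hgt
    · simp [hin j hj.1 hlt.le, hin (j + 1) (by omega) hlt]
    · simp [hout j hgt (by omega), hout (j + 1) (by omega) (by omega)]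
  · intro hni
    exact absurd (Finset.mem_Icc.2 ⟨hi, him⟩) hni

end Filtration

/-- `f` has asymptotic slope `L`: it is differentiable for large `t` and `f'(t) → L` as `t → ∞`. -/
def HasAsymptoticSlope (f : ℝ → ℝ) (L : ℝ) : Prop :=
  (∀ᶠ t in atTop, DifferentiableAt ℝ f t) ∧ Tendsto (deriv f) atTop (𝓝 L)

end DonaldsonRay

end

open scoped Manifold ContDiff Topology Bundle
open Set Filter MeasureTheory

set_option linter.unusedSectionVars false

noncomputable section

namespace DonaldsonRay

/-! ## Wedge products as alternating maps -/

section Wedge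

variable {V : Type*} {n : ℕ}

/-! Let `P_k` be the `h₀`-orthogonal projection onto `E_k` and `Q_i = P_i - P_{i+1}`, so that `w = ∑
λ_i Q_i` and `h_t(u, v) = ∑ e^{tλ_i} h₀(Q_i u, v)`. The substitution `s ↦ st` in the Donaldson
functional gives `M(tw) = ∫₀ᵗ Φ(s) ds - γ t ∫ tr(w) ωⁿ`, where `Φ = ∑ λ_k (D_k - D_{k+1})` and
`D_k(s) = ∫_X tr(P_k Θ(h_s)) ∧ ωⁿ⁻¹`. The derivative of `M(tw)` is therefore `Φ(t)` minus a
constant, and the limits of the `D_k` have to be found.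

Every metric `h_s` keeps the `G_i` orthogonal, so `P_k` is also the `h_s`-orthogonal projection. The
Gauss-Codazzi formula (`trace_curv_sub`) splits `tr(P_k Θ(h_s))` into the trace of the curvature of
the induced metric on `E_k` and a term from the second fundamental form. The first part integrates
to `2π deg E_k` for every metric (`integral_traceCurv`), because two metrics differ by an exact form
and Stokes' theorem applies (`KahlerMetric.integral_exact`). The second part is a combination of the
factors `e^{s(λ_i - λ_j)}` with `j < k ≤ i`, with coefficients independent of `s`
(`second_form_ray`, `exists_second_form`). The weights decrease, so these factors tend to `0` and
`D_k → 2π deg E_k`. The sign of the second fundamental form plays no role.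

With `y_k = deg E_k - μ_E rk E_k` the limiting slope becomes `L = 2π ∑ λ_k (y_k - y_{k+1})`. Since
`y_1 = y_{m+1} = 0`, Abel summation (`sum_by_parts`) turns this into `2π ∑_{1 ≤ k < m} (λ_{k+1} -
λ_k) y_{k+1}`. If all slopes `μ_{E_i}` with `2 ≤ i ≤ m` were below `μ_E`, all these `y_i` would be
negative, each summand would be a product of two negative numbers, and `L` would be positive.

The foundations come along the way: chart independence of the integral of top forms, positivity of
the volume, Stokes' theorem for `dβ ∧ ωⁿ⁻¹`, and the behaviour of Chern connections under a change
of holomorphic frame. -/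

theorem exists_alternating_wedge [AddCommGroup V] [Module ℝ V] (b : Fin n → V →ₗ[ℝ] V →ₗ[ℝ] ℂ) :
    ∃ A : V [⋀^Fin n × Fin 2]→ₗ[ℝ] ℂ, ∀ v, wedge (fun k u w => b k u w) v = A v := by
  -- Updating one argument touches exactly one factor of the product; this is why the product is
  -- multilinear, and the wedge is then a multiple of its alternatization.
  have key : ∀ [DecidableEq (Fin n × Fin 2)] (v : Fin n × Fin 2 → V) (k : Fin n) (c : Fin 2)
      (x : V), (∏ j, b j (Function.update v (k, c) x (j, 0)) (Function.update v (k, c) x (j, 1)))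
      = (if c = 0 then b k x (v (k, 1)) else b k (v (k, 0)) x)
        * ∏ j ∈ ({k}ᶜ : Finset (Fin n)), b j (v (j, 0)) (v (j, 1)) := by
    intro _ v k c x
    rw [Fintype.prod_eq_mul_prod_compl k]
    congr 1
    · fin_cases c <;> simp
    · refine Finset.prod_congr rfl fun j hj => ?_
      have hj : j ≠ k := by simpa using hj
      rw [Function.update_of_ne (by simp [hj]), Function.update_of_ne (by simp [hj])]
  let m : MultilinearMap ℝ (fun _ : Fin n × Fin 2 => V) ℂ :=
    { toFun := fun v => ∏ j, b j (v (j, 0)) (v (j, 1))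
      map_update_add' := by
        rintro _ v ⟨k, c⟩ x y
        rw [key, key, key, ← add_mul]
        split_ifs <;> simp
      map_update_smul' := by
        rintro _ v ⟨k, c⟩ a x
        rw [key, key]
        split_ifs <;> simp [mul_assoc] }
  refine ⟨((1 / 2 ^ n : ℝ)) • MultilinearMap.alternatization m, fun v => ?_⟩
  rw [AlternatingMap.smul_apply, MultilinearMap.alternatization_apply]
  simp only [wedge, m, MultilinearMap.domDomCongr_apply, MultilinearMap.coe_mk, Units.smul_def,
    zsmul_eq_mul, Complex.real_smul]
  push_cast
  rfl

/-- Since `ι` indexes a basis, the degree is the top one and a real alternating form is a multiple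
of the determinant of that basis. Complex values are reduced to real and imaginary parts. -/
theorem alternating_comp_linearMap {ι : Type*} [Fintype ι] [DecidableEq ι] [AddCommGroup V]
    [Module ℝ V] (e : Module.Basis ι ℝ V) (A : V [⋀^ι]→ₗ[ℝ] ℂ) (T : V →ₗ[ℝ] V) (v : ι → V) :
    A (fun i => T (v i)) = ((LinearMap.det T : ℝ) : ℂ) * A v := by
  have key : ∀ f : V [⋀^ι]→ₗ[ℝ] ℝ, f (fun i => T (v i)) = LinearMap.det T * f v := by
    intro f
    rw [f.eq_smul_basis_det e]
    have := e.det_comp T v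
    simp only [AlternatingMap.smul_apply, smul_eq_mul]
    rw [show (fun i => T (v i)) = T ∘ v from rfl, this]
    ring
  have hre := key (Complex.reLm.compAlternatingMap A)
  have him := key (Complex.imLm.compAlternatingMap A)
  simp only [LinearMap.compAlternatingMap_apply, Complex.reLm_coe, Complex.imLm_coe] at hre him
  apply Complex.ext
  · rw [hre]; simp
  · rw [him]; simp

theorem det_restrictScalars_eq_normSq [AddCommGroup V] [Module ℂ V] [FiniteDimensional ℂ V]
    (T : V →ₗ[ℂ] V) :
    LinearMap.det (T.restrictScalars ℝ) = Complex.normSq (LinearMap.det T) := by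
  rw [LinearMap.det_restrictScalars, Algebra.norm_complex_apply]

/-- Makes the index type `Fin n × Fin 2` of the wedge that of a real basis, so that `2n`-forms have
top degree and `alternating_comp_linearMap` applies. -/
theorem exists_real_basis [AddCommGroup V] [Module ℂ V] (e : Module.Basis (Fin n) ℂ V) :
    Nonempty (Module.Basis (Fin n × Fin 2) ℝ V) :=
  ⟨(Complex.basisOneI.smulTower e).reindex (Equiv.prodComm _ _)⟩

/-- `α ∧ βⁿ⁻¹` with the first factor singled out. -/
theorem wedge_first (hn : 1 ≤ n) (α β : V → V → ℂ) (v : Fin n × Fin 2 → V) :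
    wedge (fun k : Fin n => if k.val = 0 then α else β) v =
      (1 / 2 ^ n : ℂ) * ∑ σ : Equiv.Perm (Fin n × Fin 2), ((Equiv.Perm.sign σ : ℤ) : ℂ) *
        (α (v (σ (⟨0, hn⟩, 0))) (v (σ (⟨0, hn⟩, 1))) *
          ∏ k ∈ ({⟨0, hn⟩}ᶜ : Finset (Fin n)), β (v (σ (k, 0))) (v (σ (k, 1)))) := by
  unfold wedge
  congr 1
  refine Finset.sum_congr rfl fun σ _ => ?_
  rw [Fintype.prod_eq_mul_prod_compl (⟨0, hn⟩ : Fin n)]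
  congr 2
  refine Finset.prod_congr rfl fun k hk => ?_
  have : k.val ≠ 0 := by
    simpa [Fin.ext_iff] using hk
  simp [this]

theorem wedge_first_add (hn : 1 ≤ n) (α α' β : V → V → ℂ) (v : Fin n × Fin 2 → V) :
    wedge (fun k : Fin n => if k.val = 0 then (fun a b => α a b + α' a b) else β) v =
      wedge (fun k : Fin n => if k.val = 0 then α else β) v +
      wedge (fun k : Fin n => if k.val = 0 then α' else β) v := by
  simp only [wedge_first hn, ← mul_add, ← Finset.sum_add_distrib]
  congr 1
  refine Finset.sum_congr rfl fun σ _ => ?_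
  ring

theorem wedge_first_smul (hn : 1 ≤ n) (c : ℂ) (α β : V → V → ℂ) (v : Fin n × Fin 2 → V) :
    wedge (fun k : Fin n => if k.val = 0 then (fun a b => c * α a b) else β) v =
      c * wedge (fun k : Fin n => if k.val = 0 then α else β) v := by
  simp only [wedge_first hn, mul_left_comm c, Finset.mul_sum]
  refine Finset.sum_congr rfl fun σ _ => ?_
  ring

theorem wedge_first_sum (hn : 1 ≤ n) {ι : Type*} (s : Finset ι) (α : ι → V → V → ℂ)
    (β : V → V → ℂ) (v : Fin n × Fin 2 → V) :
    wedge (fun k : Fin n => if k.val = 0 then (fun a b => ∑ i ∈ s, α i a b) else β) v =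
      ∑ i ∈ s, wedge (fun k : Fin n => if k.val = 0 then α i else β) v := by
  simp only [wedge_first hn, Finset.mul_sum, Finset.sum_mul]
  rw [Finset.sum_comm]

/-- The matrix of the standard symplectic form. -/
def symp (x y : Fin n × Fin 2) : ℂ :=
  if x.1 = y.1 then (if x.2 = 0 ∧ y.2 = 1 then 1 else if x.2 = 1 ∧ y.2 = 0 then -1 else 0) else 0

/-- A nonzero product forces `σ` to map each pair `(k, 0), (k, 1)` onto such a pair. Then `σ` is a
permutation `q` of the pairs composed with permutations `τ k` inside them. The permutation `q` acts
on two copies of `Fin n`, so its sign enters squared, and the signs of the `τ k` cancel against the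
values of `symp`. -/
theorem sign_mul_prod_symp (σ : Equiv.Perm (Fin n × Fin 2)) :
    ((Equiv.Perm.sign σ : ℤ) : ℂ) * ∏ k : Fin n, symp (σ (k, 0)) (σ (k, 1)) = 0 ∨
    ((Equiv.Perm.sign σ : ℤ) : ℂ) * ∏ k : Fin n, symp (σ (k, 0)) (σ (k, 1)) = 1 := by
  by_cases h : ∀ k, (σ (k, 0)).1 = (σ (k, 1)).1
  swap
  · left
    push Not at h
    obtain ⟨k, hk⟩ := h
    rw [Finset.prod_eq_zero (Finset.mem_univ k) (by simp [symp, hk]), mul_zero]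
  right
  have hb : ∀ k (c : Fin 2), (σ (k, c)).1 = (σ (k, 0)).1 := by
    intro k c
    fin_cases c
    · rfl
    · exact (h k).symm
  have hτinj : ∀ k, Function.Injective fun c => (σ (k, c)).2 := by
    intro k c d hcd
    have : σ (k, c) = σ (k, d) := Prod.ext (by rw [hb, hb k d]) hcd
    exact (Prod.ext_iff.1 (σ.injective this)).2
  let τ : Fin n → Equiv.Perm (Fin 2) := fun k =>
    Equiv.ofBijective _ (Finite.injective_iff_bijective.1 (hτinj k))
  have hτ : ∀ k c, τ k c = (σ (k, c)).2 := fun k c => rfl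
  have hπinj : Function.Injective fun k => (σ (k, 0)).1 := by
    intro k l hkl
    have : σ (k, (τ k).symm 0) = σ (l, (τ l).symm 0) := by
      refine Prod.ext ?_ ?_
      · rw [hb, hb l]; exact hkl
      · rw [← hτ, ← hτ]; simp
    exact (Prod.ext_iff.1 (σ.injective this)).1
  let q : Equiv.Perm (Fin n) := Equiv.ofBijective _ (Finite.injective_iff_bijective.1 hπinj)
  have hσ : σ = (Equiv.prodCongrLeft fun _ : Fin 2 => q) * Equiv.prodCongrRight τ := by
    ext1 ⟨k, c⟩
    refine Prod.ext ?_ ?_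
    · exact hb k c
    · rfl
  have hsign : Equiv.Perm.sign σ = ∏ k, Equiv.Perm.sign (τ k) := by
    rw [hσ, map_mul, Equiv.Perm.sign_prodCongrLeft, Equiv.Perm.sign_prodCongrRight]
    simp
  have hterm : ∀ k, symp (σ (k, 0)) (σ (k, 1)) = ((Equiv.Perm.sign (τ k) : ℤ) : ℂ) := by
    intro k
    rw [symp, if_pos (h k), ← hτ, ← hτ]
    generalize τ k = ρ
    revert ρ
    have : ∀ ρ : Equiv.Perm (Fin 2), (ρ 0 = 0 ∧ ρ 1 = 1 ∧ Equiv.Perm.sign ρ = 1) ∨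
      (ρ 0 = 1 ∧ ρ 1 = 0 ∧ Equiv.Perm.sign ρ = -1) := by decide
    intro ρ
    rcases this ρ with ⟨h0, h1, hs⟩ | ⟨h0, h1, hs⟩ <;> rw [h0, h1, hs] <;> simp
  rw [hsign, Finset.prod_congr rfl fun k _ => hterm k]
  push_cast
  rw [← Finset.prod_mul_distrib]
  refine Finset.prod_eq_one fun k _ => ?_
  rcases Int.units_eq_one_or (Equiv.Perm.sign (τ k)) with h | h <;> rw [h] <;> simp

/-- No summand is negative and the identity contributes `1`; only positivity is needed, not the
value. -/
theorem sum_sign_mul_prod_symp_pos :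
    ∃ c : ℝ, 0 < c ∧ (∑ σ : Equiv.Perm (Fin n × Fin 2), ((Equiv.Perm.sign σ : ℤ) : ℂ) *
      ∏ k : Fin n, symp (σ (k, 0)) (σ (k, 1))) = c := by
  have : ∀ σ : Equiv.Perm (Fin n × Fin 2), ∃ c : ℝ, 0 ≤ c ∧ (σ = 1 → 0 < c) ∧
      ((Equiv.Perm.sign σ : ℤ) : ℂ) * ∏ k : Fin n, symp (σ (k, 0)) (σ (k, 1)) = c := by
    intro σ
    by_cases hσ : σ = 1
    · exact ⟨1, by norm_num, fun _ => by norm_num, by subst hσ; simp [symp]⟩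
    · rcases sign_mul_prod_symp σ with h | h
      · exact ⟨0, le_rfl, fun h' => absurd h' hσ, by simpa using h⟩
      · exact ⟨1, by norm_num, fun _ => by norm_num, by simpa using h⟩
  choose c h0 h1 h2 using this
  refine ⟨∑ σ, c σ, Finset.sum_pos' (fun σ _ => h0 σ) ⟨1, Finset.mem_univ _, h1 1 rfl⟩, ?_⟩
  rw [Finset.sum_congr rfl fun σ _ => h2 σ]
  push_cast
  rfl

/-- An orthonormal basis for the inner product `⟨x, y⟩ = B y x`. The arguments are swapped because
`inner` is conjugate-linear in its first variable whereas `B` is linear there. -/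
theorem exists_orthonormal [AddCommGroup V] [Module ℂ V] [FiniteDimensional ℂ V]
    (hV : Module.finrank ℂ V = n) (B : V →ₗ[ℂ] V →ₗ⋆[ℂ] ℂ)
    (hsymm : ∀ u v, (starRingEnd ℂ) (B u v) = B v u) (hpos : ∀ v, v ≠ 0 → 0 < (B v v).re) :
    ∃ e : Module.Basis (Fin n) ℂ V, ∀ a b, B (e a) (e b) = if a = b then 1 else 0 := by
  let core : InnerProductSpace.Core ℂ V :=
    { inner := fun x y => B y x
      conj_inner_symm := fun x y => hsymm _ _
      re_inner_nonneg := fun x => by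
        by_cases hx : x = 0
        · simp [hx]
        · exact (hpos x hx).le
      add_left := fun x y z => by simp
      smul_left := fun x y c => by simp
      definite := fun x hx => by
        by_contra hne
        have := hpos x hne
        simp [hx] at this }
  let _ : NormedAddCommGroup V := core.toNormedAddCommGroup
  let _ : InnerProductSpace ℂ V := InnerProductSpace.ofCore core.toCore
  let e := (stdOrthonormalBasis ℂ V).reindex (finCongr hV)
  refine ⟨e.toBasis, fun a b => ?_⟩
  have := orthonormal_iff_ite.1 e.orthonormal b a
  rw [OrthonormalBasis.coe_toBasis]
  change B (e a) (e b) = _ at this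
  rw [this]
  simp [eq_comm]

/-- The top power of the fundamental form of a Hermitian inner product is positive. -/
theorem wedge_fundForm_pos [AddCommGroup V] [Module ℂ V] (B : V →ₗ[ℂ] V →ₗ⋆[ℂ] ℂ)
    (hsymm : ∀ u v, (starRingEnd ℂ) (B u v) = B v u) (hpos : ∀ v, v ≠ 0 → 0 < (B v v).re)
    (u : Module.Basis (Fin n) ℂ V) :
    ∃ c : ℝ, 0 < c ∧ wedge (fun _ : Fin n => fun a b => ((-(B a b).im : ℝ) : ℂ))
      (fun kb => if kb.2 = 0 then u kb.1 else Complex.I • u kb.1) = c := by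
  have : FiniteDimensional ℂ V := u.finiteDimensional_of_finite
  obtain ⟨e, he⟩ := exists_orthonormal (n := n) (by simp [Module.finrank_eq_card_basis u]) B
    hsymm hpos
  let b : V →ₗ[ℝ] V →ₗ[ℝ] ℂ := LinearMap.mk₂ ℝ (fun a b => ((-(B a b).im : ℝ) : ℂ))
    (by intros; simp; ring) (by intros; simp) (by intros; simp; ring)
    (by
      intro c x y
      rw [← Complex.coe_smul c y, LinearMap.map_smulₛₗ]
      simp)
  obtain ⟨A, hA⟩ := exists_alternating_wedge (fun _ : Fin n => b)
  have hA' : ∀ v, wedge (fun _ : Fin n => fun a b => ((-(B a b).im : ℝ) : ℂ)) v = A v := hA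
  -- `T` carries the orthonormal basis to the given one. The value on the given basis is thus `|det
  -- T|²` times the value on the orthonormal basis, where the fundamental form is the standard
  -- symplectic form.
  let T : V →ₗ[ℂ] V := e.constr ℂ u
  have hT : ∀ k, T (e k) = u k := fun k => by simp [T]
  have hinj : LinearMap.det T ≠ 0 := by
    have : T = (e.equiv u (Equiv.refl _) : V ≃ₗ[ℂ] V) := e.ext fun i => by simp [T]
    rw [this]
    exact (LinearEquiv.isUnit_det' _).ne_zero
  obtain ⟨eR⟩ := exists_real_basis e
  obtain ⟨c, hc, hsum⟩ := sum_sign_mul_prod_symp_pos (n := n)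
  have hval : wedge (fun _ : Fin n => fun a b => ((-(B a b).im : ℝ) : ℂ))
      (fun kb => if kb.2 = 0 then e kb.1 else Complex.I • e kb.1) = ((1 / 2 ^ n * c : ℝ) : ℂ) := by
    rw [wedge]
    push_cast
    rw [← hsum]
    congr 1
    refine Finset.sum_congr rfl fun σ _ => ?_
    congr 1
    refine Finset.prod_congr rfl fun k _ => ?_
    generalize σ (k, 0) = x
    generalize σ (k, 1) = y
    obtain ⟨x, i⟩ := x
    obtain ⟨y, j⟩ := y
    fin_cases i <;> fin_cases j <;> by_cases hxy : x = y <;> simp [symp, he, hxy]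
  refine ⟨Complex.normSq (LinearMap.det T) * (1 / 2 ^ n * c), by
    have := Complex.normSq_pos.2 hinj
    positivity, ?_⟩
  have hcomp := alternating_comp_linearMap eR A (T.restrictScalars ℝ)
    (fun kb => if kb.2 = 0 then e kb.1 else Complex.I • e kb.1)
  rw [det_restrictScalars_eq_normSq, ← hA', ← hA', hval] at hcomp
  push_cast
  push_cast at hcomp
  rw [← hcomp]
  congr 1
  ext kb
  split_ifs with h
  · simp [hT]
  · simp [hT]

end Wedge

/-! ## Charts and coordinate vector fields -/

section Charts

variable {n : ℕ} {X : Type*} [TopologicalSpace X] [ChartedSpace (Fin n → ℂ) X]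

/-- The coordinate vector `u` of the chart at `p`, as a tangent vector at `x`. -/
def coordVec (p x : X) : (Fin n → ℂ) →L[ℂ] (Fin n → ℂ) :=
  fderiv ℂ (chartAt (Fin n → ℂ) x ∘ (chartAt (Fin n → ℂ) p).symm) (chartAt (Fin n → ℂ) p x)

theorem coordVec_self (x : X) (u : Fin n → ℂ) : coordVec x x u = u := by
  have h : (chartAt (Fin n → ℂ) x ∘ (chartAt (Fin n → ℂ) x).symm)
      =ᶠ[𝓝 (chartAt (Fin n → ℂ) x x)] id := by
    filter_upwards [(chartAt (Fin n → ℂ) x).open_target.mem_nhds (mem_chart_target _ x)] with z hz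
    simp [(chartAt (Fin n → ℂ) x).right_inv hz]
  unfold coordVec
  rw [h.fderiv_eq, fderiv_id]
  rfl

variable [IsManifold 𝓘(ℂ, Fin n → ℂ) ω X]

theorem contDiffAt_transition (p q : X) {z : Fin n → ℂ} (hz : z ∈ (chartAt (Fin n → ℂ) p).target)
    (hq : (chartAt (Fin n → ℂ) p).symm z ∈ (chartAt (Fin n → ℂ) q).source) :
    ContDiffAt ℂ ω (chartAt (Fin n → ℂ) q ∘ (chartAt (Fin n → ℂ) p).symm) z := by
  rw [← contMDiffAt_iff_contDiffAt]
  exact ((contMDiffOn_chart (I := 𝓘(ℂ, Fin n → ℂ)) (n := ω) (x := q)).contMDiffAt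
    ((chartAt (Fin n → ℂ) q).open_source.mem_nhds hq)).comp z
    ((contMDiffOn_chart_symm (I := 𝓘(ℂ, Fin n → ℂ)) (n := ω) (x := p)).contMDiffAt
    ((chartAt (Fin n → ℂ) p).open_target.mem_nhds hz))

variable (n X) in
-- Holomorphic transition maps are real analytic. The real structure is needed because metrics,
-- orthogonal projections and cutoff functions are merely smooth.
theorem isManifold_real : IsManifold 𝓘(ℝ, Fin n → ℂ) ω X := by
  refine isManifold_of_contDiffOn _ _ _ fun e e' he he' => ?_
  have h := ((contDiffGroupoid ω 𝓘(ℂ, Fin n → ℂ)).compatible he he').1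
  exact ContDiffOn.restrict_scalars ℝ h

instance isManifold_real_smooth : IsManifold 𝓘(ℝ, Fin n → ℂ) ∞ X :=
  have := isManifold_real n X
  IsManifold.of_le (n := ω) (by simp)

/-- The tangent space at a point is the model space by way of the preferred chart at that point, so
the manifold derivative of an inverse chart is the derivative of a transition map. -/
theorem chartVec_eq (p : X) {z : Fin n → ℂ} (hz : z ∈ (chartAt (Fin n → ℂ) p).target)
    (u : Fin n → ℂ) : chartVec p z u = coordVec p ((chartAt (Fin n → ℂ) p).symm z) u := by
  have hd : MDifferentiableAt 𝓘(ℂ, Fin n → ℂ) 𝓘(ℂ, Fin n → ℂ) (chartAt (Fin n → ℂ) p).symm z :=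
    ((contMDiffOn_chart_symm (I := 𝓘(ℂ, Fin n → ℂ)) (n := ω) (x := p)).contMDiffAt
    ((chartAt (Fin n → ℂ) p).open_target.mem_nhds hz)).mdifferentiableAt (by simp)
  refine (DFunLike.congr_fun hd.mfderiv u).trans ?_
  unfold coordVec
  rw [(chartAt (Fin n → ℂ) p).right_inv hz]
  change fderivWithin ℂ (chartAt (Fin n → ℂ) ((chartAt (Fin n → ℂ) p).symm z) ∘
    (chartAt (Fin n → ℂ) p).symm) (range id) z u = _
  rw [range_id, fderivWithin_univ]

theorem coordVec_comp (p q x : X) (hp : x ∈ (chartAt (Fin n → ℂ) p).source)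
    (hq : x ∈ (chartAt (Fin n → ℂ) q).source) (u : Fin n → ℂ) :
    coordVec p x u = coordVec q x (fderiv ℂ (chartAt (Fin n → ℂ) q ∘ (chartAt (Fin n → ℂ) p).symm)
      (chartAt (Fin n → ℂ) p x) u) := by
  unfold coordVec
  have hx := (chartAt (Fin n → ℂ) p).left_inv hp
  have h1 : DifferentiableAt ℂ (chartAt (Fin n → ℂ) q ∘ (chartAt (Fin n → ℂ) p).symm)
      (chartAt (Fin n → ℂ) p x) := (contDiffAt_transition p q
        ((chartAt (Fin n → ℂ) p).map_source hp) (by rwa [hx])).differentiableAt (by simp)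
  have h2 : DifferentiableAt ℂ (chartAt (Fin n → ℂ) x ∘ (chartAt (Fin n → ℂ) q).symm)
      ((chartAt (Fin n → ℂ) q ∘ (chartAt (Fin n → ℂ) p).symm) (chartAt (Fin n → ℂ) p x)) := by
    rw [Function.comp_apply, hx]
    exact (contDiffAt_transition q x ((chartAt (Fin n → ℂ) q).map_source hq)
      (by rw [(chartAt (Fin n → ℂ) q).left_inv hq]; exact mem_chart_source _ x)).differentiableAt
      (by simp)
  have h3 : (chartAt (Fin n → ℂ) x ∘ (chartAt (Fin n → ℂ) p).symm)
      =ᶠ[𝓝 (chartAt (Fin n → ℂ) p x)] (chartAt (Fin n → ℂ) x ∘ (chartAt (Fin n → ℂ) q).symm) ∘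
        (chartAt (Fin n → ℂ) q ∘ (chartAt (Fin n → ℂ) p).symm) := by
    have hopen : (chartAt (Fin n → ℂ) p).target ∩ (chartAt (Fin n → ℂ) p).symm ⁻¹'
        (chartAt (Fin n → ℂ) q).source ∈ 𝓝 (chartAt (Fin n → ℂ) p x) :=
      ((chartAt (Fin n → ℂ) p).isOpen_inter_preimage_symm
        (chartAt (Fin n → ℂ) q).open_source).mem_nhds
        ⟨(chartAt (Fin n → ℂ) p).map_source hp, by simpa [hx] using hq⟩
    filter_upwards [hopen] with z hz
    simp only [Function.comp_apply]
    rw [(chartAt (Fin n → ℂ) q).left_inv hz.2]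
  rw [h3.fderiv_eq, fderiv_comp _ h2 h1, Function.comp_apply, hx]
  rfl

theorem fderiv_transition_leftInverse (p x : X) (hp : x ∈ (chartAt (Fin n → ℂ) p).source)
    (u : Fin n → ℂ) :
    fderiv ℂ (chartAt (Fin n → ℂ) p ∘ (chartAt (Fin n → ℂ) x).symm)
      (chartAt (Fin n → ℂ) x x) (coordVec p x u) = u := by
  have hx := mem_chart_source (Fin n → ℂ) x
  have h := coordVec_comp p p x hp hp u
  have h1 : DifferentiableAt ℂ (chartAt (Fin n → ℂ) x ∘ (chartAt (Fin n → ℂ) p).symm)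
      (chartAt (Fin n → ℂ) p x) := (contDiffAt_transition p x
        ((chartAt (Fin n → ℂ) p).map_source hp)
        (by rwa [(chartAt (Fin n → ℂ) p).left_inv hp])).differentiableAt (by simp)
  have h2 : DifferentiableAt ℂ (chartAt (Fin n → ℂ) p ∘ (chartAt (Fin n → ℂ) x).symm)
      ((chartAt (Fin n → ℂ) x ∘ (chartAt (Fin n → ℂ) p).symm) (chartAt (Fin n → ℂ) p x)) := by
    rw [Function.comp_apply, (chartAt (Fin n → ℂ) p).left_inv hp]
    exact (contDiffAt_transition x p ((chartAt (Fin n → ℂ) x).map_source hx)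
      (by rwa [(chartAt (Fin n → ℂ) x).left_inv hx])).differentiableAt
      (by simp)
  have h3 : (chartAt (Fin n → ℂ) p ∘ (chartAt (Fin n → ℂ) x).symm) ∘
        (chartAt (Fin n → ℂ) x ∘ (chartAt (Fin n → ℂ) p).symm)
        =ᶠ[𝓝 (chartAt (Fin n → ℂ) p x)] id := by
    have hopen : (chartAt (Fin n → ℂ) p).target ∩ (chartAt (Fin n → ℂ) p).symm ⁻¹'
        (chartAt (Fin n → ℂ) x).source ∈ 𝓝 (chartAt (Fin n → ℂ) p x) :=
      ((chartAt (Fin n → ℂ) p).isOpen_inter_preimage_symm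
        (chartAt (Fin n → ℂ) x).open_source).mem_nhds
        ⟨(chartAt (Fin n → ℂ) p).map_source hp,
          by simp [(chartAt (Fin n → ℂ) p).left_inv hp]⟩
    filter_upwards [hopen] with z hz
    simp only [Function.comp_apply]
    rw [(chartAt (Fin n → ℂ) x).left_inv hz.2, (chartAt (Fin n → ℂ) p).right_inv hz.1]
    rfl
  have h4 := h3.fderiv_eq (𝕜 := ℂ)
  rw [fderiv_comp _ h2 h1, fderiv_id, Function.comp_apply,
    (chartAt (Fin n → ℂ) p).left_inv hp] at h4
  exact DFunLike.congr_fun h4 u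

theorem coordVec_injective (p x : X) (hp : x ∈ (chartAt (Fin n → ℂ) p).source) :
    Function.Injective (coordVec (n := n) p x) :=
  Function.LeftInverse.injective (fderiv_transition_leftInverse p x hp)

/-- Coordinate vector fields are holomorphic. -/
theorem isHolOn_coordVec (p : X) (u : Fin n → ℂ) :
    IsHolOn n n (E := fun x : X => TangentSpace 𝓘(ℂ, Fin n → ℂ) x) (fun x : X => coordVec (n := n) p x u)
      (chartAt (Fin n → ℂ) p).source := by
  have hb : (trivializationAt (Fin n → ℂ) (TangentSpace 𝓘(ℂ, Fin n → ℂ)) p).baseSet =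
    (chartAt (Fin n → ℂ) p).source := TangentBundle.trivializationAt_baseSet p
  rw [← hb]
  refine (Bundle.Trivialization.contMDiffOn_section_baseSet_iff (IB := 𝓘(ℂ, Fin n → ℂ)) (n := ω)
    (F := Fin n → ℂ) (E := fun x : X => TangentSpace 𝓘(ℂ, Fin n → ℂ) x) (s := fun x => coordVec (n := n) p x u)
    (trivializationAt (Fin n → ℂ) (TangentSpace 𝓘(ℂ, Fin n → ℂ)) p)).2 ?_
  refine (contMDiffOn_const (c := u)).congr fun x hx => ?_
  rw [hb] at hx
  rw [TangentBundle.trivializationAt_apply]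
  simpa using fderiv_transition_leftInverse p x hx u

theorem contDiffOn_comp_chart_symm {F : Type*} [NormedAddCommGroup F] [NormedSpace ℝ F]
    {f : X → F} {U : Set X}
    (hf : ContMDiffOn 𝓘(ℝ, Fin n → ℂ) 𝓘(ℝ, F) ∞ f U) (p : X) :
    ContDiffOn ℝ ∞ (f ∘ (chartAt (Fin n → ℂ) p).symm)
      ((chartAt (Fin n → ℂ) p).target ∩ (chartAt (Fin n → ℂ) p).symm ⁻¹' U) := by
  rw [← contMDiffOn_iff_contDiffOn]
  exact hf.comp ((contMDiffOn_chart_symm (I := 𝓘(ℝ, Fin n → ℂ)) (n := ∞) (x := p)).mono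
    inter_subset_left) inter_subset_right

theorem contDiffAt_comp_chart_symm {F : Type*} [NormedAddCommGroup F] [NormedSpace ℝ F]
    {f : X → F} {U : Set X} (hU : IsOpen U)
    (hf : ContMDiffOn 𝓘(ℝ, Fin n → ℂ) 𝓘(ℝ, F) ∞ f U) (p : X) {z : Fin n → ℂ}
    (hz : z ∈ (chartAt (Fin n → ℂ) p).target) (hz' : (chartAt (Fin n → ℂ) p).symm z ∈ U) :
    ContDiffAt ℝ ∞ (f ∘ (chartAt (Fin n → ℂ) p).symm) z :=
  (contDiffOn_comp_chart_symm hf p).contDiffAt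
    (((chartAt (Fin n → ℂ) p).isOpen_inter_preimage_symm hU).mem_nhds ⟨hz, hz'⟩)

/-- The Kähler form in the coordinates of a chart. -/
theorem contDiffOn_fundForm (g : TangentMetric n X) (p : X) (u v : Fin n → ℂ) :
    ContDiffOn ℝ ∞ (fun z => g.fundForm ((chartAt (Fin n → ℂ) p).symm z)
      (coordVec p ((chartAt (Fin n → ℂ) p).symm z) u)
      (coordVec p ((chartAt (Fin n → ℂ) p).symm z) v)) (chartAt (Fin n → ℂ) p).target := by
  have h := contDiffOn_comp_chart_symm
    (g.smooth _ (chartAt (Fin n → ℂ) p).open_source _ _ (isHolOn_coordVec p u)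
      (isHolOn_coordVec p v)) p
  have hsub : (chartAt (Fin n → ℂ) p).target ∩ (chartAt (Fin n → ℂ) p).symm ⁻¹'
      (chartAt (Fin n → ℂ) p).source = (chartAt (Fin n → ℂ) p).target :=
    inter_eq_left.2 fun z hz => (chartAt (Fin n → ℂ) p).map_target hz
  rw [hsub] at h
  have h2 := (Complex.ofRealCLM.contDiff (n := ∞)).comp_contDiffOn
    ((Complex.imCLM.contDiff (n := ∞)).comp_contDiffOn h).neg
  exact h2

theorem density_eq (θ : TopForm n X) (p : X) {z : Fin n → ℂ}
    (hz : z ∈ (chartAt (Fin n → ℂ) p).target) :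
    θ.density p z = θ ((chartAt (Fin n → ℂ) p).symm z) fun kb =>
      coordVec p ((chartAt (Fin n → ℂ) p).symm z)
        (Pi.single kb.1 (if kb.2 = 0 then 1 else Complex.I)) := by
  unfold TopForm.density
  congr 1
  ext1 kb
  exact chartVec_eq p hz _

/-- The standard real frame of `ℂⁿ`. -/
def stdFrame (n : ℕ) (kb : Fin n × Fin 2) : Fin n → ℂ :=
  Pi.single kb.1 (if kb.2 = 0 then 1 else Complex.I)

theorem density_chart (θ : TopForm n X) (p : X) {x : X} (hx : x ∈ (chartAt (Fin n → ℂ) p).source) :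
    θ.density p (chartAt (Fin n → ℂ) p x) = θ x fun kb => coordVec p x (stdFrame n kb) := by
  rw [density_eq θ p ((chartAt (Fin n → ℂ) p).map_source hx)]
  generalize hy : (chartAt (Fin n → ℂ) p).symm (chartAt (Fin n → ℂ) p x) = y
  rw [(chartAt (Fin n → ℂ) p).left_inv hx] at hy
  subst hy
  rfl

end Charts

/-! ## Integration of top forms -/

section Integration

variable {n : ℕ} {X : Type*} [TopologicalSpace X] [ChartedSpace (Fin n → ℂ) X]

/-- `θ` is alternating and real-multilinear at every point. -/
def TopForm.IsAlt (θ : TopForm n X) : Prop :=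
  ∀ x, ∃ A : (Fin n → ℂ) [⋀^Fin n × Fin 2]→ₗ[ℝ] ℂ, ∀ v : Fin n × Fin 2 → (Fin n → ℂ), θ x v = A v

/-- `θ` has continuous densities in all charts. -/
def TopForm.IsCont (θ : TopForm n X) : Prop :=
  ∀ p, ContinuousOn (θ.density p) (chartAt (Fin n → ℂ) p).target

/-- The product of a function and a top form. -/
def TopForm.fmul (f : X → ℂ) (θ : TopForm n X) : TopForm n X := fun x v => f x * θ x v

theorem TopForm.IsAlt.fmul {θ : TopForm n X} (hθ : θ.IsAlt) (f : X → ℂ) : (θ.fmul f).IsAlt := by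
  intro x
  obtain ⟨A, hA⟩ := hθ x
  exact ⟨f x • A, fun v => by simp [TopForm.fmul, hA]⟩

theorem TopForm.IsCont.fmul {θ : TopForm n X} (hθ : θ.IsCont) {f : X → ℂ} (hf : Continuous f) :
    (θ.fmul f).IsCont := fun p =>
  (hf.comp_continuousOn (chartAt (Fin n → ℂ) p).continuousOn_symm).mul (hθ p)

/-- A continuous density may blow up towards the boundary of the chart; integrability comes from the
support in `K`, whose image in the chart is compact. -/
theorem TopForm.integrableOn_density [CompactSpace X] {θ : TopForm n X} (hθ : θ.IsCont) {K : Set X}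
    (hK : IsClosed K) (p : X) (hKp : K ⊆ (chartAt (Fin n → ℂ) p).source)
    (h0 : ∀ x ∉ K, ∀ v, θ x v = 0) :
    IntegrableOn (θ.density p) (chartAt (Fin n → ℂ) p).target := by
  have hcomp : IsCompact (chartAt (Fin n → ℂ) p '' K) :=
    hK.isCompact.image_of_continuousOn ((chartAt (Fin n → ℂ) p).continuousOn.mono hKp)
  have hsub : chartAt (Fin n → ℂ) p '' K ⊆ (chartAt (Fin n → ℂ) p).target := by
    rintro _ ⟨x, hx, rfl⟩
    exact (chartAt (Fin n → ℂ) p).map_source (hKp hx)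
  refine (((hθ p).mono hsub).integrableOn_compact hcomp).of_forall_sdiff_eq_zero
    (chartAt (Fin n → ℂ) p).open_target.measurableSet fun z hz => ?_
  refine h0 _ (fun hmem => hz.2 ⟨_, hmem, (chartAt (Fin n → ℂ) p).right_inv hz.1⟩) _

variable [IsManifold 𝓘(ℂ, Fin n → ℂ) ω X]

/-- The real determinant of a complex linear map is `|det|²`, hence nonnegative: densities change by
the absolute Jacobian, which is the orientability of a complex manifold. -/
theorem TopForm.IsAlt.density_transition {θ : TopForm n X} (hθ : θ.IsAlt) (p q x : X)
    (hp : x ∈ (chartAt (Fin n → ℂ) p).source) (hq : x ∈ (chartAt (Fin n → ℂ) q).source) :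
    θ.density p (chartAt (Fin n → ℂ) p x) =
      (Complex.normSq (LinearMap.det (fderiv ℂ (chartAt (Fin n → ℂ) q ∘
        (chartAt (Fin n → ℂ) p).symm) (chartAt (Fin n → ℂ) p x) :
          (Fin n → ℂ) →ₗ[ℂ] (Fin n → ℂ))) : ℂ) *
      θ.density q (chartAt (Fin n → ℂ) q x) := by
  obtain ⟨A, hA⟩ := hθ x
  obtain ⟨e⟩ := exists_real_basis (Pi.basisFun ℂ (Fin n))
  rw [density_chart θ p hp, density_chart θ q hq, hA, hA]
  simp only [coordVec_comp p q x hp hq]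
  rw [← det_restrictScalars_eq_normSq]
  exact alternating_comp_linearMap e (A.compLinearMap
    ((coordVec (n := n) q x : (Fin n → ℂ) →ₗ[ℂ] (Fin n → ℂ)).restrictScalars ℝ))
    ((fderiv ℂ (chartAt (Fin n → ℂ) q ∘ (chartAt (Fin n → ℂ) p).symm) (chartAt (Fin n → ℂ) p x) :
      (Fin n → ℂ) →ₗ[ℂ] (Fin n → ℂ)).restrictScalars ℝ) (stdFrame n)

/-- Both integrals only see the overlap of the charts, and there the change of variables formula
matches `density_transition`. -/
theorem TopForm.IsAlt.integral_chart_change {θ : TopForm n X} (hθ : θ.IsAlt) (p q : X)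
    (h0 : ∀ x, x ∉ (chartAt (Fin n → ℂ) p).source ∩ (chartAt (Fin n → ℂ) q).source →
      ∀ v, θ x v = 0) :
    ∫ z in (chartAt (Fin n → ℂ) p).target, θ.density p z =
      ∫ z in (chartAt (Fin n → ℂ) q).target, θ.density q z := by
  set P := chartAt (Fin n → ℂ) p with hP
  set Q := chartAt (Fin n → ℂ) q with hQ
  have hTp : IsOpen (P.target ∩ P.symm ⁻¹' Q.source) := P.isOpen_inter_preimage_symm Q.open_source
  have hTq : IsOpen (Q.target ∩ Q.symm ⁻¹' P.source) := Q.isOpen_inter_preimage_symm P.open_source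
  have hsp : ∫ z in P.target, θ.density p z =
      ∫ z in P.target ∩ P.symm ⁻¹' Q.source, θ.density p z := by
    refine setIntegral_eq_of_subset_of_forall_sdiff_eq_zero P.open_target.measurableSet
      inter_subset_left fun z hz => ?_
    exact h0 _ (fun h => hz.2 ⟨hz.1, h.2⟩) _
  have hsq : ∫ z in Q.target, θ.density q z =
      ∫ z in Q.target ∩ Q.symm ⁻¹' P.source, θ.density q z := by
    refine setIntegral_eq_of_subset_of_forall_sdiff_eq_zero Q.open_target.measurableSet
      inter_subset_left fun z hz => ?_
    exact h0 _ (fun h => hz.2 ⟨hz.1, h.1⟩) _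
  have himg : (Q ∘ P.symm) '' (P.target ∩ P.symm ⁻¹' Q.source) = Q.target ∩ Q.symm ⁻¹' P.source := by
    ext w
    constructor
    · rintro ⟨z, ⟨hz, hz'⟩, rfl⟩
      refine ⟨Q.map_source hz', ?_⟩
      simp only [mem_preimage, Function.comp_apply, Q.left_inv hz']
      exact P.map_target hz
    · rintro ⟨hw, hw'⟩
      refine ⟨P (Q.symm w), ⟨P.map_source hw', ?_⟩, ?_⟩
      · simp only [mem_preimage, P.left_inv hw']
        exact Q.map_target hw
      · simp only [Function.comp_apply, P.left_inv hw', Q.right_inv hw]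
  have hinj : InjOn (Q ∘ P.symm) (P.target ∩ P.symm ⁻¹' Q.source) := by
    intro z hz w hw h
    exact P.symm.injOn hz.1 hw.1 (Q.injOn hz.2 hw.2 h)
  rw [hsp, hsq, ← himg, integral_image_eq_integral_abs_det_fderiv_smul volume hTp.measurableSet
    (f' := fun z => (fderiv ℂ (Q ∘ P.symm) z).restrictScalars ℝ)
    (fun z hz => ((((contDiffAt_transition p q hz.1 hz.2).differentiableAt
      (by simp)).hasFDerivAt).restrictScalars ℝ).hasFDerivWithinAt) hinj]
  refine setIntegral_congr_fun hTp.measurableSet fun z hz => ?_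
  have h := hθ.density_transition p q (P.symm z) (P.map_target hz.1) hz.2
  rw [← hP, ← hQ, P.right_inv hz.1] at h
  have hdet : ((fderiv ℂ (Q ∘ P.symm) z).restrictScalars ℝ).det =
      Complex.normSq (LinearMap.det (fderiv ℂ (Q ∘ P.symm) z : (Fin n → ℂ) →ₗ[ℂ] (Fin n → ℂ))) :=
    det_restrictScalars_eq_normSq _
  simp only [hdet, abs_of_nonneg (Complex.normSq_nonneg _)]
  rw [h, Complex.real_smul]
  rfl

variable [CompactSpace X] [T2Space X]

variable (n X) in
/-- The partition of unity in the definition of the integral. -/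
def part : PartitionOfUnity X X univ := (exists_partition n X).choose

theorem part_subordinate (p : X) : tsupport (part n X p) ⊆ (chartAt (Fin n → ℂ) p).source :=
  (exists_partition n X).choose_spec p

/-- The part of `θ` in the chart at `p`. -/
def TopForm.piece (θ : TopForm n X) (p : X) : TopForm n X := θ.fmul fun x => (part n X p x : ℂ)

theorem TopForm.IsCont.piece {θ : TopForm n X} (hθ : θ.IsCont) (p : X) : (θ.piece p).IsCont :=
  hθ.fmul (by fun_prop)

theorem TopForm.piece_eq_zero (θ : TopForm n X) (p : X) (x : X) (hx : x ∉ tsupport (part n X p))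
    (v) : θ.piece p x v = 0 := by
  simp [TopForm.piece, TopForm.fmul, image_eq_zero_of_notMem_tsupport hx]

variable (n X) in
/-- The indices of the nonzero functions of the partition of unity. -/
def partIndex : Finset X :=
  ((part n X).locallyFinite.finite_nonempty_of_compact).toFinset

theorem part_eq_zero {p : X} (hp : p ∉ partIndex n X) (x : X) : part n X p x = 0 := by
  by_contra h
  exact hp (((part n X).locallyFinite.finite_nonempty_of_compact).mem_toFinset.2 ⟨x, h⟩)

theorem sum_part (x : X) : ∑ p ∈ partIndex n X, part n X p x = 1 := by
  rw [← (part n X).sum_eq_one (mem_univ x)]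
  refine (finsum_eq_sum_of_support_subset _ fun p hp => ?_).symm
  by_contra h
  exact hp (part_eq_zero h x)

theorem TopForm.integral_eq_sum (θ : TopForm n X) :
    θ.integral = ∑ p ∈ partIndex n X, ∫ z in (chartAt (Fin n → ℂ) p).target,
      (θ.piece p).density p z := by
  refine finsum_eq_sum_of_support_subset _ fun p hp => ?_
  by_contra h
  refine hp ?_
  have : ∀ x, (exists_partition n X).choose p x = 0 := part_eq_zero h
  simp [this]

theorem TopForm.IsCont.integrableOn_piece {θ : TopForm n X} (hθ : θ.IsCont) (p : X) :
    IntegrableOn ((θ.piece p).density p) (chartAt (Fin n → ℂ) p).target :=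
  TopForm.integrableOn_density (hθ.piece p) (isClosed_tsupport _) p (part_subordinate p)
    (θ.piece_eq_zero p)

theorem TopForm.integral_sum {ι : Type*} (s : Finset ι) (θ : ι → TopForm n X)
    (hθ : ∀ i ∈ s, (θ i).IsCont) :
    TopForm.integral (fun x v => ∑ i ∈ s, θ i x v : TopForm n X) =
      ∑ i ∈ s, (θ i).integral := by
  simp only [TopForm.integral_eq_sum]
  rw [Finset.sum_comm]
  refine Finset.sum_congr rfl fun p _ => ?_
  rw [← integral_finsetSum _ fun i hi => (hθ i hi).integrableOn_piece p]
  congr 1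
  ext z
  simp only [TopForm.density, TopForm.piece, TopForm.fmul, Finset.mul_sum]

theorem TopForm.integral_const_mul (c : ℂ) (θ : TopForm n X) :
    TopForm.integral (fun x v => c * θ x v : TopForm n X) = c * θ.integral := by
  simp only [TopForm.integral_eq_sum, Finset.mul_sum]
  refine Finset.sum_congr rfl fun p _ => ?_
  rw [← MeasureTheory.integral_const_mul]
  congr 1
  ext z
  simp only [TopForm.density, TopForm.piece, TopForm.fmul, mul_left_comm]

/-- The integral of a top form supported in the domain of a chart. -/
theorem TopForm.integral_eq_of_support {θ : TopForm n X} (hθ : θ.IsAlt) (hθ' : θ.IsCont) {K : Set X}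
    (hK : IsClosed K) (q : X) (hKq : K ⊆ (chartAt (Fin n → ℂ) q).source)
    (h0 : ∀ x ∉ K, ∀ v, θ x v = 0) :
    θ.integral = ∫ z in (chartAt (Fin n → ℂ) q).target, θ.density q z := by
  rw [TopForm.integral_eq_sum]
  -- Each piece lives in the overlap of the charts at `p` and `q`. It can be integrated in the chart
  -- at `q`, where the functions of the partition add up to one.
  have h1 : ∀ p ∈ partIndex n X, ∫ z in (chartAt (Fin n → ℂ) p).target, (θ.piece p).density p z =
      ∫ z in (chartAt (Fin n → ℂ) q).target, (θ.piece p).density q z := by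
    intro p _
    refine TopForm.IsAlt.integral_chart_change (hθ.fmul _) p q fun x hx v => ?_
    by_cases hxp : x ∈ tsupport (part n X p)
    · have hxK : x ∉ K := fun hxK => hx ⟨part_subordinate p hxp, hKq hxK⟩
      simp [TopForm.fmul, h0 x hxK]
    · exact θ.piece_eq_zero p x hxp v
  rw [Finset.sum_congr rfl h1, ← integral_finsetSum]
  · refine setIntegral_congr_fun (chartAt (Fin n → ℂ) q).open_target.measurableSet fun z _ => ?_
    simp only [TopForm.density, TopForm.piece, TopForm.fmul, ← Finset.sum_mul]
    rw [← Complex.ofReal_sum, sum_part]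
    simp
  · intro p _
    refine TopForm.integrableOn_density (hθ'.piece p) hK q hKq fun x hx v => ?_
    simp [TopForm.piece, TopForm.fmul, h0 x hx]

end Integration

/-! ## Stokes' theorem for `dβ ∧ ωⁿ⁻¹` in coordinates -/

section LocalStokes

variable {n : ℕ}

/-- Integration by parts against the constant function `1`. -/
theorem integral_fderiv_eq_zero {f : (Fin n → ℂ) → ℂ} (hf : ContDiff ℝ 1 f)
    (hc : HasCompactSupport f) (v : Fin n → ℂ) : ∫ z, fderiv ℝ f z v = 0 := by
  have hf' : Continuous fun z => fderiv ℝ f z v := (hf.continuous_fderiv (by simp)).clm_apply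
    continuous_const
  have h := integral_mul_fderiv_eq_neg_fderiv_mul_of_integrable (μ := (volume : Measure (Fin n → ℂ)))
    (f := fun _ => (1 : ℂ)) (g := f) (v := v)
    (by simp) (by
      simp only [one_mul]
      exact hf'.integrable_of_hasCompactSupport (hc.fderiv_apply ℝ v))
    (by simp only [one_mul]; exact hf.continuous.integrable_of_hasCompactSupport hc)
    (fun _ _ => by fun_prop) (fun z _ => hf.differentiable (by simp) z)
  simpa using h

theorem sum_sign_swap {M : Type*} [AddCommGroup M] [Module ℂ M] {ι : Type*} [Fintype ι]
    [DecidableEq ι] (T : Equiv.Perm ι → M) (τ : Equiv.Perm ι) :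
    ∑ σ : Equiv.Perm ι, ((Equiv.Perm.sign σ : ℤ) : ℂ) • T (σ * τ) =
      ((Equiv.Perm.sign τ : ℤ) : ℂ) • ∑ σ : Equiv.Perm ι, ((Equiv.Perm.sign σ : ℤ) : ℂ) • T σ := by
  rw [Finset.smul_sum]
  refine Fintype.sum_equiv (Equiv.mulRight τ) _ _ fun σ => ?_
  simp only [Equiv.coe_mulRight, smul_smul, map_mul]
  congr 1
  push_cast
  rw [mul_left_comm, ← Int.cast_mul (Equiv.Perm.sign τ : ℤ), Int.units_coe_mul_self]
  simp

/-- The antisymmetrization of a function with vanishing cyclic sums vanishes. -/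
theorem sum_sign_cyclic {ι : Type*} [Fintype ι] [DecidableEq ι] (T : Equiv.Perm ι → ℂ)
    {a b c : ι} (hab : a ≠ b) (hbc : b ≠ c)
    (hT : ∀ σ, T σ + T (σ * (Equiv.swap a b * Equiv.swap b c))
      + T (σ * (Equiv.swap a b * Equiv.swap b c) * (Equiv.swap a b * Equiv.swap b c)) = 0) :
    ∑ σ : Equiv.Perm ι, ((Equiv.Perm.sign σ : ℤ) : ℂ) * T σ = 0 := by
  -- The three-cycle `τ` is even, so precomposition with `τ` or `τ²` does not change the
  -- antisymmetrization, and three equal sums add up to zero.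
  set τ := Equiv.swap a b * Equiv.swap b c
  have hτ : Equiv.Perm.sign τ = 1 := by
    simp [τ, Equiv.Perm.sign_swap hab, Equiv.Perm.sign_swap hbc]
  have h1 := sum_sign_swap T τ
  have h2 := sum_sign_swap (fun σ => T (σ * τ)) τ
  simp only [hτ, smul_eq_mul, Units.val_one, Int.cast_one, one_mul] at h1 h2
  have h3 : ∑ σ : Equiv.Perm ι, ((Equiv.Perm.sign σ : ℤ) : ℂ) *
      (T σ + T (σ * τ) + T (σ * τ * τ)) = 0 :=
    Finset.sum_eq_zero fun σ _ => by rw [hT σ, mul_zero]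
  simp only [mul_add, Finset.sum_add_distrib] at h3
  rw [h2, h1] at h3
  linear_combination (1 / 3 : ℂ) * h3

variable {U : Set (Fin n → ℂ)} {b : (Fin n → ℂ) → (Fin n → ℂ) → ℂ}
  {w : (Fin n → ℂ) → (Fin n → ℂ) → (Fin n → ℂ) → ℂ}

/-- The pointwise identity `d(b ∧ wⁿ⁻¹) = db ∧ wⁿ⁻¹` for closed `w`. The factor `2` arises because
the two terms of `db` are exchanged, up to the sign of the permutation, by swapping the two
arguments of the first slot. Terms in which a factor `w` is differentiated cancel in threes by
closedness. -/
theorem sum_sign_fderiv_wedge (hn : 1 ≤ n) {z : Fin n → ℂ}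
    (hb : ∀ u, DifferentiableAt ℝ (fun z => b z u) z)
    (hw : ∀ u v, DifferentiableAt ℝ (fun z => w z u v) z)
    (hclosed : ∀ u v t, fderiv ℝ (fun z => w z v t) z u + fderiv ℝ (fun z => w z t u) z v
      + fderiv ℝ (fun z => w z u v) z t = 0) (v : Fin n × Fin 2 → (Fin n → ℂ)) :
    ∑ σ : Equiv.Perm (Fin n × Fin 2), ((Equiv.Perm.sign σ : ℤ) : ℂ) *
      ((fderiv ℝ (fun z => b z (v (σ (⟨0, hn⟩, 1)))) z (v (σ (⟨0, hn⟩, 0)))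
        - fderiv ℝ (fun z => b z (v (σ (⟨0, hn⟩, 0)))) z (v (σ (⟨0, hn⟩, 1)))) *
        ∏ k ∈ ({⟨0, hn⟩}ᶜ : Finset (Fin n)), w z (v (σ (k, 0))) (v (σ (k, 1)))) =
    2 * ∑ σ : Equiv.Perm (Fin n × Fin 2), ((Equiv.Perm.sign σ : ℤ) : ℂ) *
      fderiv ℝ (fun z => b z (v (σ (⟨0, hn⟩, 1))) *
        ∏ k ∈ ({⟨0, hn⟩}ᶜ : Finset (Fin n)), w z (v (σ (k, 0))) (v (σ (k, 1)))) z
        (v (σ (⟨0, hn⟩, 0))) := by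
  set o : Fin n := ⟨0, hn⟩ with ho
  set S : Finset (Fin n) := {o}ᶜ with hS
  have hSo : ∀ k ∈ S, k ≠ o := fun k hk => by simpa [hS] using hk
  let T1 : Equiv.Perm (Fin n × Fin 2) → ℂ := fun σ =>
    fderiv ℝ (fun z => b z (v (σ (o, 1)))) z (v (σ (o, 0))) *
      ∏ k ∈ S, w z (v (σ (k, 0))) (v (σ (k, 1)))
  have hT1 : ∑ σ : Equiv.Perm (Fin n × Fin 2), ((Equiv.Perm.sign σ : ℤ) : ℂ) *
      (fderiv ℝ (fun z => b z (v (σ (o, 0)))) z (v (σ (o, 1))) *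
        ∏ k ∈ S, w z (v (σ (k, 0))) (v (σ (k, 1)))) =
      - ∑ σ : Equiv.Perm (Fin n × Fin 2), ((Equiv.Perm.sign σ : ℤ) : ℂ) * T1 σ := by
    have h := sum_sign_swap T1 (Equiv.swap (o, 0) (o, 1))
    rw [Equiv.Perm.sign_swap (by simp)] at h
    simp only [smul_eq_mul, Units.val_neg, Units.val_one, Int.cast_neg, Int.cast_one,
      neg_one_mul] at h
    rw [← h]
    refine Finset.sum_congr rfl fun σ _ => ?_
    congr 1
    simp only [T1, Equiv.Perm.mul_apply, Equiv.swap_apply_left, Equiv.swap_apply_right]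
    congr 1
    refine Finset.prod_congr rfl fun k hk => ?_
    rw [Equiv.swap_apply_of_ne_of_ne (by simp [hSo k hk]) (by simp [hSo k hk]),
      Equiv.swap_apply_of_ne_of_ne (by simp [hSo k hk]) (by simp [hSo k hk])]
  have hlhs : ∑ σ : Equiv.Perm (Fin n × Fin 2), ((Equiv.Perm.sign σ : ℤ) : ℂ) *
      ((fderiv ℝ (fun z => b z (v (σ (o, 1)))) z (v (σ (o, 0)))
        - fderiv ℝ (fun z => b z (v (σ (o, 0)))) z (v (σ (o, 1)))) *
        ∏ k ∈ S, w z (v (σ (k, 0))) (v (σ (k, 1)))) =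
      2 * ∑ σ : Equiv.Perm (Fin n × Fin 2), ((Equiv.Perm.sign σ : ℤ) : ℂ) * T1 σ := by
    simp only [sub_mul, mul_sub, Finset.sum_sub_distrib]
    rw [hT1]
    ring
  rw [hlhs]
  congr 1
  have hprod : ∀ σ : Equiv.Perm (Fin n × Fin 2),
      fderiv ℝ (fun z => b z (v (σ (o, 1))) * ∏ k ∈ S, w z (v (σ (k, 0))) (v (σ (k, 1)))) z
        (v (σ (o, 0))) = T1 σ + ∑ l ∈ S, b z (v (σ (o, 1))) *
          ((∏ k ∈ S.erase l, w z (v (σ (k, 0))) (v (σ (k, 1)))) *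
          fderiv ℝ (fun z => w z (v (σ (l, 0))) (v (σ (l, 1)))) z (v (σ (o, 0)))) := by
    intro σ
    have hd : HasFDerivAt (fun z => ∏ k ∈ S, w z (v (σ (k, 0))) (v (σ (k, 1)))) _ z :=
      HasFDerivAt.finsetProd (g := fun k z => w z (v (σ (k, 0))) (v (σ (k, 1))))
        fun k _ => (hw (v (σ (k, 0))) (v (σ (k, 1)))).hasFDerivAt
    rw [fderiv_fun_mul (hb _) hd.differentiableAt, hd.fderiv]
    simp only [add_apply, smul_apply, smul_eq_mul,
      sum_apply, T1, Finset.mul_sum]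
    ring
  simp only [hprod, mul_add, Finset.sum_add_distrib, Finset.mul_sum]
  rw [eq_comm, add_eq_left, Finset.sum_comm]
  refine Finset.sum_eq_zero fun l hl => ?_
  have hlo := hSo l hl
  -- The cycle `(o, 0) → (l, 0) → (l, 1) → (o, 0)` rotates the three arguments of `dw` in the `l`-th
  -- factor and fixes every other slot, so the cyclic sums vanish by `hclosed`.
  refine sum_sign_cyclic (a := (o, (0 : Fin 2))) (b := (l, 0)) (c := (l, 1)) (fun σ => _)
    (by simp [hlo.symm]) (by simp) fun σ => ?_
  set τ := Equiv.swap (o, (0 : Fin 2)) (l, 0) * Equiv.swap (l, 0) (l, 1) with hτ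
  have t1 : τ (o, 0) = (l, 0) := by
    simp [hτ, Equiv.swap_apply_of_ne_of_ne, hlo.symm]
  have t2 : τ (l, 0) = (l, 1) := by
    simp [hτ, Equiv.swap_apply_of_ne_of_ne, hlo]
  have t3 : τ (l, 1) = (o, 0) := by
    simp [hτ]
  have t4 : τ (o, 1) = (o, 1) := by
    simp [hτ, Equiv.swap_apply_of_ne_of_ne, hlo.symm]
  have t5 : ∀ k ∈ S.erase l, ∀ c, τ (k, c) = (k, c) := by
    intro k hk c
    have h1 := hSo k (Finset.mem_of_mem_erase hk)
    have h2 := Finset.ne_of_mem_erase hk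
    simp [hτ, Equiv.swap_apply_of_ne_of_ne, h1, h2]
  clear_value τ
  have t6 : ∀ ρ : Equiv.Perm (Fin n × Fin 2),
      ∏ k ∈ S.erase l, w z (v ((ρ * τ) (k, 0))) (v ((ρ * τ) (k, 1))) =
      ∏ k ∈ S.erase l, w z (v (ρ (k, 0))) (v (ρ (k, 1))) := fun ρ =>
    Finset.prod_congr rfl fun k hk => by rw [Equiv.Perm.mul_apply, Equiv.Perm.mul_apply,
      t5 k hk, t5 k hk]
  simp only [t6]
  simp only [Equiv.Perm.mul_apply, t1, t2, t3, t4]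
  have hc := hclosed (v (σ (o, 0))) (v (σ (l, 0))) (v (σ (l, 1)))
  linear_combination (b z (v (σ (o, 1))) *
    ∏ k ∈ S.erase l, w z (v (σ (k, 0))) (v (σ (k, 1)))) * hc

/-- By `sum_sign_fderiv_wedge` the integrand is a combination of derivatives, in constant
directions, of the functions `G σ`. The factor `b` has compact support in `U`, so each `G σ` is `C¹`
on the whole space although `w` is controlled only on `U`. -/
theorem integral_exterior_derivative_wedge (hn : 1 ≤ n) (hU : IsOpen U)
    {K : Set (Fin n → ℂ)} (hK : IsCompact K) (hKU : K ⊆ U)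
    (hb : ∀ u, ContDiffOn ℝ 1 (fun z => b z u) U) (hb0 : ∀ z ∉ K, ∀ u, b z u = 0)
    (hw : ∀ u v, ContDiffOn ℝ 1 (fun z => w z u v) U)
    (hclosed : ∀ z ∈ U, ∀ u v t, fderiv ℝ (fun z => w z v t) z u + fderiv ℝ (fun z => w z t u) z v
      + fderiv ℝ (fun z => w z u v) z t = 0) (v : Fin n × Fin 2 → (Fin n → ℂ)) :
    ∫ z in U, wedge (fun k : Fin n => if k.val = 0 then (fun s t =>
      fderiv ℝ (fun z => b z t) z s - fderiv ℝ (fun z => b z s) z t) else w z) v = 0 := by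
  let G : Equiv.Perm (Fin n × Fin 2) → (Fin n → ℂ) → ℂ := fun σ z => b z (v (σ (⟨0, hn⟩, 1))) *
        ∏ k ∈ ({⟨0, hn⟩}ᶜ : Finset (Fin n)), w z (v (σ (k, 0))) (v (σ (k, 1)))
  have hG0 : ∀ σ, ∀ z ∉ K, G σ z = 0 := fun σ z hz => by simp [G, hb0 z hz]
  have hGc : ∀ σ, HasCompactSupport (G σ) := fun σ => HasCompactSupport.intro hK (hG0 σ)
  have hGU : ∀ σ, ContDiffOn ℝ 1 (G σ) U := fun σ =>
    (hb _).mul (contDiffOn_prod fun k _ => hw _ _)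
  have hGd : ∀ σ, ContDiff ℝ 1 (G σ) := by
    intro σ
    rw [contDiff_iff_contDiffAt]
    intro z
    by_cases hz : z ∈ U
    · exact (hGU σ).contDiffAt (hU.mem_nhds hz)
    · have : G σ =ᶠ[𝓝 z] fun _ => 0 := by
        filter_upwards [hK.isClosed.isOpen_compl.mem_nhds fun h => hz (hKU h)] with y hy
        exact hG0 σ y hy
      exact contDiffAt_const.congr_of_eventuallyEq this
  have hint : ∀ σ u, Integrable fun z => fderiv ℝ (G σ) z u := fun σ u =>
    (((hGd σ).continuous_fderiv (by simp)).clm_apply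
      continuous_const).integrable_of_hasCompactSupport ((hGc σ).fderiv_apply ℝ u)
  have hDG0 : ∀ σ u, ∀ z ∉ U, fderiv ℝ (G σ) z u = 0 := by
    intro σ u z hz
    have : G σ =ᶠ[𝓝 z] fun _ => 0 := by
      filter_upwards [hK.isClosed.isOpen_compl.mem_nhds fun h => hz (hKU h)] with y hy
      exact hG0 σ y hy
    rw [this.fderiv_eq]
    simp
  have hval : ∀ z ∈ U, wedge (fun k : Fin n => if k.val = 0 then (fun s t =>
      fderiv ℝ (fun z => b z t) z s - fderiv ℝ (fun z => b z s) z t) else w z) v =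
      (1 / 2 ^ n : ℂ) * (2 * ∑ σ : Equiv.Perm (Fin n × Fin 2), ((Equiv.Perm.sign σ : ℤ) : ℂ) *
        fderiv ℝ (G σ) z (v (σ (⟨0, hn⟩, 0)))) := by
    intro z hz
    rw [wedge_first hn, sum_sign_fderiv_wedge hn
      (fun u => ((hb u).contDiffAt (hU.mem_nhds hz)).differentiableAt (by simp))
      (fun u t => ((hw u t).contDiffAt (hU.mem_nhds hz)).differentiableAt (by simp))
      (hclosed z hz) v]
  rw [setIntegral_congr_fun hU.measurableSet hval, integral_const_mul, integral_const_mul,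
    integral_finsetSum _ fun σ _ => ((hint σ _).const_mul _).integrableOn]
  rw [Finset.sum_eq_zero, mul_zero, mul_zero]
  intro σ _
  rw [integral_const_mul, setIntegral_eq_integral_of_forall_compl_eq_zero
    fun z hz => hDG0 σ _ z hz, integral_fderiv_eq_zero (hGd σ) (hGc σ), mul_zero]

end LocalStokes

/-! ## Stokes' theorem on a compact Kähler manifold -/

section Stokes

variable {n : ℕ} {X : Type*} [TopologicalSpace X] [ChartedSpace (Fin n → ℂ) X]

/-- The two-form `α` in the coordinates of the chart at `p`. -/
def TwoForm.pull (α : TwoForm n X) (p : X) (z u v : Fin n → ℂ) : ℂ :=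
  α ((chartAt (Fin n → ℂ) p).symm z) (coordVec p ((chartAt (Fin n → ℂ) p).symm z) u)
    (coordVec p ((chartAt (Fin n → ℂ) p).symm z) v)

/-- The one-form `β` in the coordinates of the chart at `p`. -/
def pullOne (β : X → (Fin n → ℂ) → ℂ) (p : X) (z u : Fin n → ℂ) : ℂ :=
  β ((chartAt (Fin n → ℂ) p).symm z) (coordVec p ((chartAt (Fin n → ℂ) p).symm z) u)

/-- `α` is real-bilinear at every point. -/
def TwoForm.IsBilin (α : TwoForm n X) : Prop :=
  ∀ x, ∃ b : (Fin n → ℂ) →ₗ[ℝ] (Fin n → ℂ) →ₗ[ℝ] ℂ, ∀ u v : Fin n → ℂ, α x u v = b u v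

/-- `α` has continuous coefficients in all charts. -/
def TwoForm.IsCont (α : TwoForm n X) : Prop :=
  ∀ p u v, ContinuousOn (fun z => α.pull p z u v) (chartAt (Fin n → ℂ) p).target

theorem continuousOn_wedge {S : Set (Fin n → ℂ)}
    {a : Fin n → (Fin n → ℂ) → (Fin n → ℂ) → (Fin n → ℂ) → ℂ}
    (ha : ∀ k u v, ContinuousOn (fun z => a k z u v) S) (v : Fin n × Fin 2 → (Fin n → ℂ)) :
    ContinuousOn (fun z => wedge (fun k => a k z) v) S :=
  continuousOn_const.mul (continuousOn_finsetSum _ fun _ _ =>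
    continuousOn_const.mul (continuousOn_finsetProd _ fun _ _ => ha _ _ _))

variable [IsManifold 𝓘(ℂ, Fin n → ℂ) ω X]

theorem TangentMetric.fundForm_isBilin (g : TangentMetric n X) : g.fundForm.IsBilin := by
  intro x
  refine ⟨LinearMap.mk₂ ℝ (fun u v : Fin n → ℂ => ((-(g.form x u v).im : ℝ) : ℂ)) ?_ ?_ ?_ ?_,
    fun u v => rfl⟩
  · intro u u' v
    have : g.form x (u + u' : Fin n → ℂ) v = g.form x u v + g.form x u' v :=
      LinearMap.map_add₂ (g.form x) u u' v
    rw [this]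
    simp
    ring
  · intro c u v
    have : g.form x (c • u : Fin n → ℂ) v = (c : ℂ) • g.form x u v :=
      LinearMap.map_smul₂ (g.form x) (c : ℂ) u v
    rw [this]
    simp
  · intro u v v'
    have : g.form x u (v + v' : Fin n → ℂ) = g.form x u v + g.form x u v' :=
      map_add (g.form x u) v v'
    rw [this]
    simp
    ring
  · intro c u v
    have : g.form x u (c • v : Fin n → ℂ) = (starRingEnd ℂ c) • g.form x u v :=
      LinearMap.map_smulₛₗ (g.form x u) (c : ℂ) v
    rw [this]
    simp

theorem KahlerMetric.form_isBilin (g : KahlerMetric n X) : g.form.IsBilin :=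
  TangentMetric.fundForm_isBilin g.metric

theorem KahlerMetric.contDiffOn_form (g : KahlerMetric n X) (p : X) (u v : Fin n → ℂ) :
    ContDiffOn ℝ ∞ (fun z => g.form.pull p z u v) (chartAt (Fin n → ℂ) p).target :=
  contDiffOn_fundForm g.metric p u v

theorem KahlerMetric.form_isCont (g : KahlerMetric n X) : g.form.IsCont :=
  fun p u v => (g.contDiffOn_form p u v).continuousOn

theorem KahlerMetric.fderiv_form (g : KahlerMetric n X) (p : X) {z : Fin n → ℂ}
    (hz : z ∈ (chartAt (Fin n → ℂ) p).target) (u v t : Fin n → ℂ) :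
    fderiv ℝ (fun z => g.form.pull p z v t) z u + fderiv ℝ (fun z => g.form.pull p z t u) z v
      + fderiv ℝ (fun z => g.form.pull p z u v) z t = 0 := by
  rw [← g.closed p z hz u v t]
  have h : ∀ s s' : Fin n → ℂ, (fun z => g.form.pull p z s s') =ᶠ[𝓝 z]
      fun z => g.metric.fundForm _ (chartVec p z s) (chartVec p z s') := by
    intro s s'
    filter_upwards [(chartAt (Fin n → ℂ) p).open_target.mem_nhds hz] with y hy
    rw [chartVec_eq p hy, chartVec_eq p hy]
    rfl
  rw [(h _ _).fderiv_eq, (h _ _).fderiv_eq, (h _ _).fderiv_eq]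

theorem KahlerMetric.wedgePow_density (g : KahlerMetric n X) (α : TwoForm n X) (p : X)
    {z : Fin n → ℂ} (hz : z ∈ (chartAt (Fin n → ℂ) p).target) :
    (g.wedgePow α).density p z =
      wedge (fun k : Fin n => if k.val = 0 then α.pull p z else g.form.pull p z) (stdFrame n) := by
  rw [density_eq _ p hz]
  change wedge (fun (k : Fin n) u v => (if k.val = 0 then α ((chartAt (Fin n → ℂ) p).symm z)
    else g.form ((chartAt (Fin n → ℂ) p).symm z)) (coordVec p ((chartAt (Fin n → ℂ) p).symm z) u)
      (coordVec p ((chartAt (Fin n → ℂ) p).symm z) v)) (stdFrame n) = _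
  congr 1
  ext k u v
  split_ifs <;> rfl

theorem KahlerMetric.wedgePow_isCont (g : KahlerMetric n X) {α : TwoForm n X} (hα : α.IsCont) :
    (g.wedgePow α).IsCont := by
  intro p
  refine (continuousOn_wedge (a := fun k z => if k.val = 0 then α.pull p z else g.form.pull p z)
    (fun k u v => ?_) (stdFrame n)).congr fun z hz => g.wedgePow_density α p hz
  by_cases hk : k.val = 0
  · simpa only [hk, if_true] using hα p u v
  · simpa only [hk, if_false] using g.form_isCont p u v

theorem KahlerMetric.wedgePow_isAlt (g : KahlerMetric n X) {α : TwoForm n X} (hα : α.IsBilin) :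
    (g.wedgePow α).IsAlt := by
  intro x
  obtain ⟨a, ha⟩ := hα x
  obtain ⟨b, hb⟩ := g.form_isBilin x
  obtain ⟨A, hA⟩ := exists_alternating_wedge (fun k : Fin n => if k.val = 0 then a else b)
  refine ⟨A, fun v => ?_⟩
  rw [← hA]
  change wedge (V := Fin n → ℂ) (fun k : Fin n => if k.val = 0 then α x else g.form x) v = _
  congr 1
  ext k u w
  by_cases hk : k.val = 0
  · exact (congrFun (congrFun (if_pos hk) u) w).trans ((ha u w).trans (by rw [if_pos hk]))
  · exact (congrFun (congrFun (if_neg hk) u) w).trans ((hb u w).trans (by rw [if_neg hk]))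

theorem KahlerMetric.wedgePow_sum (hn : 1 ≤ n) (g : KahlerMetric n X) {ι : Type*} (s : Finset ι)
    (α : ι → TwoForm n X) :
    g.wedgePow (fun x u v => ∑ i ∈ s, α i x u v) = fun x v => ∑ i ∈ s, g.wedgePow (α i) x v := by
  ext x v
  exact wedge_first_sum hn s (fun i => α i x) (g.form x) v

theorem KahlerMetric.wedgePow_const_mul (hn : 1 ≤ n) (g : KahlerMetric n X) (c : ℂ)
    (α : TwoForm n X) :
    g.wedgePow (fun x u v => c * α x u v) = fun x v => c * g.wedgePow α x v := by
  ext x v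
  exact wedge_first_smul hn c (α x) (g.form x) v

theorem KahlerMetric.wedgePow_zero (hn : 1 ≤ n) (g : KahlerMetric n X) :
    g.wedgePow (fun _ _ _ => 0) = fun _ _ => 0 := by
  have := g.wedgePow_const_mul hn 0 (fun _ _ _ => 0)
  simpa using this

/-- The differential of a function. -/
def dfun (f : X → ℂ) (x : X) (u : Fin n → ℂ) : ℂ :=
  fderiv ℝ (f ∘ (chartAt (Fin n → ℂ) x).symm) (chartAt (Fin n → ℂ) x x) u

/-- `dfun` uses a different chart at each point; the chain rule for the transition map shows that it
agrees with the differential in any one chart. -/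
theorem pullOne_dfun {f : X → ℂ} (hf : ContMDiff 𝓘(ℝ, Fin n → ℂ) 𝓘(ℝ, ℂ) ∞ f) (p : X)
    {z : Fin n → ℂ} (hz : z ∈ (chartAt (Fin n → ℂ) p).target) (u : Fin n → ℂ) :
    pullOne (dfun f) p z u = fderiv ℝ (f ∘ (chartAt (Fin n → ℂ) p).symm) z u := by
  set P := chartAt (Fin n → ℂ) p with hP
  set x := P.symm z with hx
  set Q := chartAt (Fin n → ℂ) x with hQ
  have hxQ : x ∈ Q.source := mem_chart_source _ x
  have h1 : DifferentiableAt ℝ (f ∘ Q.symm) (Q (P.symm z)) :=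
    (contDiffAt_comp_chart_symm (U := univ) isOpen_univ hf.contMDiffOn x (Q.map_source hxQ)
      (mem_univ _)).differentiableAt (by simp)
  have h2 : HasFDerivAt (Q ∘ P.symm) ((fderiv ℂ (Q ∘ P.symm) z).restrictScalars ℝ) z :=
    (((contDiffAt_transition p x hz hxQ).differentiableAt (by simp)).hasFDerivAt).restrictScalars ℝ
  have h3 : f ∘ P.symm =ᶠ[𝓝 z] (f ∘ Q.symm) ∘ (Q ∘ P.symm) := by
    filter_upwards [(P.isOpen_inter_preimage_symm Q.open_source).mem_nhds ⟨hz, hxQ⟩] with y hy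
    simp only [Function.comp_apply, Q.left_inv hy.2]
  rw [h3.fderiv_eq]
  have h4 := (HasFDerivAt.comp (f := Q ∘ P.symm) z h1.hasFDerivAt h2).fderiv
  rw [h4]
  unfold pullOne dfun coordVec
  rw [← hP, ← hx, ← hQ, hx, P.right_inv hz, ← hx]
  rfl

theorem dfun_eq_zero {f : X → ℂ} {x : X} (hx : x ∉ tsupport f) (u : Fin n → ℂ) :
    dfun f x u = 0 := by
  have h : f ∘ (chartAt (Fin n → ℂ) x).symm =ᶠ[𝓝 (chartAt (Fin n → ℂ) x x)] fun _ => 0 := by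
    have hc := (chartAt (Fin n → ℂ) x).continuousAt_symm (mem_chart_target _ x)
    have hx' : (tsupport f)ᶜ ∈ 𝓝 ((chartAt (Fin n → ℂ) x).symm (chartAt (Fin n → ℂ) x x)) := by
      rw [(chartAt (Fin n → ℂ) x).left_inv (mem_chart_source _ x)]
      exact (isClosed_tsupport f).isOpen_compl.mem_nhds hx
    filter_upwards [hc hx'] with y hy
    exact image_eq_zero_of_notMem_tsupport (f := f) hy
  unfold dfun
  rw [h.fderiv_eq]
  simp

variable [CompactSpace X] [T2Space X]

/-- The Leibniz rule `d(fβ) = f dβ + df ∧ β` combined with the local Stokes theorem in the chart at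
`q`. Continuity of the second form is recorded so that these identities can be summed over a
partition of unity. -/
theorem KahlerMetric.integral_cutoff (hn : 1 ≤ n) (g : KahlerMetric n X) {α : TwoForm n X}
    {β : X → (Fin n → ℂ) → ℂ} (hα : α.IsBilin) (hα' : α.IsCont)
    (hβ : ∀ x, ∃ L : (Fin n → ℂ) →ₗ[ℝ] ℂ, ∀ u, β x u = L u)
    (hβs : ∀ p u, ContDiffOn ℝ ∞ (fun z => pullOne β p z u) (chartAt (Fin n → ℂ) p).target)
    (hαβ : ∀ p, ∀ z ∈ (chartAt (Fin n → ℂ) p).target, ∀ u v, α.pull p z u v =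
      fderiv ℝ (fun z => pullOne β p z v) z u - fderiv ℝ (fun z => pullOne β p z u) z v)
    {f : X → ℂ} (hf : ContMDiff 𝓘(ℝ, Fin n → ℂ) 𝓘(ℝ, ℂ) ∞ f) (q : X)
    (hfq : tsupport f ⊆ (chartAt (Fin n → ℂ) q).source) :
    let γ : TwoForm n X := fun x u v => dfun f x u * β x v - dfun f x v * β x u
    (g.wedgePow γ).IsCont ∧
    ((g.wedgePow α).fmul f).integral = - (g.wedgePow γ).integral := by
  intro γ
  have hdf : ∀ p, ContDiffOn ℝ ∞ (f ∘ (chartAt (Fin n → ℂ) p).symm)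
      (chartAt (Fin n → ℂ) p).target := fun p => by
    have := contDiffOn_comp_chart_symm (U := univ) hf.contMDiffOn p
    simpa using this
  have hγbilin : γ.IsBilin := by
    intro x
    obtain ⟨L, hL⟩ := hβ x
    let D : (Fin n → ℂ) →ₗ[ℝ] ℂ := (fderiv ℝ (f ∘ (chartAt (Fin n → ℂ) x).symm)
      (chartAt (Fin n → ℂ) x x) : (Fin n → ℂ) →L[ℝ] ℂ)
    refine ⟨LinearMap.mk₂ ℝ (fun u v => D u * L v - D v * L u) ?_ ?_ ?_ ?_, fun u v => ?_⟩
    · intros; simp; ring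
    · intros; simp; ring
    · intros; simp; ring
    · intros; simp; ring
    · have h1 : β x u = L u := hL u
      have h2 : β x v = L v := hL v
      change dfun f x u * β x v - dfun f x v * β x u = _
      rw [h1, h2]
      rfl
  have hγpull : ∀ p, ∀ z ∈ (chartAt (Fin n → ℂ) p).target, ∀ u v, γ.pull p z u v =
      fderiv ℝ (f ∘ (chartAt (Fin n → ℂ) p).symm) z u * pullOne β p z v
        - fderiv ℝ (f ∘ (chartAt (Fin n → ℂ) p).symm) z v * pullOne β p z u := by
    intro p z hz u v
    rw [← pullOne_dfun hf p hz, ← pullOne_dfun hf p hz]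
    rfl
  have hγcont : γ.IsCont := by
    intro p u v
    have hc := (hdf p).continuousOn_fderiv_of_isOpen (chartAt (Fin n → ℂ) p).open_target (by simp)
    refine ContinuousOn.congr (f := fun z =>
      fderiv ℝ (f ∘ (chartAt (Fin n → ℂ) p).symm) z u * pullOne β p z v
        - fderiv ℝ (f ∘ (chartAt (Fin n → ℂ) p).symm) z v * pullOne β p z u) ?_
      (fun z hz => hγpull p z hz u v)
    exact ((hc.clm_apply continuousOn_const).mul (hβs p v).continuousOn).sub
      ((hc.clm_apply continuousOn_const).mul (hβs p u).continuousOn)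
  refine ⟨g.wedgePow_isCont hγcont, ?_⟩
  have hf0 : ∀ x ∉ tsupport f, ∀ v, (g.wedgePow α).fmul f x v = 0 := fun x hx v => by
    simp [TopForm.fmul, image_eq_zero_of_notMem_tsupport hx]
  have hγ0 : ∀ x ∉ tsupport f, ∀ v, g.wedgePow γ x v = 0 := fun x hx v => by
    have : γ x = fun _ _ => 0 := by
      ext u v
      change dfun f x u * β x v - dfun f x v * β x u = 0
      rw [dfun_eq_zero hx u, dfun_eq_zero hx v]
      simp
    unfold KahlerMetric.wedgePow
    rw [this]
    exact congrFun (congrFun (g.wedgePow_zero hn) x) v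
  rw [TopForm.integral_eq_of_support ((g.wedgePow_isAlt hα).fmul f)
    ((g.wedgePow_isCont hα').fmul hf.continuous) (isClosed_tsupport f) q hfq hf0,
    TopForm.integral_eq_of_support (g.wedgePow_isAlt hγbilin) (g.wedgePow_isCont hγcont)
    (isClosed_tsupport f) q hfq hγ0]
  set Q := chartAt (Fin n → ℂ) q with hQ
  -- Outside its target the inverse chart has no meaning, hence the extension by zero.
  let b : (Fin n → ℂ) → (Fin n → ℂ) → ℂ := fun z u =>
    Q.target.indicator (fun z => f (Q.symm z) * pullOne β q z u) z
  have hbQ : ∀ u, EqOn (fun z => b z u) (fun z => f (Q.symm z) * pullOne β q z u) Q.target :=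
    fun u z hz => indicator_of_mem hz _
  have hbs : ∀ u, ContDiffOn ℝ ∞ (fun z => b z u) Q.target := fun u =>
    ((hdf q).mul (hβs q u)).congr (hbQ u)
  have hcomp : IsCompact (Q '' tsupport f) :=
    (isClosed_tsupport f).isCompact.image_of_continuousOn (Q.continuousOn.mono hfq)
  have hsub : Q '' tsupport f ⊆ Q.target := by
    rintro _ ⟨x, hx, rfl⟩
    exact Q.map_source (hfq hx)
  have hb0 : ∀ z ∉ Q '' tsupport f, ∀ u, b z u = 0 := by
    intro z hz u
    by_cases hzQ : z ∈ Q.target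
    · have : Q.symm z ∉ tsupport f := fun h => hz ⟨_, h, Q.right_inv hzQ⟩
      simp [b, image_eq_zero_of_notMem_tsupport this]
    · exact indicator_of_notMem hzQ _
  have hstokes := integral_exterior_derivative_wedge hn Q.open_target hcomp hsub
    (fun u => (hbs u).of_le (by simp)) hb0 (fun u v => (g.contDiffOn_form q u v).of_le (by simp))
    (fun z hz u v t => g.fderiv_form q hz u v t) (stdFrame n)
  have hint1 : IntegrableOn (((g.wedgePow α).fmul f).density q) Q.target :=
    TopForm.integrableOn_density ((g.wedgePow_isCont hα').fmul hf.continuous)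
      (isClosed_tsupport f) q hfq hf0
  have hint2 : IntegrableOn ((g.wedgePow γ).density q) Q.target :=
    TopForm.integrableOn_density (g.wedgePow_isCont hγcont) (isClosed_tsupport f) q hfq hγ0
  rw [eq_neg_iff_add_eq_zero, ← MeasureTheory.integral_add hint1 hint2, ← hstokes]
  refine setIntegral_congr_fun Q.open_target.measurableSet fun z hz => ?_
  have h1 : ((g.wedgePow α).fmul f).density q z = f (Q.symm z) * (g.wedgePow α).density q z := rfl
  simp only [h1]
  rw [g.wedgePow_density α q hz, g.wedgePow_density γ q hz, ← wedge_first_smul hn,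
    ← wedge_first_add hn]
  congr 1
  ext k u v
  split_ifs
  swap
  · rfl
  change f (Q.symm z) * α.pull q z u v + γ.pull q z u v =
    fderiv ℝ (fun z => b z v) z u - fderiv ℝ (fun z => b z u) z v
  rw [hαβ q z hz, hγpull q z hz]
  have hd : ∀ t s, fderiv ℝ (fun z => b z t) z s = f (Q.symm z) *
      fderiv ℝ (fun z => pullOne β q z t) z s + fderiv ℝ (f ∘ Q.symm) z s * pullOne β q z t := by
    intro t s
    have he : (fun z => b z t) =ᶠ[𝓝 z] fun z => (f ∘ Q.symm) z * pullOne β q z t := by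
      filter_upwards [Q.open_target.mem_nhds hz] with y hy
      exact hbQ t hy
    rw [he.fderiv_eq, fderiv_fun_mul
      (((hdf q).contDiffAt (Q.open_target.mem_nhds hz)).differentiableAt (by simp))
      (((hβs q t).contDiffAt (Q.open_target.mem_nhds hz)).differentiableAt (by simp))]
    simp only [add_apply, smul_apply, smul_eq_mul, Function.comp_apply]
    ring
  rw [hd, hd]
  ring

/-- Stokes' theorem: `∫_X dβ ∧ ωⁿ⁻¹ = 0`. -/
theorem KahlerMetric.integral_exact (hn : 1 ≤ n) (g : KahlerMetric n X) {α : TwoForm n X}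
    {β : X → (Fin n → ℂ) → ℂ} (hα : α.IsBilin)
    (hβ : ∀ x, ∃ L : (Fin n → ℂ) →ₗ[ℝ] ℂ, ∀ u, β x u = L u)
    (hβs : ∀ p u, ContDiffOn ℝ ∞ (fun z => pullOne β p z u) (chartAt (Fin n → ℂ) p).target)
    (hαβ : ∀ p, ∀ z ∈ (chartAt (Fin n → ℂ) p).target, ∀ u v, α.pull p z u v =
      fderiv ℝ (fun z => pullOne β p z v) z u - fderiv ℝ (fun z => pullOne β p z u) z v) :
    (g.wedgePow α).integral = 0 := by
  have hα' : α.IsCont := by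
    intro p u v
    have hc := fun t => (hβs p t).continuousOn_fderiv_of_isOpen
      (chartAt (Fin n → ℂ) p).open_target (by simp)
    exact (((hc v).clm_apply continuousOn_const).sub
      ((hc u).clm_apply continuousOn_const)).congr fun z hz => hαβ p z hz u v
  -- The partition in the definition of the integral is only continuous; the cutoffs have to be
  -- differentiated here, so a smooth partition is used.
  obtain ⟨σ, hσ⟩ := SmoothPartitionOfUnity.exists_isSubordinate_chartAt_source
    𝓘(ℝ, Fin n → ℂ) X
  let S : Finset X := (σ.locallyFinite.finite_nonempty_of_compact).toFinset
  let f : X → X → ℂ := fun q x => (σ q x : ℂ)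
  have hfs : ∀ q, ContMDiff 𝓘(ℝ, Fin n → ℂ) 𝓘(ℝ, ℂ) ∞ (f q) := fun q =>
    (Complex.ofRealCLM.contDiff (n := ∞)).contMDiff.comp (σ q).contMDiff
  have hft : ∀ q, tsupport (f q) ⊆ (chartAt (Fin n → ℂ) q).source := fun q => by
    refine (closure_mono fun x hx => ?_).trans (hσ q)
    simpa [f] using hx
  have hsum : ∀ x, ∑ q ∈ S, f q x = 1 := by
    intro x
    have h := σ.sum_eq_one (mem_univ x)
    rw [finsum_eq_sum_of_support_subset (s := S)] at h
    · simp only [f]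
      rw [← Complex.ofReal_sum, h, Complex.ofReal_one]
    · intro q hq
      exact (σ.locallyFinite.finite_nonempty_of_compact).mem_toFinset.2 ⟨x, hq⟩
  have hcut := fun q => g.integral_cutoff hn hα hα' hβ hβs hαβ (hfs q) q (hft q)
  have h1 : g.wedgePow α = fun x v => ∑ q ∈ S, (g.wedgePow α).fmul (f q) x v := by
    ext x v
    simp only [TopForm.fmul, ← Finset.sum_mul, hsum, one_mul]
  rw [h1, TopForm.integral_sum S _ fun q _ => (g.wedgePow_isCont hα').fmul (hfs q).continuous,
    Finset.sum_congr rfl fun q _ => (hcut q).2, Finset.sum_neg_distrib,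
    ← TopForm.integral_sum S _ fun q _ => (hcut q).1, ← g.wedgePow_sum hn]
  -- The cutoffs add up to one, so their differentials add up to zero and the error terms of
  -- `integral_cutoff` cancel.
  have hd0 : ∀ x (u : Fin n → ℂ), ∑ q ∈ S, dfun (f q) x u = 0 := by
    intro x u
    have hdiff : ∀ q ∈ S, DifferentiableAt ℝ (f q ∘ (chartAt (Fin n → ℂ) x).symm)
        (chartAt (Fin n → ℂ) x x) := fun q _ =>
      (contDiffAt_comp_chart_symm (U := univ) isOpen_univ (hfs q).contMDiffOn x
        (mem_chart_target _ x) (mem_univ _)).differentiableAt (by simp)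
    have h := fderiv_sum hdiff
    have hone : (∑ q ∈ S, f q ∘ (chartAt (Fin n → ℂ) x).symm) = fun _ => (1 : ℂ) := by
      ext z
      simp [hsum]
    rw [hone] at h
    have h2 := DFunLike.congr_fun h u
    simp only [fderiv_fun_const, sum_apply] at h2
    exact h2.symm
  have h0 : (fun x u v => ∑ q ∈ S, (dfun (f q) x u * β x v - dfun (f q) x v * β x u) :
      TwoForm n X) = fun _ _ _ => 0 := by
    ext x u v
    rw [Finset.sum_sub_distrib, ← Finset.sum_mul, ← Finset.sum_mul, hd0 x u, hd0 x v]
    simp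
  rw [h0, g.wedgePow_zero hn]
  simp [TopForm.integral_eq_sum, TopForm.density, TopForm.piece, TopForm.fmul]

end Stokes

/-! ## The volume -/

section Volume

variable {n : ℕ} {X : Type*} [TopologicalSpace X] [ChartedSpace (Fin n → ℂ) X]
  [IsManifold 𝓘(ℂ, Fin n → ℂ) ω X]

theorem KahlerMetric.top_density (g : KahlerMetric n X) (p : X) {z : Fin n → ℂ}
    (hz : z ∈ (chartAt (Fin n → ℂ) p).target) :
    g.top.density p z = wedge (fun _ : Fin n => g.form.pull p z) (stdFrame n) := by
  rw [density_eq _ p hz]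
  rfl

theorem KahlerMetric.top_isCont (g : KahlerMetric n X) : g.top.IsCont := fun p =>
  (continuousOn_wedge (a := fun _ z => g.form.pull p z)
    (fun _ u v => g.form_isCont p u v) (stdFrame n)).congr fun _ hz => g.top_density p hz

/-- The coordinate vectors form a complex basis of the tangent space, so `wedge_fundForm_pos`
applies. -/
theorem KahlerMetric.top_density_pos (g : KahlerMetric n X) (p : X) {z : Fin n → ℂ}
    (hz : z ∈ (chartAt (Fin n → ℂ) p).target) :
    ∃ c : ℝ, 0 < c ∧ g.top.density p z = c := by
  set x := (chartAt (Fin n → ℂ) p).symm z with hx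
  let T : (Fin n → ℂ) →ₗ[ℂ] (Fin n → ℂ) := (coordVec (n := n) p x : (Fin n → ℂ) →ₗ[ℂ] (Fin n → ℂ))
  have hinj : Function.Injective T :=
    coordVec_injective p x ((chartAt (Fin n → ℂ) p).map_target hz)
  let u : Module.Basis (Fin n) ℂ (Fin n → ℂ) :=
    (Pi.basisFun ℂ (Fin n)).map (LinearEquiv.ofInjectiveEndo T hinj)
  obtain ⟨c, hc, h⟩ := wedge_fundForm_pos (V := Tan (n := n) x) (g.metric.form x)
    (g.metric.conj_symm x) (g.metric.pos x) u
  refine ⟨c, hc, ?_⟩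
  rw [← h, density_eq _ p hz]
  change wedge (fun _ : Fin n => fun a b => ((-(g.metric.form x a b).im : ℝ) : ℂ)) _ = _
  congr 1
  ext1 kb
  have hu : ∀ k, u k = T (Pi.single k 1) := fun k => by simp [u]
  change T (Pi.single kb.1 (if kb.2 = 0 then 1 else Complex.I)) =
    if kb.2 = 0 then u kb.1 else Complex.I • u kb.1
  split_ifs
  · rw [hu]
  · rw [hu, ← map_smul, ← Pi.single_smul, smul_eq_mul, mul_one]

variable [CompactSpace X] [T2Space X]

/-- All pieces are nonnegative, and some function of the partition is positive at a given point,
hence on an open set. This makes the division by the volume in `heConst` meaningful. -/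
theorem KahlerMetric.integral_top_pos [Nonempty X] (g : KahlerMetric n X) :
    ∃ c : ℝ, 0 < c ∧ g.top.integral = c := by
  let D : X → (Fin n → ℂ) → ℝ := fun p z => (g.top.density p z).re
  have hD : ∀ p, ∀ z ∈ (chartAt (Fin n → ℂ) p).target, 0 < D p z ∧ g.top.density p z = D p z := by
    intro p z hz
    obtain ⟨c, hc, h⟩ := g.top_density_pos p hz
    simp [D, h, hc]
  let f : X → (Fin n → ℂ) → ℝ := fun p z => part n X p ((chartAt (Fin n → ℂ) p).symm z) * D p z
  have hpiece : ∀ p, ∀ z ∈ (chartAt (Fin n → ℂ) p).target, (g.top.piece p).density p z = f p z := by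
    intro p z hz
    have : (g.top.piece p).density p z =
      (part n X p ((chartAt (Fin n → ℂ) p).symm z) : ℂ) * g.top.density p z := rfl
    rw [this, (hD p z hz).2]
    simp [f]
  have hfint : ∀ p, IntegrableOn (f p) (chartAt (Fin n → ℂ) p).target := by
    intro p
    have h := (g.top_isCont.integrableOn_piece p).re
    refine IntegrableOn.congr_fun h (fun z hz => ?_) (chartAt (Fin n → ℂ) p).open_target.measurableSet
    simp [hpiece p z hz]
  have hf0 : ∀ p, ∀ z ∈ (chartAt (Fin n → ℂ) p).target, 0 ≤ f p z := fun p z hz =>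
    mul_nonneg ((part n X).nonneg p _) (hD p z hz).1.le
  refine ⟨∑ p ∈ partIndex n X, ∫ z in (chartAt (Fin n → ℂ) p).target, f p z, ?_, ?_⟩
  · obtain ⟨x⟩ := ‹Nonempty X›
    obtain ⟨p, hp, hpx⟩ : ∃ p ∈ partIndex n X, 0 < part n X p x := by
      by_contra! h
      have := sum_part (n := n) x
      have h' := Finset.sum_nonpos h
      linarith
    have hxp : x ∈ (chartAt (Fin n → ℂ) p).source :=
      part_subordinate p (subset_tsupport _ hpx.ne')
    refine Finset.sum_pos' (fun q _ => setIntegral_nonneg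
      (chartAt (Fin n → ℂ) q).open_target.measurableSet (hf0 q)) ⟨p, hp, ?_⟩
    rw [setIntegral_pos_iff_support_of_nonneg_ae
      ((ae_restrict_iff' (chartAt (Fin n → ℂ) p).open_target.measurableSet).2
        (Eventually.of_forall (hf0 p))) (hfint p)]
    have hopen : IsOpen ((chartAt (Fin n → ℂ) p).target ∩ (chartAt (Fin n → ℂ) p).symm ⁻¹'
        {y | 0 < part n X p y}) :=
      (chartAt (Fin n → ℂ) p).isOpen_inter_preimage_symm
        (isOpen_lt continuous_const (part n X p).continuous)
    refine (hopen.measure_pos volume ⟨chartAt (Fin n → ℂ) p x,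
      (chartAt (Fin n → ℂ) p).map_source hxp, ?_⟩).trans_le (measure_mono fun z hz =>
        ⟨(mul_pos hz.2 (hD p z hz.1).1).ne', hz.1⟩)
    simpa [(chartAt (Fin n → ℂ) p).left_inv hxp] using hpx
  · rw [TopForm.integral_eq_sum]
    push_cast
    refine Finset.sum_congr rfl fun p _ => ?_
    exact (setIntegral_congr_fun (chartAt (Fin n → ℂ) p).open_target.measurableSet
      (hpiece p)).trans integral_complex_ofReal

end Volume

/-! ## Calculus of matrix-valued functions on `ℂⁿ` -/

section MatrixCalculus

open scoped Matrix

variable {n k l m : ℕ}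

/-- `(D_u f + ε D_{iu} f) / 2`, which is `∂f` for `ε = -i` and `∂̄f` for `ε = i`. -/
def dd (ε : ℂ) (f : (Fin n → ℂ) → ℂ) (z u : Fin n → ℂ) : ℂ :=
  (fderiv ℝ f z u + ε * fderiv ℝ f z (Complex.I • u)) / 2

theorem del_eq_dd (f : (Fin n → ℂ) → ℂ) (z u : Fin n → ℂ) : del f z u = dd (-Complex.I) f z u := by
  simp [del, dd, sub_eq_add_neg]

theorem fderiv_eq_dd_add_dd (f : (Fin n → ℂ) → ℂ) (z u : Fin n → ℂ) :
    fderiv ℝ f z u = dd (-Complex.I) f z u + dd Complex.I f z u := by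
  simp only [dd]
  ring

/-- Entrywise `dd`. -/
def ddM (ε : ℂ) (F : (Fin n → ℂ) → Matrix (Fin k) (Fin l) ℂ) (z u : Fin n → ℂ) :
    Matrix (Fin k) (Fin l) ℂ :=
  Matrix.of fun a b => dd ε (fun z => F z a b) z u

/-- Entrywise smoothness. -/
def SmoothM (F : (Fin n → ℂ) → Matrix (Fin k) (Fin l) ℂ) (U : Set (Fin n → ℂ)) : Prop :=
  ∀ a b, ContDiffOn ℝ ∞ (fun z => F z a b) U

/-- Entrywise holomorphy. -/
def HolM (F : (Fin n → ℂ) → Matrix (Fin k) (Fin l) ℂ) (U : Set (Fin n → ℂ)) : Prop :=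
  ∀ a b, ContDiffOn ℂ ω (fun z => F z a b) U

variable {U : Set (Fin n → ℂ)}

theorem HolM.smoothM {F : (Fin n → ℂ) → Matrix (Fin k) (Fin l) ℂ} (hF : HolM F U) :
    SmoothM F U := fun a b => ((hF a b).restrict_scalars ℝ).of_le (by simp)

theorem SmoothM.differentiableAt {F : (Fin n → ℂ) → Matrix (Fin k) (Fin l) ℂ} (hF : SmoothM F U)
    (hU : IsOpen U) {z : Fin n → ℂ} (hz : z ∈ U) (a : Fin k) (b : Fin l) :
    DifferentiableAt ℝ (fun z => F z a b) z :=
  ((hF a b).contDiffAt (hU.mem_nhds hz)).differentiableAt (by simp)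

theorem HolM.differentiableAt {F : (Fin n → ℂ) → Matrix (Fin k) (Fin l) ℂ} (hF : HolM F U)
    (hU : IsOpen U) {z : Fin n → ℂ} (hz : z ∈ U) (a : Fin k) (b : Fin l) :
    DifferentiableAt ℂ (fun z => F z a b) z :=
  ((hF a b).contDiffAt (hU.mem_nhds hz)).differentiableAt (by simp)

theorem SmoothM.mul {F : (Fin n → ℂ) → Matrix (Fin k) (Fin l) ℂ}
    {G : (Fin n → ℂ) → Matrix (Fin l) (Fin m) ℂ} (hF : SmoothM F U) (hG : SmoothM G U) :
    SmoothM (fun z => F z * G z) U := fun a b => by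
  simp only [Matrix.mul_apply]
  exact ContDiffOn.sum fun c _ => (hF a c).mul (hG c b)

theorem HolM.mul {F : (Fin n → ℂ) → Matrix (Fin k) (Fin l) ℂ}
    {G : (Fin n → ℂ) → Matrix (Fin l) (Fin m) ℂ} (hF : HolM F U) (hG : HolM G U) :
    HolM (fun z => F z * G z) U := fun a b => by
  simp only [Matrix.mul_apply]
  exact ContDiffOn.sum fun c _ => (hF a c).mul (hG c b)

theorem HolM.const (A : Matrix (Fin k) (Fin l) ℂ) : HolM (fun _ => A) U :=
  fun _ _ => contDiffOn_const

theorem SmoothM.add {F G : (Fin n → ℂ) → Matrix (Fin k) (Fin l) ℂ} (hF : SmoothM F U)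
    (hG : SmoothM G U) : SmoothM (fun z => F z + G z) U := fun a b => (hF a b).add (hG a b)

theorem SmoothM.sub {F G : (Fin n → ℂ) → Matrix (Fin k) (Fin l) ℂ} (hF : SmoothM F U)
    (hG : SmoothM G U) : SmoothM (fun z => F z - G z) U := fun a b => (hF a b).sub (hG a b)

theorem SmoothM.const_smul {F : (Fin n → ℂ) → Matrix (Fin k) (Fin l) ℂ} (hF : SmoothM F U)
    (c : ℂ) : SmoothM (fun z => c • F z) U := fun a b => contDiffOn_const.mul (hF a b)

theorem SmoothM.sum {ι : Type*} {s : Finset ι} {F : ι → (Fin n → ℂ) → Matrix (Fin k) (Fin l) ℂ}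
    (hF : ∀ i ∈ s, SmoothM (F i) U) : SmoothM (fun z => ∑ i ∈ s, F i z) U := fun a b => by
  simp only [Matrix.sum_apply]
  exact ContDiffOn.sum fun i hi => hF i hi a b

theorem SmoothM.conjTranspose {F : (Fin n → ℂ) → Matrix (Fin k) (Fin l) ℂ} (hF : SmoothM F U) :
    SmoothM (fun z => (F z)ᴴ) U := fun a b =>
  Complex.conjCLE.contDiff.comp_contDiffOn (hF b a)

theorem SmoothM.mono {F : (Fin n → ℂ) → Matrix (Fin k) (Fin l) ℂ} (hF : SmoothM F U)
    {V : Set (Fin n → ℂ)} (hV : V ⊆ U) : SmoothM F V := fun a b => (hF a b).mono hV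

theorem HolM.mono {F : (Fin n → ℂ) → Matrix (Fin k) (Fin l) ℂ} (hF : HolM F U)
    {V : Set (Fin n → ℂ)} (hV : V ⊆ U) : HolM F V := fun a b => (hF a b).mono hV

theorem HolM.congr {F G : (Fin n → ℂ) → Matrix (Fin k) (Fin l) ℂ} (hF : HolM F U)
    (h : ∀ z ∈ U, G z = F z) : HolM G U := fun a b =>
  (hF a b).congr fun z hz => by rw [h z hz]

/-- The scalar field is left general so that smooth and holomorphic matrices are treated at once. -/
theorem contDiffOn_det {𝕜 : Type*} [NontriviallyNormedField 𝕜] [NormedAlgebra 𝕜 ℂ]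
    {V : Type*} [NormedAddCommGroup V] [NormedSpace 𝕜 V] {U : Set V} {N : WithTop ℕ∞}
    {F : V → Matrix (Fin k) (Fin k) ℂ} (hF : ∀ a b, ContDiffOn 𝕜 N (fun z => F z a b) U) :
    ContDiffOn 𝕜 N (fun z => (F z).det) U := by
  simp only [Matrix.det_apply']
  exact ContDiffOn.sum fun σ _ => contDiffOn_const.mul (contDiffOn_prod fun i _ => hF _ _)

theorem contDiffOn_matrix_inv {𝕜 : Type*} [NontriviallyNormedField 𝕜] [NormedAlgebra 𝕜 ℂ]
    {V : Type*} [NormedAddCommGroup V] [NormedSpace 𝕜 V] {U : Set V} {N : WithTop ℕ∞}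
    {F : V → Matrix (Fin k) (Fin k) ℂ} (hF : ∀ a b, ContDiffOn 𝕜 N (fun z => F z a b) U)
    (hdet : ∀ z ∈ U, (F z).det ≠ 0) (a b : Fin k) :
    ContDiffOn 𝕜 N (fun z => (F z)⁻¹ a b) U := by
  simp only [Matrix.inv_def, Matrix.smul_apply, Ring.inverse_eq_inv', Matrix.adjugate_apply,
    smul_eq_mul]
  refine ContDiffOn.mul ((contDiffOn_det hF).inv hdet) (contDiffOn_det fun c d => ?_)
  by_cases h : c = b
  · subst h
    simpa using contDiffOn_const
  · simpa [h] using hF c d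

theorem SmoothM.inv {F : (Fin n → ℂ) → Matrix (Fin k) (Fin k) ℂ} (hF : SmoothM F U)
    (hdet : ∀ z ∈ U, (F z).det ≠ 0) : SmoothM (fun z => (F z)⁻¹) U :=
  contDiffOn_matrix_inv hF hdet

theorem HolM.inv {F : (Fin n → ℂ) → Matrix (Fin k) (Fin k) ℂ} (hF : HolM F U)
    (hdet : ∀ z ∈ U, (F z).det ≠ 0) : HolM (fun z => (F z)⁻¹) U :=
  contDiffOn_matrix_inv hF hdet

theorem contDiffOn_dd (hU : IsOpen U) {f : (Fin n → ℂ) → ℂ} (hf : ContDiffOn ℝ ∞ f U) (ε : ℂ)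
    (u : Fin n → ℂ) : ContDiffOn ℝ ∞ (fun z => dd ε f z u) U := by
  have h : ∀ v, ContDiffOn ℝ ∞ (fun z => fderiv ℝ f z v) U := fun v =>
    (hf.fderiv_of_isOpen hU (by simp)).clm_apply contDiffOn_const
  exact ((h u).add (contDiffOn_const.mul (h _))).div_const 2

theorem SmoothM.ddM (hU : IsOpen U) {F : (Fin n → ℂ) → Matrix (Fin k) (Fin l) ℂ}
    (hF : SmoothM F U) (ε : ℂ) (u : Fin n → ℂ) : SmoothM (fun z => ddM ε F z u) U :=
  fun a b => contDiffOn_dd hU (hF a b) ε u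

theorem dd_congr (hU : IsOpen U) {f g : (Fin n → ℂ) → ℂ} (h : EqOn f g U) (ε : ℂ)
    {z : Fin n → ℂ} (hz : z ∈ U) (u : Fin n → ℂ) : dd ε f z u = dd ε g z u := by
  have : f =ᶠ[𝓝 z] g := by
    filter_upwards [hU.mem_nhds hz] with y hy using h hy
  simp only [dd, this.fderiv_eq]

theorem ddM_congr (hU : IsOpen U) {F G : (Fin n → ℂ) → Matrix (Fin k) (Fin l) ℂ}
    (h : ∀ z ∈ U, F z = G z) (ε : ℂ) {z : Fin n → ℂ} (hz : z ∈ U) (u : Fin n → ℂ) :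
    ddM ε F z u = ddM ε G z u := by
  ext a b
  exact dd_congr hU (fun y hy => by rw [h y hy]) ε hz u

theorem dd_mul {f g : (Fin n → ℂ) → ℂ} {z : Fin n → ℂ} (hf : DifferentiableAt ℝ f z)
    (hg : DifferentiableAt ℝ g z) (ε : ℂ) (u : Fin n → ℂ) :
    dd ε (fun z => f z * g z) z u = dd ε f z u * g z + f z * dd ε g z u := by
  simp only [dd, fderiv_fun_mul hf hg, add_apply, smul_apply, smul_eq_mul]
  ring

theorem dd_sum {ι : Type*} {s : Finset ι} {f : ι → (Fin n → ℂ) → ℂ} {z : Fin n → ℂ}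
    (hf : ∀ i ∈ s, DifferentiableAt ℝ (f i) z) (ε : ℂ) (u : Fin n → ℂ) :
    dd ε (fun z => ∑ i ∈ s, f i z) z u = ∑ i ∈ s, dd ε (f i) z u := by
  simp only [dd, fderiv_fun_sum hf, sum_apply, Finset.mul_sum, ← Finset.sum_add_distrib,
    Finset.sum_div]

theorem dd_add {f g : (Fin n → ℂ) → ℂ} {z : Fin n → ℂ} (hf : DifferentiableAt ℝ f z)
    (hg : DifferentiableAt ℝ g z) (ε : ℂ) (u : Fin n → ℂ) :
    dd ε (fun z => f z + g z) z u = dd ε f z u + dd ε g z u := by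
  simp only [dd, fderiv_fun_add hf hg, add_apply]
  ring

theorem dd_const (c ε : ℂ) (z u : Fin n → ℂ) : dd ε (fun _ => c) z u = 0 := by
  simp [dd]

theorem ddM_const (A : Matrix (Fin k) (Fin l) ℂ) (ε : ℂ) (z u : Fin n → ℂ) :
    ddM ε (fun _ => A) z u = 0 := by
  ext a b
  exact dd_const _ _ _ _

theorem ddM_mul (hU : IsOpen U) {F : (Fin n → ℂ) → Matrix (Fin k) (Fin l) ℂ}
    {G : (Fin n → ℂ) → Matrix (Fin l) (Fin m) ℂ} (hF : SmoothM F U) (hG : SmoothM G U) (ε : ℂ)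
    {z : Fin n → ℂ} (hz : z ∈ U) (u : Fin n → ℂ) :
    ddM ε (fun z => F z * G z) z u = ddM ε F z u * G z + F z * ddM ε G z u := by
  ext a b
  simp only [ddM, Matrix.of_apply, Matrix.add_apply, Matrix.mul_apply]
  rw [dd_sum (f := fun c z => F z a c * G z c b) fun c _ =>
    (hF.differentiableAt hU hz a c).mul (hG.differentiableAt hU hz c b), ← Finset.sum_add_distrib]
  exact Finset.sum_congr rfl fun c _ => dd_mul (hF.differentiableAt hU hz a c)
    (hG.differentiableAt hU hz c b) ε u

theorem ddM_add (hU : IsOpen U) {F G : (Fin n → ℂ) → Matrix (Fin k) (Fin l) ℂ}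
    (hF : SmoothM F U) (hG : SmoothM G U) (ε : ℂ) {z : Fin n → ℂ} (hz : z ∈ U) (u : Fin n → ℂ) :
    ddM ε (fun z => F z + G z) z u = ddM ε F z u + ddM ε G z u := by
  ext a b
  exact dd_add (hF.differentiableAt hU hz a b) (hG.differentiableAt hU hz a b) ε u

theorem ddM_const_smul (hU : IsOpen U) {F : (Fin n → ℂ) → Matrix (Fin k) (Fin l) ℂ}
    (hF : SmoothM F U) (c ε : ℂ) {z : Fin n → ℂ} (hz : z ∈ U) (u : Fin n → ℂ) :
    ddM ε (fun z => c • F z) z u = c • ddM ε F z u := by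
  ext a b
  have := dd_mul (f := fun _ => c) (by fun_prop) (hF.differentiableAt hU hz a b) ε u
  simpa [ddM, dd_const] using this

theorem ddM_sum (hU : IsOpen U) {ι : Type*} {s : Finset ι}
    {F : ι → (Fin n → ℂ) → Matrix (Fin k) (Fin l) ℂ} (hF : ∀ i ∈ s, SmoothM (F i) U) (ε : ℂ)
    {z : Fin n → ℂ} (hz : z ∈ U) (u : Fin n → ℂ) :
    ddM ε (fun z => ∑ i ∈ s, F i z) z u = ∑ i ∈ s, ddM ε (F i) z u := by
  ext a b
  simp only [ddM, Matrix.of_apply, Matrix.sum_apply]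
  exact dd_sum (fun i hi => (hF i hi).differentiableAt hU hz a b) ε u

theorem dd_trace (hU : IsOpen U) {F : (Fin n → ℂ) → Matrix (Fin k) (Fin k) ℂ}
    (hF : SmoothM F U) (ε : ℂ) {z : Fin n → ℂ} (hz : z ∈ U) (u : Fin n → ℂ) :
    dd ε (fun z => (F z).trace) z u = (ddM ε F z u).trace :=
  dd_sum (fun i _ => hF.differentiableAt hU hz i i) ε u

theorem ddM_inv (hU : IsOpen U) {F : (Fin n → ℂ) → Matrix (Fin k) (Fin k) ℂ}
    (hF : SmoothM F U) (hdet : ∀ z ∈ U, (F z).det ≠ 0) (ε : ℂ) {z : Fin n → ℂ} (hz : z ∈ U)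
    (u : Fin n → ℂ) : ddM ε (fun z => (F z)⁻¹) z u = -((F z)⁻¹ * ddM ε F z u * (F z)⁻¹) := by
  have h1 := ddM_mul hU hF (hF.inv hdet) ε hz u
  have h2 : ddM ε (fun z => F z * (F z)⁻¹) z u = 0 := by
    rw [ddM_congr hU (G := fun _ => 1) (fun y hy => Matrix.mul_nonsing_inv _
      (isUnit_iff_ne_zero.2 (hdet y hy))) ε hz u, ddM_const]
  rw [h2] at h1
  have h3 : (F z)⁻¹ * F z = 1 := Matrix.nonsing_inv_mul _ (isUnit_iff_ne_zero.2 (hdet z hz))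
  have h4 := congrArg (fun A => (F z)⁻¹ * A) h1
  simp only [mul_zero, mul_add, ← mul_assoc, h3, one_mul] at h4
  exact (neg_eq_of_add_eq_zero_right h4.symm).symm

/-- The factor is `0` for `ε = i` and `1` for `ε = -i`: this contains both `∂̄f = 0` and `∂f = df`
for holomorphic `f`. -/
theorem dd_eq_of_differentiableAt {f : (Fin n → ℂ) → ℂ} {z : Fin n → ℂ}
    (hf : DifferentiableAt ℂ f z) (ε : ℂ) (u : Fin n → ℂ) :
    dd ε f z u = (1 + ε * Complex.I) / 2 * fderiv ℂ f z u := by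
  have h : fderiv ℝ f z = (fderiv ℂ f z).restrictScalars ℝ :=
    (hf.hasFDerivAt.restrictScalars ℝ).fderiv
  simp only [dd, h, ContinuousLinearMap.coe_restrictScalars', map_smul, smul_eq_mul]
  ring

theorem HolM.delbar (hU : IsOpen U) {F : (Fin n → ℂ) → Matrix (Fin k) (Fin l) ℂ}
    (hF : HolM F U) {z : Fin n → ℂ} (hz : z ∈ U) (u : Fin n → ℂ) :
    DonaldsonRay.ddM Complex.I F z u = 0 := by
  ext a b
  simp [DonaldsonRay.ddM, dd_eq_of_differentiableAt (hF.differentiableAt hU hz a b)]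

theorem dd_conj (ε : ℂ) (f : (Fin n → ℂ) → ℂ) (z u : Fin n → ℂ) :
    dd ε (fun z => (starRingEnd ℂ) (f z)) z u =
      (starRingEnd ℂ) (dd ((starRingEnd ℂ) ε) f z u) := by
  have h : ∀ v, fderiv ℝ (fun z => (starRingEnd ℂ) (f z)) z v =
      (starRingEnd ℂ) (fderiv ℝ f z v) := fun v =>
    DFunLike.congr_fun (Complex.conjCLE.comp_fderiv (f := f) (x := z)) v
  simp [dd, h, Complex.conj_ofNat]

theorem HolM.del_conjTranspose (hU : IsOpen U) {F : (Fin n → ℂ) → Matrix (Fin k) (Fin l) ℂ}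
    (hF : HolM F U) {z : Fin n → ℂ} (hz : z ∈ U) (u : Fin n → ℂ) :
    DonaldsonRay.ddM (-Complex.I) (fun z => (F z)ᴴ) z u = 0 := by
  ext a b
  have h := dd_conj (-Complex.I) (fun z => F z b a) z u
  have h2 := dd_eq_of_differentiableAt (hF.differentiableAt hU hz b a) Complex.I u
  simp only [map_neg, Complex.conj_I, neg_neg, h2] at h
  simpa [DonaldsonRay.ddM] using h

theorem HolM.del (hU : IsOpen U) {F : (Fin n → ℂ) → Matrix (Fin k) (Fin l) ℂ}
    (hF : HolM F U) (u : Fin n → ℂ) : HolM (fun z => DonaldsonRay.ddM (-Complex.I) F z u) U := by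
  intro a b
  have h : ContDiffOn ℂ ω (fun z => fderiv ℂ (fun z => F z a b) z u) U :=
    ((hF a b).fderiv_of_isOpen hU (by simp)).clm_apply contDiffOn_const
  refine h.congr fun z hz => ?_
  simp [DonaldsonRay.ddM, dd_eq_of_differentiableAt (hF.differentiableAt hU hz a b)]

theorem dd_comp {f : (Fin n → ℂ) → ℂ} {τ : (Fin n → ℂ) → (Fin n → ℂ)} {z : Fin n → ℂ}
    (hf : DifferentiableAt ℝ f (τ z)) (hτ : DifferentiableAt ℂ τ z) (ε : ℂ) (u : Fin n → ℂ) :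
    dd ε (fun z => f (τ z)) z u = dd ε f (τ z) (fderiv ℂ τ z u) := by
  have h := (HasFDerivAt.comp z hf.hasFDerivAt (hτ.hasFDerivAt.restrictScalars ℝ)).fderiv
  have h' : fderiv ℝ (fun z => f (τ z)) z =
    (fderiv ℝ f (τ z)).comp ((fderiv ℂ τ z).restrictScalars ℝ) := h
  simp only [dd, h', ContinuousLinearMap.comp_apply, ContinuousLinearMap.coe_restrictScalars',
    map_smul]

theorem SmoothM.comp {V : Set (Fin n → ℂ)} {F : (Fin n → ℂ) → Matrix (Fin k) (Fin l) ℂ}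
    (hF : SmoothM F V) {τ : (Fin n → ℂ) → (Fin n → ℂ)} (hτ : ContDiffOn ℂ ω τ U)
    (hmaps : MapsTo τ U V) : SmoothM (fun z => F (τ z)) U := fun a b =>
  (hF a b).comp ((hτ.restrict_scalars ℝ).of_le (by simp)) hmaps

/-- `∂f` is of type `(1,0)`. Consequently `conn` is complex linear in the direction. -/
theorem del_smul (f : (Fin n → ℂ) → ℂ) (z u : Fin n → ℂ) (c : ℂ) :
    dd (-Complex.I) f z (c • u) = c * dd (-Complex.I) f z u := by
  have h : c • u = c.re • u + c.im • (Complex.I • u) := by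
    ext j
    simp only [Pi.smul_apply, Pi.add_apply, Complex.real_smul, smul_eq_mul]
    rw [← mul_assoc, ← add_mul, Complex.re_add_im]
  have h2 : Complex.I • c • u = c.re • (Complex.I • u) - c.im • u := by
    rw [h]
    ext j
    simp only [Pi.smul_apply, Pi.add_apply, Pi.sub_apply, Complex.real_smul, smul_eq_mul]
    linear_combination (c.im * u j : ℂ) * Complex.I_mul_I
  simp only [dd]
  rw [h2, h]
  simp only [map_add, map_sub, map_smul, Complex.real_smul]
  conv_rhs => rw [← Complex.re_add_im c]
  linear_combination (c.im * (fderiv ℝ f z) (Complex.I • u) / 2 : ℂ) * Complex.I_mul_I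

theorem dd_add_right (ε : ℂ) (f : (Fin n → ℂ) → ℂ) (z u v : Fin n → ℂ) :
    dd ε f z (u + v) = dd ε f z u + dd ε f z v := by
  simp only [dd, smul_add, map_add]
  ring

theorem dd_smul_right (ε : ℂ) (f : (Fin n → ℂ) → ℂ) (z u : Fin n → ℂ) (c : ℝ) :
    dd ε f z (c • u) = c * dd ε f z u := by
  have h : Complex.I • c • u = c • Complex.I • u := smul_comm _ _ _
  simp only [dd, h, map_smul, Complex.real_smul]
  ring

/-- `∂_u ∂_v f` is symmetric in `u` and `v`. -/
theorem dd_comm (hU : IsOpen U) {f : (Fin n → ℂ) → ℂ} (hf : ContDiffOn ℝ ∞ f U) (ε δ : ℂ)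
    {z : Fin n → ℂ} (hz : z ∈ U) (u v : Fin n → ℂ) :
    dd ε (fun z => dd δ f z v) z u = dd δ (fun z => dd ε f z u) z v := by
  have hfz : ContDiffAt ℝ ∞ f z := hf.contDiffAt (hU.mem_nhds hz)
  have hd : DifferentiableAt ℝ (fderiv ℝ f) z :=
    (hfz.fderiv_right (m := 1) (by rw [one_add_one_eq_two]; exact ENat.LEInfty.out)).differentiableAt (by simp)
  have hv : ∀ s t, fderiv ℝ (fun z => fderiv ℝ f z s) z t = fderiv ℝ (fderiv ℝ f) z t s := by
    intro s t
    rw [fderiv_clm_apply hd (by fun_prop)]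
    simp
  have hsymm : ∀ s t, fderiv ℝ (fderiv ℝ f) z s t = fderiv ℝ (fderiv ℝ f) z t s := fun s t =>
    (hfz.isSymmSndFDerivAt (by simpa using ENat.LEInfty.out)) s t
  have hd' : ∀ s, DifferentiableAt ℝ (fun z => fderiv ℝ f z s) z := fun s =>
    hd.clm_apply (by fun_prop)
  have hexp : ∀ (α : ℂ) s t, fderiv ℝ (fun z => dd α f z s) z t =
      (fderiv ℝ (fderiv ℝ f) z t s + α * fderiv ℝ (fderiv ℝ f) z t (Complex.I • s)) / 2 := by
    intro α s t
    have : (fun z => dd α f z s) = fun z =>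
      (2⁻¹ : ℂ) * (fderiv ℝ f z s + α * fderiv ℝ f z (Complex.I • s)) := by
      ext z
      simp only [dd]
      ring
    rw [this, fderiv_const_mul ((hd' _).fun_add ((hd' _).const_mul _)),
      fderiv_fun_add (hd' _) ((hd' _).const_mul _), fderiv_const_mul (hd' _)]
    simp only [smul_apply, add_apply, smul_eq_mul, hv]
    ring
  rw [dd, dd, hexp, hexp, hexp, hexp, hsymm u v, hsymm u (Complex.I • v),
    hsymm (Complex.I • u) v, hsymm (Complex.I • u) (Complex.I • v)]
  ring

end MatrixCalculus

/-! ## The Chern connection and its curvature in a holomorphic frame -/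

section Curvature

open scoped Matrix

variable {n k r : ℕ} {U V : Set (Fin n → ℂ)}

/-- The connection matrix `(∂H) H⁻¹` of the Gram matrix `H`. -/
def conn (H : (Fin n → ℂ) → Matrix (Fin k) (Fin k) ℂ) (z u : Fin n → ℂ) :
    Matrix (Fin k) (Fin k) ℂ :=
  ddM (-Complex.I) H z u * (H z)⁻¹

/-- The curvature matrix `√-1 ∂̄((∂H) H⁻¹)` of the Gram matrix `H`. -/
def curv (H : (Fin n → ℂ) → Matrix (Fin k) (Fin k) ℂ) (z u v : Fin n → ℂ) :
    Matrix (Fin k) (Fin k) ℂ :=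
  Complex.I • (ddM Complex.I (fun z => conn H z v) z u - ddM Complex.I (fun z => conn H z u) z v)

theorem smoothM_conn (hU : IsOpen U) {H : (Fin n → ℂ) → Matrix (Fin k) (Fin k) ℂ}
    (hH : SmoothM H U) (hdet : ∀ z ∈ U, (H z).det ≠ 0) (u : Fin n → ℂ) :
    SmoothM (fun z => conn H z u) U := (hH.ddM hU _ u).mul (hH.inv hdet)

theorem smoothM_curv (hU : IsOpen U) {H : (Fin n → ℂ) → Matrix (Fin k) (Fin k) ℂ}
    (hH : SmoothM H U) (hdet : ∀ z ∈ U, (H z).det ≠ 0) (u v : Fin n → ℂ) :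
    SmoothM (fun z => curv H z u v) U :=
  (((smoothM_conn hU hH hdet v).ddM hU _ u).sub
    ((smoothM_conn hU hH hdet u).ddM hU _ v)).const_smul _

theorem ddM_del_smul (H : (Fin n → ℂ) → Matrix (Fin k) (Fin k) ℂ) (z u : Fin n → ℂ) (c : ℂ) :
    ddM (-Complex.I) H z (c • u) = c • ddM (-Complex.I) H z u := by
  ext a b
  exact del_smul _ z u c

theorem ddM_add_right (ε : ℂ) (H : (Fin n → ℂ) → Matrix (Fin k) (Fin k) ℂ) (z u v : Fin n → ℂ) :
    ddM ε H z (u + v) = ddM ε H z u + ddM ε H z v := by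
  ext a b
  exact dd_add_right ε _ z u v

theorem ddM_smul_right (ε : ℂ) (H : (Fin n → ℂ) → Matrix (Fin k) (Fin k) ℂ) (z u : Fin n → ℂ)
    (c : ℝ) : ddM ε H z (c • u) = (c : ℂ) • ddM ε H z u := by
  ext a b
  exact dd_smul_right ε _ z u c

theorem conn_smul (H : (Fin n → ℂ) → Matrix (Fin k) (Fin k) ℂ) (z u : Fin n → ℂ) (c : ℂ) :
    conn H z (c • u) = c • conn H z u := by
  simp [conn, ddM_del_smul]

theorem conn_add (H : (Fin n → ℂ) → Matrix (Fin k) (Fin k) ℂ) (z u v : Fin n → ℂ) :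
    conn H z (u + v) = conn H z u + conn H z v := by
  simp [conn, ddM_add_right, Matrix.add_mul]

/-- Separates the point from the direction, so that `conn` can be differentiated when the direction
itself varies with the point. -/
theorem conn_eq_sum (H : (Fin n → ℂ) → Matrix (Fin k) (Fin k) ℂ) (z u : Fin n → ℂ) :
    conn H z u = ∑ j, u j • conn H z (Pi.single j 1) := by
  let L : (Fin n → ℂ) →ₗ[ℂ] Matrix (Fin k) (Fin k) ℂ :=
    { toFun := conn H z
      map_add' := conn_add H z
      map_smul' := fun c u => conn_smul H z u c }
  have h : L u = ∑ j, u j • L (Pi.single j 1) := by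
    conv_lhs => rw [pi_eq_sum_univ' u]
    simp [map_sum]
  exact h

theorem curv_skew (H : (Fin n → ℂ) → Matrix (Fin k) (Fin k) ℂ) (z u v : Fin n → ℂ) :
    curv H z u v = - curv H z v u := by
  simp [curv, ← smul_neg]

theorem curv_add_left (hU : IsOpen U) {H : (Fin n → ℂ) → Matrix (Fin k) (Fin k) ℂ}
    (hH : SmoothM H U) (hdet : ∀ z ∈ U, (H z).det ≠ 0) {z : Fin n → ℂ} (hz : z ∈ U)
    (u u' v : Fin n → ℂ) : curv H z (u + u') v = curv H z u v + curv H z u' v := by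
  simp only [curv, ddM_add_right, conn_add]
  rw [ddM_add hU (smoothM_conn hU hH hdet u) (smoothM_conn hU hH hdet u') _ hz, ← smul_add]
  congr 1
  abel

theorem curv_smul_left (hU : IsOpen U) {H : (Fin n → ℂ) → Matrix (Fin k) (Fin k) ℂ}
    (hH : SmoothM H U) (hdet : ∀ z ∈ U, (H z).det ≠ 0) {z : Fin n → ℂ} (hz : z ∈ U)
    (c : ℝ) (u v : Fin n → ℂ) : curv H z (c • u) v = (c : ℂ) • curv H z u v := by
  have h : ∀ y, conn H y (c • u) = (c : ℂ) • conn H y u := fun y => conn_smul H y u c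
  simp only [curv, ddM_smul_right, h]
  rw [ddM_const_smul hU (smoothM_conn hU hH hdet u) _ _ hz, ← smul_sub, smul_comm]

/-- A linear functional of the curvature is a real bilinear form. -/
theorem exists_bilin_curv (hU : IsOpen U) {H : (Fin n → ℂ) → Matrix (Fin k) (Fin k) ℂ}
    (hH : SmoothM H U) (hdet : ∀ z ∈ U, (H z).det ≠ 0) {z : Fin n → ℂ} (hz : z ∈ U)
    (L : Matrix (Fin k) (Fin k) ℂ →ₗ[ℂ] ℂ) :
    ∃ b : (Fin n → ℂ) →ₗ[ℝ] (Fin n → ℂ) →ₗ[ℝ] ℂ, ∀ u v, L (curv H z u v) = b u v := by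
  refine ⟨LinearMap.mk₂ ℝ (fun u v => L (curv H z u v)) ?_ ?_ ?_ ?_, fun u v => rfl⟩
  · intro u u' v
    rw [curv_add_left hU hH hdet hz, map_add]
  · intro c u v
    rw [curv_smul_left hU hH hdet hz, map_smul]
    rfl
  · intro u v v'
    rw [curv_skew, curv_add_left hU hH hdet hz, curv_skew H z u v, curv_skew H z u v']
    simp [add_comm]
  · intro c u v
    rw [curv_skew, curv_smul_left hU hH hdet hz, curv_skew H z u v]
    simp

/-! ### Change of holomorphic frame and of chart -/

section Change

variable {H H' M : (Fin n → ℂ) → Matrix (Fin k) (Fin k) ℂ} {τ : (Fin n → ℂ) → (Fin n → ℂ)}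

theorem ddM_comp (hV : IsOpen V) (hH : SmoothM H V) (hU : IsOpen U) (hτ : ContDiffOn ℂ ω τ U)
    (hmaps : MapsTo τ U V) (ε : ℂ) {z : Fin n → ℂ} (hz : z ∈ U) (u : Fin n → ℂ) :
    ddM ε (fun z => H (τ z)) z u = ddM ε H (τ z) (fderiv ℂ τ z u) := by
  ext a b
  exact dd_comp (hH.differentiableAt hV (hmaps hz) a b)
    ((hτ.contDiffAt (hU.mem_nhds hz)).differentiableAt (by simp)) ε u

/-- `∂(Mᴴ) = 0` because `M` is holomorphic. The Leibniz rule for `M H Mᴴ` therefore leaves two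
terms, and their right-hand factors cancel against the inverse. -/
theorem conn_change (hU : IsOpen U) (hV : IsOpen V) (hH : SmoothM H V) (hM : HolM M U)
    (hMdet : ∀ z ∈ U, (M z).det ≠ 0)
    (hτ : ContDiffOn ℂ ω τ U) (hmaps : MapsTo τ U V)
    (hHH' : ∀ z ∈ U, H' z = M z * H (τ z) * (M z)ᴴ) {z : Fin n → ℂ} (hz : z ∈ U)
    (hdetz : (H (τ z)).det ≠ 0) (u : Fin n → ℂ) :
    conn H' z u = ddM (-Complex.I) M z u * (M z)⁻¹ +
      M z * conn H (τ z) (fderiv ℂ τ z u) * (M z)⁻¹ := by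
  have hHτ := hH.comp hτ hmaps
  have hd : ddM (-Complex.I) H' z u = ddM (-Complex.I) M z u * H (τ z) * (M z)ᴴ +
      M z * ddM (-Complex.I) H (τ z) (fderiv ℂ τ z u) * (M z)ᴴ := by
    rw [ddM_congr hU hHH' _ hz, ddM_mul hU (hM.smoothM.mul hHτ) hM.smoothM.conjTranspose _ hz,
      ddM_mul hU hM.smoothM hHτ _ hz, hM.del_conjTranspose hU hz, ddM_comp hV hH hU hτ hmaps _ hz,
      mul_zero, add_zero, Matrix.add_mul]
  have hMu : IsUnit (M z).det := isUnit_iff_ne_zero.2 (hMdet z hz)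
  have hMhu : IsUnit ((M z)ᴴ).det := by
    rw [Matrix.det_conjTranspose]
    exact hMu.star
  have hHu : IsUnit (H (τ z)).det := isUnit_iff_ne_zero.2 hdetz
  unfold conn
  rw [hd, hHH' z hz, Matrix.mul_inv_rev, Matrix.mul_inv_rev, Matrix.add_mul]
  congr 1
  · rw [mul_assoc, Matrix.mul_nonsing_inv_cancel_left _ _ hMhu, mul_assoc,
      Matrix.mul_nonsing_inv_cancel_left _ _ hHu]
  · rw [mul_assoc (M z * _), Matrix.mul_nonsing_inv_cancel_left _ _ hMhu]
    simp only [mul_assoc]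

/-- The gauge term involves only `M` and not `H`, so it drops out when two metrics are compared. -/
theorem trace_conn_change (hU : IsOpen U) (hV : IsOpen V) (hH : SmoothM H V) (hM : HolM M U)
    (hMdet : ∀ z ∈ U, (M z).det ≠ 0)
    (hτ : ContDiffOn ℂ ω τ U) (hmaps : MapsTo τ U V)
    (hHH' : ∀ z ∈ U, H' z = M z * H (τ z) * (M z)ᴴ) {z : Fin n → ℂ} (hz : z ∈ U)
    (hdetz : (H (τ z)).det ≠ 0) (u : Fin n → ℂ) :
    (conn H' z u).trace = (ddM (-Complex.I) M z u * (M z)⁻¹).trace +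
      (conn H (τ z) (fderiv ℂ τ z u)).trace := by
  rw [conn_change hU hV hH hM hMdet hτ hmaps hHH' hz hdetz, Matrix.trace_add,
    Matrix.trace_mul_cycle, Matrix.nonsing_inv_mul _ (isUnit_iff_ne_zero.2 (hMdet z hz)), one_mul]

/-- The direction `dτ(v)` varies holomorphically with the point, so `∂̄` does not see its variation
and the direction can be frozen. -/
theorem delbar_conn_comp (hU : IsOpen U) (hV : IsOpen V) (hH : SmoothM H V)
    (hdet : ∀ z ∈ V, (H z).det ≠ 0) (hτ : ContDiffOn ℂ ω τ U) (hmaps : MapsTo τ U V)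
    {z : Fin n → ℂ} (hz : z ∈ U) (u v : Fin n → ℂ) :
    ddM Complex.I (fun z => conn H (τ z) (fderiv ℂ τ z v)) z u =
      ddM Complex.I (fun y => conn H y (fderiv ℂ τ z v)) (τ z) (fderiv ℂ τ z u) := by
  have hc := fun j => smoothM_conn hV hH hdet (Pi.single j 1)
  have hτz : DifferentiableAt ℂ τ z :=
    (hτ.contDiffAt (hU.mem_nhds hz)).differentiableAt (by simp)
  have hξ : ∀ j, DifferentiableAt ℂ (fun z => fderiv ℂ τ z v j) z := by
    intro j
    have h : ContDiffOn ℂ ω (fun z => fderiv ℂ τ z v) U :=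
      (hτ.fderiv_of_isOpen hU (by simp)).clm_apply contDiffOn_const
    exact differentiableAt_pi.1 ((h.contDiffAt (hU.mem_nhds hz)).differentiableAt (by simp)) j
  ext a b
  have hcd : ∀ j, DifferentiableAt ℝ (fun y => conn H y (Pi.single j 1) a b) (τ z) :=
    fun j => (hc j).differentiableAt hV (hmaps hz) a b
  have hcd' : ∀ j, DifferentiableAt ℝ (fun y => conn H (τ y) (Pi.single j 1) a b) z :=
    fun j => (hcd j).comp z (hτz.restrictScalars ℝ)
  have hξ' := fun j => (hξ j).restrictScalars ℝ
  simp only [ddM, Matrix.of_apply]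
  have e1 : (fun z => conn H (τ z) (fderiv ℂ τ z v) a b) = fun z =>
      ∑ j, fderiv ℂ τ z v j * conn H (τ z) (Pi.single j 1) a b := by
    ext z
    rw [conn_eq_sum, Matrix.sum_apply]
    rfl
  have e2 : (fun y => conn H y (fderiv ℂ τ z v) a b) = fun y =>
      ∑ j, fderiv ℂ τ z v j * conn H y (Pi.single j 1) a b := by
    ext z
    rw [conn_eq_sum, Matrix.sum_apply]
    rfl
  rw [e1, e2, dd_sum (f := fun j z => fderiv ℂ τ z v j * conn H (τ z) (Pi.single j 1) a b)
    (fun j _ => (hξ' j).mul (hcd' j)),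
    dd_sum (f := fun j y => fderiv ℂ τ z v j * conn H y (Pi.single j 1) a b)
    (fun j _ => (hcd j).const_mul _)]
  refine Finset.sum_congr rfl fun j _ => ?_
  rw [dd_mul (hξ' j) (hcd' j), dd_mul (by fun_prop) (hcd j), dd_const,
    dd_eq_of_differentiableAt (hξ j),
    dd_comp (f := fun y => conn H y (Pi.single j 1) a b) (hcd j) hτz]
  simp

/-- `∂̄` kills the holomorphic gauge term of `conn_change` and passes through `M` and `M⁻¹`. -/
theorem curv_change (hU : IsOpen U) (hV : IsOpen V) (hH : SmoothM H V)
    (hdet : ∀ z ∈ V, (H z).det ≠ 0) (hM : HolM M U) (hMdet : ∀ z ∈ U, (M z).det ≠ 0)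
    (hτ : ContDiffOn ℂ ω τ U) (hmaps : MapsTo τ U V)
    (hHH' : ∀ z ∈ U, H' z = M z * H (τ z) * (M z)ᴴ) {z : Fin n → ℂ} (hz : z ∈ U)
    (u v : Fin n → ℂ) :
    curv H' z u v = M z * curv H (τ z) (fderiv ℂ τ z u) (fderiv ℂ τ z v) * (M z)⁻¹ := by
  have hMi := hM.inv hMdet
  have hξ : ∀ v, SmoothM (fun z => conn H (τ z) (fderiv ℂ τ z v)) U := by
    intro v
    have h : ContDiffOn ℂ ω (fun z => fderiv ℂ τ z v) U :=
      (hτ.fderiv_of_isOpen hU (by simp)).clm_apply contDiffOn_const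
    have h' : ∀ j, ContDiffOn ℝ ∞ (fun z => fderiv ℂ τ z v j) U := fun j =>
      ((contDiffOn_pi.1 h j).restrict_scalars ℝ).of_le (by simp)
    intro a b
    have e1 : (fun z => conn H (τ z) (fderiv ℂ τ z v) a b) = fun z =>
        ∑ j, fderiv ℂ τ z v j * conn H (τ z) (Pi.single j 1) a b := by
      ext z
      rw [conn_eq_sum, Matrix.sum_apply]
      rfl
    rw [e1]
    exact ContDiffOn.sum fun j _ => (h' j).mul
      ((smoothM_conn hV hH hdet (Pi.single j 1)).comp hτ hmaps a b)
  have key : ∀ u v, ddM Complex.I (fun z => conn H' z v) z u =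
      M z * ddM Complex.I (fun y => conn H y (fderiv ℂ τ z v)) (τ z) (fderiv ℂ τ z u) *
        (M z)⁻¹ := by
    intro u v
    have hd := hM.del hU v
    rw [ddM_congr hU (fun y hy => conn_change hU hV hH hM hMdet hτ hmaps hHH' hy
      (hdet _ (hmaps hy)) v) _ hz, ddM_add hU (hd.smoothM.mul hMi.smoothM)
      ((hM.smoothM.mul (hξ v)).mul hMi.smoothM) _ hz, (hd.mul hMi).delbar hU hz, zero_add,
      ddM_mul hU (hM.smoothM.mul (hξ v)) hMi.smoothM _ hz, hMi.delbar hU hz, mul_zero, add_zero,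
      ddM_mul hU hM.smoothM (hξ v) _ hz, hM.delbar hU hz, Matrix.zero_mul, zero_add,
      delbar_conn_comp hU hV hH hdet hτ hmaps hz]
  unfold curv
  rw [key, key, ← Matrix.sub_mul, ← Matrix.mul_sub, Matrix.mul_smul, Matrix.smul_mul]

end Change

/-- The trace of the curvature is the exterior derivative of the trace of the connection matrix. -/
theorem trace_curv_eq (hU : IsOpen U) {H : (Fin n → ℂ) → Matrix (Fin k) (Fin k) ℂ}
    (hH : SmoothM H U) (hdet : ∀ z ∈ U, (H z).det ≠ 0) {z : Fin n → ℂ} (hz : z ∈ U)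
    (u v : Fin n → ℂ) :
    (curv H z u v).trace = Complex.I * (fderiv ℝ (fun z => (conn H z v).trace) z u
      - fderiv ℝ (fun z => (conn H z u).trace) z v) := by
  have hc := fun t => smoothM_conn hU hH hdet t
  -- The curvature consists of the `∂̄` part only, so the `∂` part of `d tr A` has to cancel. It is
  -- symmetric in `u` and `v`, because second derivatives commute and `tr(A_v A_u) = tr(A_u A_v)`.
  have hdel : ∀ u v, (ddM (-Complex.I) (fun z => conn H z v) z u).trace =
      (ddM (-Complex.I) (fun z => ddM (-Complex.I) H z v) z u * (H z)⁻¹).trace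
        - (conn H z v * conn H z u).trace := by
    intro u v
    have h := ddM_mul hU (hH.ddM hU (-Complex.I) v) (hH.inv hdet) (-Complex.I) hz u
    have h' : ddM (-Complex.I) (fun z => conn H z v) z u = _ := h
    rw [h', ddM_inv hU hH hdet _ hz, Matrix.trace_add, Matrix.mul_neg, Matrix.trace_neg,
      sub_eq_add_neg]
    simp only [conn, mul_assoc]
  have hsymm : ddM (-Complex.I) (fun z => ddM (-Complex.I) H z v) z u =
      ddM (-Complex.I) (fun z => ddM (-Complex.I) H z u) z v := by
    ext a b
    exact dd_comm hU (hH a b) _ _ hz u v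
  rw [fderiv_eq_dd_add_dd, fderiv_eq_dd_add_dd, dd_trace hU (hc v) _ hz, dd_trace hU (hc u) _ hz,
    dd_trace hU (hc v) _ hz, dd_trace hU (hc u) _ hz, hdel, hdel, hsymm,
    Matrix.trace_mul_comm (conn H z v)]
  simp only [curv, Matrix.trace_smul, Matrix.trace_sub, smul_eq_mul]
  ring

/-! ### Induced connection and curvature of a subbundle -/

section ChernWeil

variable {H : (Fin n → ℂ) → Matrix (Fin r) (Fin r) ℂ} {B : (Fin n → ℂ) → Matrix (Fin k) (Fin r) ℂ}
  {C : (Fin n → ℂ) → Matrix (Fin r) (Fin k) ℂ}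

/-- The rows of `B` are the coordinates of a frame of the subbundle, and `C`, pinned down by `hCH`,
is the orthogonal projection to the subbundle in these coordinates. The formula says that the
induced connection is the projection of the ambient one. -/
theorem conn_sub (hU : IsOpen U) (hH : SmoothM H U) (hdet : ∀ z ∈ U, (H z).det ≠ 0)
    (hB : HolM B U) (hS : ∀ z ∈ U, (B z * H z * (B z)ᴴ).det ≠ 0)
    (hCH : ∀ z ∈ U, C z * (B z * H z * (B z)ᴴ) = H z * (B z)ᴴ) {z : Fin n → ℂ} (hz : z ∈ U)
    (v : Fin n → ℂ) :
    conn (fun z => B z * H z * (B z)ᴴ) z v =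
      (ddM (-Complex.I) B z v + B z * conn H z v) * C z := by
  have hSu : IsUnit (B z * H z * (B z)ᴴ).det := isUnit_iff_ne_zero.2 (hS z hz)
  have hHu : IsUnit (H z).det := isUnit_iff_ne_zero.2 (hdet z hz)
  have hC : C z = H z * (B z)ᴴ * (B z * H z * (B z)ᴴ)⁻¹ := by
    rw [← hCH z hz, Matrix.mul_nonsing_inv_cancel_right _ _ hSu]
  unfold conn
  rw [ddM_mul hU (hB.smoothM.mul hH) hB.smoothM.conjTranspose _ hz, hB.del_conjTranspose hU hz,
    Matrix.mul_zero, add_zero, ddM_mul hU hB.smoothM hH _ hz]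
  generalize hi : (B z * H z * (B z)ᴴ)⁻¹ = S at hC
  rw [hC]
  simp only [Matrix.add_mul, Matrix.mul_assoc]
  rw [Matrix.nonsing_inv_mul_cancel_left _ _ hHu]

/-- Apply `∂̄` to `B C = 1`, with `B` holomorphic. Thus `∂̄C` vanishes on the subbundle, as a second
fundamental form should. -/
theorem delbar_section (hU : IsOpen U) (hB : HolM B U) (hC : SmoothM C U)
    (hBC : ∀ z ∈ U, B z * C z = 1) {z : Fin n → ℂ} (hz : z ∈ U) (u : Fin n → ℂ) :
    B z * ddM Complex.I C z u = 0 := by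
  have h := ddM_mul hU hB.smoothM hC Complex.I hz u
  rw [ddM_congr hU hBC _ hz, ddM_const, hB.delbar hU hz, Matrix.zero_mul, zero_add] at h
  exact h.symm

/-- The Gauss-Codazzi formula for the trace of the curvature of a subbundle. -/
theorem trace_curv_sub (hU : IsOpen U) (hH : SmoothM H U) (hdet : ∀ z ∈ U, (H z).det ≠ 0)
    (hB : HolM B U) (hS : ∀ z ∈ U, (B z * H z * (B z)ᴴ).det ≠ 0) (hC : SmoothM C U)
    (hCH : ∀ z ∈ U, C z * (B z * H z * (B z)ᴴ) = H z * (B z)ᴴ) {z : Fin n → ℂ} (hz : z ∈ U)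
    (u v : Fin n → ℂ) :
    (curv (fun z => B z * H z * (B z)ᴴ) z u v).trace = (curv H z u v * (C z * B z)).trace +
      Complex.I * (((ddM (-Complex.I) B z v + B z * conn H z v) * ddM Complex.I C z u).trace
        - ((ddM (-Complex.I) B z u + B z * conn H z u) * ddM Complex.I C z v).trace) := by
  -- Apply `∂̄` to `conn_sub`. As `B` and `∂B` are holomorphic, the derivative falls either on the
  -- ambient connection, giving the compressed curvature, or on `C`, giving the second fundamental
  -- form.
  have key : ∀ u v, (ddM Complex.I (fun z => conn (fun z => B z * H z * (B z)ᴴ) z v) z u).trace =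
      (ddM Complex.I (fun z => conn H z v) z u * (C z * B z)).trace +
        ((ddM (-Complex.I) B z v + B z * conn H z v) * ddM Complex.I C z u).trace := by
    intro u v
    have hc := smoothM_conn hU hH hdet v
    have hdB := hB.del hU v
    rw [ddM_congr hU (fun y hy => conn_sub hU hH hdet hB hS hCH hy v) _ hz,
      ddM_mul hU (hdB.smoothM.add (hB.smoothM.mul hc)) hC _ hz, Matrix.trace_add,
      ddM_add hU hdB.smoothM (hB.smoothM.mul hc) _ hz, hdB.delbar hU hz, zero_add,
      ddM_mul hU hB.smoothM hc _ hz, hB.delbar hU hz, Matrix.zero_mul, zero_add,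
      Matrix.trace_mul_cycle, Matrix.trace_mul_comm (C z * B z)]
  simp only [curv, Matrix.trace_smul, Matrix.trace_sub, smul_eq_mul, key, Matrix.smul_mul,
    Matrix.sub_mul]
  ring

end ChernWeil

end Curvature

/-! ## The second fundamental form along a ray -/

section Ray

open scoped Matrix

variable {n k r : ℕ} {U : Set (Fin n → ℂ)} {ι : Type*} [DecidableEq ι] {s T : Finset ι}
  {H : (Fin n → ℂ) → Matrix (Fin r) (Fin r) ℂ} {Q : ι → (Fin n → ℂ) → Matrix (Fin r) (Fin r) ℂ}
  {B : (Fin n → ℂ) → Matrix (Fin k) (Fin r) ℂ}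

theorem sum_idempotents_mul {q : ι → Matrix (Fin r) (Fin r) ℂ}
    (hq : ∀ i ∈ s, ∀ j ∈ s, q i * q j = if i = j then q i else 0) (hsum : ∑ i ∈ s, q i = 1)
    (e : ι → ℂ) (he : ∀ i ∈ s, e i ≠ 0) :
    (∑ i ∈ s, e i • q i) * (∑ i ∈ s, (e i)⁻¹ • q i) = 1 := by
  rw [← hsum, Finset.sum_mul]
  refine Finset.sum_congr rfl fun i hi => ?_
  rw [Finset.mul_sum, Finset.sum_eq_single i]
  · rw [Matrix.smul_mul, Matrix.mul_smul, hq i hi i hi, if_pos rfl, smul_smul,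
      mul_inv_cancel₀ (he i hi), one_smul]
  · intro j hj hji
    rw [Matrix.smul_mul, Matrix.mul_smul, hq i hi j hj, if_neg hji.symm, smul_zero, smul_zero]
  · exact fun h => absurd hi h

/-- The coefficients `eᵢ` are constants, so differentiation only touches the idempotents, and `∑ eᵢ
Qᵢ` is inverted by inverting the coefficients. -/
theorem conn_ray (hU : IsOpen U) (hH : SmoothM H U) (hdet : ∀ z ∈ U, (H z).det ≠ 0)
    (hQ : ∀ i ∈ s, SmoothM (Q i) U)
    (hQQ : ∀ z ∈ U, ∀ i ∈ s, ∀ j ∈ s, Q i z * Q j z = if i = j then Q i z else 0)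
    (hsum : ∀ z ∈ U, ∑ i ∈ s, Q i z = 1) (e : ι → ℂ) (he : ∀ i ∈ s, e i ≠ 0)
    {z : Fin n → ℂ} (hz : z ∈ U) (v : Fin n → ℂ) :
    conn (fun z => (∑ i ∈ s, e i • Q i z) * H z) z v =
      (∑ i ∈ s, e i • (ddM (-Complex.I) (Q i) z v + Q i z * conn H z v)) *
        (∑ i ∈ s, (e i)⁻¹ • Q i z) := by
  have hHu : IsUnit (H z).det := isUnit_iff_ne_zero.2 (hdet z hz)
  have hinv : (∑ i ∈ s, e i • Q i z)⁻¹ = ∑ i ∈ s, (e i)⁻¹ • Q i z :=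
    Matrix.inv_eq_right_inv (sum_idempotents_mul (hQQ z hz) (hsum z hz) e he)
  have hK : SmoothM (fun z => ∑ i ∈ s, e i • Q i z) U :=
    SmoothM.sum fun i hi => (hQ i hi).const_smul _
  have hdK : ddM (-Complex.I) (fun z => ∑ i ∈ s, e i • Q i z) z v =
      ∑ i ∈ s, e i • ddM (-Complex.I) (Q i) z v := by
    rw [ddM_sum hU (F := fun i z => e i • Q i z) (fun i hi => (hQ i hi).const_smul _) _ hz]
    exact Finset.sum_congr rfl fun i hi => ddM_const_smul hU (hQ i hi) _ _ hz v
  unfold conn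
  rw [ddM_mul hU hK hH _ hz, hdK, Matrix.mul_inv_rev, hinv, ← Matrix.mul_assoc]
  congr 1
  rw [Matrix.add_mul, Matrix.mul_nonsing_inv_cancel_right _ _ hHu]
  simp only [smul_add, Finset.sum_add_distrib, Matrix.mul_assoc, Finset.sum_mul, Matrix.smul_mul]

/-- Along the ray `∑ eᵢ Qᵢ H` the second fundamental form of a subbundle that is compatible with the
idempotents `Qᵢ` is a combination of the exponential factors `eᵢ / eⱼ`. -/
theorem second_form_ray (hU : IsOpen U) (hH : SmoothM H U) (hdet : ∀ z ∈ U, (H z).det ≠ 0)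
    (hQ : ∀ i ∈ s, SmoothM (Q i) U)
    (hQQ : ∀ z ∈ U, ∀ i ∈ s, ∀ j ∈ s, Q i z * Q j z = if i = j then Q i z else 0)
    (hsum : ∀ z ∈ U, ∑ i ∈ s, Q i z = 1) (e : ι → ℂ) (he : ∀ i ∈ s, e i ≠ 0)
    (hB : HolM B U) (hT : T ⊆ s) (hBQ : ∀ z ∈ U, ∀ i ∈ s \ T, B z * Q i z = 0)
    {z : Fin n → ℂ} (hz : z ∈ U) {Y : Matrix (Fin r) (Fin k) ℂ} (hY : ∀ i ∈ T, Q i z * Y = 0)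
    (v : Fin n → ℂ) :
    (ddM (-Complex.I) B z v + B z * conn (fun z => (∑ i ∈ s, e i • Q i z) * H z) z v) * Y =
      ∑ i ∈ T, ∑ j ∈ s \ T, (e i / e j) •
        (B z * (ddM (-Complex.I) (Q i) z v + Q i z * conn H z v) * Q j z * Y) := by
  rw [conn_ray hU hH hdet hQ hQQ hsum e he hz, Matrix.add_mul]
  have hKY : (∑ i ∈ s, (e i)⁻¹ • Q i z) * Y = ∑ j ∈ s \ T, (e j)⁻¹ • (Q j z * Y) := by
    rw [Matrix.sum_mul, ← Finset.sum_sdiff hT, add_eq_left.2]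
    · simp only [Matrix.smul_mul]
    · exact Finset.sum_eq_zero fun i hi => by rw [Matrix.smul_mul, hY i hi, smul_zero]
  -- Differentiating `B Qᵢ = 0` moves the derivative onto `B`. The blocks outside `T` then add up to
  -- `-∂B Y`, which cancels the separate term `∂B Y`; only `i` in `T` paired with `j` outside `T`
  -- remains.
  have hBdQ : ∀ i ∈ s \ T, B z * ddM (-Complex.I) (Q i) z v =
      -(ddM (-Complex.I) B z v * Q i z) := by
    intro i hi
    have h := ddM_mul hU hB.smoothM (hQ i (Finset.sdiff_subset hi)) (-Complex.I) hz v
    rw [ddM_congr hU (G := fun _ => 0) (fun y hy => hBQ y hy i hi) _ hz, ddM_const] at h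
    exact (neg_eq_of_add_eq_zero_right h.symm).symm
  have hBK : B z * (∑ i ∈ s, e i • (ddM (-Complex.I) (Q i) z v + Q i z * conn H z v)) =
      (∑ i ∈ T, e i • (B z * (ddM (-Complex.I) (Q i) z v + Q i z * conn H z v)))
        - ∑ i ∈ s \ T, e i • (ddM (-Complex.I) B z v * Q i z) := by
    rw [Matrix.mul_sum, ← Finset.sum_sdiff hT, add_comm, sub_eq_add_neg, ← Finset.sum_neg_distrib]
    congr 1
    · exact Finset.sum_congr rfl fun i _ => Matrix.mul_smul _ _ _
    · refine Finset.sum_congr rfl fun i hi => ?_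
      rw [Matrix.mul_smul, Matrix.mul_add, hBdQ i hi, ← Matrix.mul_assoc, hBQ z hz i hi,
        Matrix.zero_mul, add_zero, smul_neg]
  have hYs : ∑ i ∈ s \ T, Q i z * Y = Y := by
    have h : (∑ i ∈ s, Q i z) * Y = Y := by rw [hsum z hz, Matrix.one_mul]
    rw [Matrix.sum_mul, ← Finset.sum_sdiff hT, Finset.sum_eq_zero (s := T) hY, add_zero] at h
    exact h
  have hcancel : (∑ i ∈ s \ T, e i • (ddM (-Complex.I) B z v * Q i z)) *
      (∑ j ∈ s \ T, (e j)⁻¹ • (Q j z * Y)) = ddM (-Complex.I) B z v * Y := by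
    conv_rhs => rw [← hYs, Matrix.mul_sum]
    rw [Matrix.sum_mul]
    refine Finset.sum_congr rfl fun i hi => ?_
    have his := Finset.sdiff_subset hi
    rw [Matrix.mul_sum, Finset.sum_eq_single i]
    · rw [Matrix.smul_mul, Matrix.mul_smul, smul_smul, mul_inv_cancel₀ (he i his), one_smul,
        Matrix.mul_assoc, ← Matrix.mul_assoc (Q i z), hQQ z hz i his i his, if_pos rfl]
    · intro j hj hji
      rw [Matrix.smul_mul, Matrix.mul_smul, Matrix.mul_assoc, ← Matrix.mul_assoc (Q i z),
        hQQ z hz i his j (Finset.sdiff_subset hj), if_neg hji.symm, Matrix.zero_mul,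
        Matrix.mul_zero, smul_zero, smul_zero]
    · exact fun h => absurd hi h
  rw [Matrix.mul_assoc, Matrix.mul_assoc, hKY, ← Matrix.mul_assoc, hBK, Matrix.sub_mul, hcancel,
    add_sub_cancel, Matrix.sum_mul]
  refine Finset.sum_congr rfl fun i _ => ?_
  rw [Matrix.mul_sum]
  refine Finset.sum_congr rfl fun j _ => ?_
  rw [Matrix.smul_mul, Matrix.mul_smul, smul_smul, div_eq_mul_inv]
  simp only [Matrix.mul_assoc]

end Ray

/-! ## Holomorphic frames -/

section Frames

open scoped Matrix

variable {n r : ℕ} {X : Type*} [TopologicalSpace X] [ChartedSpace (Fin n → ℂ) X]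
  {E : X → Type*} [∀ x, AddCommGroup (E x)] [∀ x, Module ℂ (E x)] [∀ x, TopologicalSpace (E x)]
  [TopologicalSpace (Bundle.TotalSpace (Fin r → ℂ) E)] [FiberBundle (Fin r → ℂ) E]

/-- The part of the target of the chart at `p` that lies over `U`. -/
def chartDom (p : X) (U : Set X) : Set (Fin n → ℂ) :=
  (chartAt (Fin n → ℂ) p).target ∩ (chartAt (Fin n → ℂ) p).symm ⁻¹' U

theorem isOpen_chartDom (p : X) {U : Set X} (hU : IsOpen U) :
    IsOpen (chartDom (n := n) p U) :=
  (chartAt (Fin n → ℂ) p).isOpen_inter_preimage_symm hU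

theorem chartDom_mono (p : X) {U V : Set X} (hUV : U ⊆ V) :
    chartDom (n := n) p U ⊆ chartDom p V :=
  fun _ hz => ⟨hz.1, hUV hz.2⟩

theorem exists_right_inverse_of_linearIndependent {k l : ℕ} {D : Fin k → Fin l → ℂ}
    (hD : LinearIndependent ℂ D) : ∃ C : Matrix (Fin l) (Fin k) ℂ, Matrix.of D * C = 1 := by
  obtain ⟨g, hg⟩ := LinearMap.exists_leftInverse_of_injective (Fintype.linearCombination ℂ D)
    (LinearMap.ker_eq_bot.2 hD.fintypeLinearCombination_injective)
  refine ⟨Matrix.of fun b => g (Pi.single b 1), ?_⟩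
  ext a c
  have h1 : g (D a) = Pi.single a 1 := by
    have h := LinearMap.congr_fun hg (Pi.single a 1)
    rwa [LinearMap.comp_apply, Fintype.linearCombination_apply_single, one_smul] at h
  have h2 : D a = ∑ b, D a b • (Pi.single b 1 : Fin l → ℂ) := by
    ext b
    simp [Pi.single_apply]
  rw [h2, map_sum] at h1
  have h3 := congrFun h1 c
  simp only [Finset.sum_apply, map_smul, Pi.smul_apply, smul_eq_mul] at h3
  rw [Matrix.mul_apply, Matrix.one_apply]
  simp only [Matrix.of_apply]
  rw [h3, Pi.single_apply]
  simp only [eq_comm]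

theorem HolFrame.rank_eq {S S' : ∀ x, Submodule ℂ (E x)} {k k' : ℕ} {x₀ x₁ : X}
    (s : HolFrame n r S k x₀) (s' : HolFrame n r S' k' x₁) {y : X} (hy : y ∈ s.dom)
    (hy' : y ∈ s'.dom) (hS : S y = S' y) : k = k' := by
  have h1 := finrank_span_eq_card (s.linearIndependent y hy)
  have h2 := finrank_span_eq_card (s'.linearIndependent y hy')
  rw [s.span_eq y hy] at h1
  rw [s'.span_eq y hy'] at h2
  rw [hS] at h1
  simpa using h1.symm.trans h2

theorem form_sum_sum {B : ∀ x, E x →ₗ[ℂ] E x →ₗ⋆[ℂ] ℂ} {k l : ℕ} {y : X}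
    (c : Fin k → ℂ) (d : Fin l → ℂ) (e : Fin k → E y) (f : Fin l → E y) :
    B y (∑ a, c a • e a) (∑ b, d b • f b) =
      ∑ a, ∑ b, c a * B y (e a) (f b) * (starRingEnd ℂ) (d b) := by
  simp only [map_sum, LinearMap.sum_apply, map_smul, LinearMap.smul_apply, LinearMap.map_smulₛₗ,
    smul_eq_mul, Finset.mul_sum]
  rw [Finset.sum_comm]
  exact Finset.sum_congr rfl fun a _ => Finset.sum_congr rfl fun b _ => by ring

theorem gram_change (h : HermitianMetric n r E) {k k' : ℕ} {s : Fin k → ∀ x, E x}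
    {s' : Fin k' → ∀ x, E x} {p q : X} {z z' : Fin n → ℂ}
    (hzz' : (chartAt (Fin n → ℂ) q).symm z' = (chartAt (Fin n → ℂ) p).symm z)
    {B : Matrix (Fin k) (Fin k') ℂ}
    (hB : ∀ a, s a ((chartAt (Fin n → ℂ) p).symm z) =
      ∑ b, B a b • s' b ((chartAt (Fin n → ℂ) p).symm z)) :
    gram (fun y a b => h.form y a b) s p z =
      B * gram (fun y a b => h.form y a b) s' q z' * Bᴴ := by
  have hg : gram (fun y a b => h.form y a b) s' q z' = gram (fun y a b => h.form y a b) s' p z :=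
    congrArg (fun y => Matrix.of fun a b => h.form y (s' a y) (s' b y)) hzz'
  rw [hg]
  ext a c
  simp only [gram, Matrix.of_apply, Matrix.mul_apply, Matrix.conjTranspose_apply]
  rw [hB a, hB c, form_sum_sum, Finset.sum_comm]
  refine Finset.sum_congr rfl fun b _ => ?_
  rw [Finset.sum_mul]
  rfl

/-- A vector in the left kernel of the Gram matrix gives a combination of the sections of norm zero.
-/
theorem det_gram_ne_zero (h : HermitianMetric n r E) {k : ℕ} {s : Fin k → ∀ x, E x}
    {p : X} {z : Fin n → ℂ}
    (hs : LinearIndependent ℂ fun a => s a ((chartAt (Fin n → ℂ) p).symm z)) :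
    (gram (fun y a b => h.form y a b) s p z).det ≠ 0 := by
  intro h0
  obtain ⟨v, hv, hv0⟩ := Matrix.exists_vecMul_eq_zero_iff.2 h0
  set y := (chartAt (Fin n → ℂ) p).symm z with hy
  have h1 : h.form y (∑ a, v a • s a y) (∑ b, v b • s b y) = 0 := by
    rw [form_sum_sum, Finset.sum_comm]
    refine Finset.sum_eq_zero fun b _ => ?_
    rw [← Finset.sum_mul]
    have := congrFun hv0 b
    simp only [Matrix.vecMul, dotProduct, gram, Matrix.of_apply, Pi.zero_apply] at this
    rw [this, zero_mul]
  have h2 : ∑ a, v a • s a y = 0 := by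
    by_contra hne
    have := h.pos y _ hne
    rw [h1] at this
    simp at this
  exact hv (funext fun a => Fintype.linearIndependent_iff.1 hs v h2 a)

variable [IsManifold 𝓘(ℂ, Fin n → ℂ) ω X]

theorem smoothM_gram (h : HermitianMetric n r E) {k : ℕ} {s : Fin k → ∀ x, E x} {U : Set X}
    (hU : IsOpen U) (hs : ∀ a, IsHolOn n r (s a) U) (p : X) :
    SmoothM (gram (n := n) (fun y a b => h.form y a b) s p) (chartDom p U) := fun a b =>
  contDiffOn_comp_chart_symm (h.smooth U hU _ _ (hs a) (hs b)) p

variable [VectorBundle ℂ (Fin r → ℂ) E] [ContMDiffVectorBundle ω (Fin r → ℂ) E 𝓘(ℂ, Fin n → ℂ)]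

theorem contDiffOn_coords {s : ∀ x, E x} {U : Set X} (hU : IsOpen U) (hs : IsHolOn n r s U)
    (p x₀ : X) (b : Fin r) :
    ContDiffOn ℂ ω (fun z => (trivializationAt (Fin r → ℂ) E x₀).linearMapAt ℂ
      ((chartAt (Fin n → ℂ) p).symm z) (s ((chartAt (Fin n → ℂ) p).symm z)) b)
      (chartDom p (U ∩ (trivializationAt (Fin r → ℂ) E x₀).baseSet)) := by
  set e := trivializationAt (Fin r → ℂ) E x₀
  have h1 : ContMDiffOn 𝓘(ℂ, Fin n → ℂ) 𝓘(ℂ, Fin r → ℂ) ω (fun x => (e ⟨x, s x⟩).2)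
      (U ∩ e.baseSet) :=
    (e.contMDiffOn_section_iff (hU.inter e.open_baseSet) inter_subset_right).1
      (hs.mono inter_subset_left)
  have h2 : ContDiffOn ℂ ω (fun z => (e ⟨(chartAt (Fin n → ℂ) p).symm z,
      s ((chartAt (Fin n → ℂ) p).symm z)⟩).2) (chartDom p (U ∩ e.baseSet)) := by
    rw [← contMDiffOn_iff_contDiffOn]
    exact h1.comp ((contMDiffOn_chart_symm (I := 𝓘(ℂ, Fin n → ℂ)) (n := ω) (x := p)).mono
      inter_subset_left) fun z hz => hz.2
  refine (contDiffOn_pi.1 h2 b).congr fun z hz => ?_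
  exact congrFun (congrFun (e.coe_linearMapAt_of_mem (R := ℂ) hz.2.2) _) b

/-- A frame is expressed holomorphically in a frame of a larger subbundle. -/
theorem HolFrame.exists_transition {S S' : ∀ x, Submodule ℂ (E x)} {k k' : ℕ} {x₀ x₁ : X}
    (s : HolFrame n r S k x₀) (s' : HolFrame n r S' k' x₁) (hS : ∀ y, S y ≤ S' y) (p : X) :
    ∃ B : (Fin n → ℂ) → Matrix (Fin k) (Fin k') ℂ, HolM B (chartDom p (s.dom ∩ s'.dom)) ∧
      ∀ z ∈ chartDom p (s.dom ∩ s'.dom), ∀ a, s.sec a ((chartAt (Fin n → ℂ) p).symm z) =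
        ∑ b, B z a b • s'.sec b ((chartAt (Fin n → ℂ) p).symm z) := by
  have hex : ∀ z : Fin n → ℂ, ∃ B : Matrix (Fin k) (Fin k') ℂ,
      z ∈ chartDom p (s.dom ∩ s'.dom) → ∀ a, s.sec a ((chartAt (Fin n → ℂ) p).symm z) =
        ∑ b, B a b • s'.sec b ((chartAt (Fin n → ℂ) p).symm z) := by
    intro z
    by_cases hz : z ∈ chartDom p (s.dom ∩ s'.dom)
    · have h1 : ∀ a, ∃ c : Fin k' → ℂ, ∑ b, c b • s'.sec b ((chartAt (Fin n → ℂ) p).symm z) =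
          s.sec a ((chartAt (Fin n → ℂ) p).symm z) := fun a => by
        refine (Submodule.mem_span_range_iff_exists_fun ℂ).1 ?_
        rw [s'.span_eq _ hz.2.2]
        refine hS _ ?_
        rw [← s.span_eq _ hz.2.1]
        exact Submodule.subset_span ⟨a, rfl⟩
      choose c hc using h1
      exact ⟨Matrix.of c, fun _ a => (hc a).symm⟩
    · exact ⟨0, fun h => absurd h hz⟩
  choose B hB using hex
  refine ⟨B, fun a b z₀ hz₀ => ?_, hB⟩
  set y₀ := (chartAt (Fin n → ℂ) p).symm z₀ with hy₀
  set e := trivializationAt (Fin r → ℂ) E y₀ with he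
  have hye : y₀ ∈ e.baseSet := FiberBundle.mem_baseSet_trivializationAt' y₀
  let D : (Fin n → ℂ) → Matrix (Fin k) (Fin r) ℂ := fun z => Matrix.of fun a =>
    e.linearMapAt ℂ ((chartAt (Fin n → ℂ) p).symm z) (s.sec a ((chartAt (Fin n → ℂ) p).symm z))
  let D' : (Fin n → ℂ) → Matrix (Fin k') (Fin r) ℂ := fun z => Matrix.of fun a =>
    e.linearMapAt ℂ ((chartAt (Fin n → ℂ) p).symm z) (s'.sec a ((chartAt (Fin n → ℂ) p).symm z))
  have hDD' : ∀ z ∈ chartDom p (s.dom ∩ s'.dom), D z = B z * D' z := by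
    intro z hz
    ext a c
    simp only [D, D', Matrix.of_apply, Matrix.mul_apply]
    rw [hB z hz a, map_sum, Finset.sum_apply]
    exact Finset.sum_congr rfl fun b _ => by rw [map_smul, Pi.smul_apply, smul_eq_mul]
  have hli : LinearIndependent ℂ (D' z₀) :=
    (s'.linearIndependent y₀ hz₀.2.2).map' (e.linearMapAt ℂ y₀) (LinearMap.ker_eq_bot.2 (by
      rw [e.coe_linearMapAt_of_mem hye]
      exact (e.linearEquivAt ℂ y₀ hye).injective))
  -- A constant right inverse at `z₀`. Near `z₀` the square matrix `D' C` stays invertible and `B =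
  -- (D C)(D' C)⁻¹`, an expression that is visibly holomorphic.
  obtain ⟨C, hC⟩ : ∃ C : Matrix (Fin r) (Fin k') ℂ, D' z₀ * C = 1 :=
    exists_right_inverse_of_linearIndependent hli
  have hHD : HolM D (chartDom p (s.dom ∩ e.baseSet)) := fun a c =>
    contDiffOn_coords s.isOpen_dom (s.hol a) p y₀ c
  have hHD' : HolM D' (chartDom p (s'.dom ∩ e.baseSet)) := fun a c =>
    contDiffOn_coords s'.isOpen_dom (s'.hol a) p y₀ c
  set V := chartDom (n := n) p (s.dom ∩ s'.dom ∩ e.baseSet) with hV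
  have hVo : IsOpen V := isOpen_chartDom p ((s.isOpen_dom.inter s'.isOpen_dom).inter e.open_baseSet)
  have hDC : HolM (fun z => D' z * C) V := (hHD'.mono (chartDom_mono p
    fun y hy => ⟨hy.1.2, hy.2⟩)).mul (HolM.const C)
  have hD : HolM (fun z => D z * C) V := (hHD.mono (chartDom_mono p
    fun y hy => ⟨hy.1.1, hy.2⟩)).mul (HolM.const C)
  have hcont : ContinuousOn (fun z => (D' z * C).det) V :=
    (contDiffOn_det (𝕜 := ℂ) (N := ω) hDC).continuousOn
  have hz₀V : z₀ ∈ V := ⟨hz₀.1, hz₀.2, hye⟩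
  set W := V ∩ (fun z => (D' z * C).det) ⁻¹' {0}ᶜ with hW
  have hWo : IsOpen W := hcont.isOpen_inter_preimage hVo isOpen_compl_singleton
  have hz₀W : z₀ ∈ W := ⟨hz₀V, by simp [hC]⟩
  have hres : HolM (fun z => D z * C * (D' z * C)⁻¹) W :=
    (hD.mono inter_subset_left).mul ((hDC.mono inter_subset_left).inv fun z hz => hz.2)
  have hBW : HolM B W := hres.congr fun z hz => by
    rw [hDD' z ⟨hz.1.1, hz.1.2.1⟩, Matrix.mul_assoc (B z), Matrix.mul_assoc (B z),
      Matrix.mul_nonsing_inv _ (isUnit_iff_ne_zero.2 hz.2), Matrix.mul_one]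
  exact ((hBW a b).contDiffAt (hWo.mem_nhds hz₀W)).contDiffWithinAt

/-- Two holomorphic frames of the same subbundle, in charts at `p` and `q`: the transition matrix
and the transition of the charts. -/
theorem HolFrame.curv_change {S : ∀ x, Submodule ℂ (E x)} {k : ℕ} {x₀ x₁ : X}
    (s : HolFrame n r S k x₀) (s' : HolFrame n r S k x₁) (p q : X) :
    ∃ M : (Fin n → ℂ) → Matrix (Fin k) (Fin k) ℂ,
      HolM M (chartDom p (s.dom ∩ s'.dom)) ∧
      (∀ z ∈ chartDom p (s.dom ∩ s'.dom), ∀ a, s.sec a ((chartAt (Fin n → ℂ) p).symm z) =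
        ∑ b, M z a b • s'.sec b ((chartAt (Fin n → ℂ) p).symm z)) ∧
      ∀ (h : HermitianMetric n r E), ∀ z ∈ chartDom p (s.dom ∩ s'.dom ∩ (chartAt (Fin n → ℂ) q).source),
        (M z).det ≠ 0 ∧
        let τ := chartAt (Fin n → ℂ) q ∘ (chartAt (Fin n → ℂ) p).symm
        (∀ u, (conn (gram (fun y a b => h.form y a b) s.sec p) z u).trace =
          (ddM (-Complex.I) M z u * (M z)⁻¹).trace +
          (conn (gram (fun y a b => h.form y a b) s'.sec q) (τ z) (fderiv ℂ τ z u)).trace) ∧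
        ∀ u v, curv (gram (fun y a b => h.form y a b) s.sec p) z u v =
          M z * curv (gram (fun y a b => h.form y a b) s'.sec q) (τ z) (fderiv ℂ τ z u)
            (fderiv ℂ τ z v) * (M z)⁻¹ := by
  -- `M` is fixed before any metric is given, so that two metrics can be compared through the same
  -- `M`.
  obtain ⟨M, hM, hMs⟩ := s.exists_transition s' (fun _ => le_rfl) p
  refine ⟨M, hM, hMs, fun h z hz => ?_⟩
  have hMdet : ∀ z ∈ chartDom p (s.dom ∩ s'.dom), (M z).det ≠ 0 := by
    intro z hz h0
    have h1 := gram_change h (s := s.sec) (s' := s'.sec) (p := p) (q := p) rfl (hMs z hz)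
    refine det_gram_ne_zero h (s := s.sec) (p := p) (s.linearIndependent _ hz.2.1) ?_
    rw [h1, Matrix.det_mul, Matrix.det_mul, h0, zero_mul, zero_mul]
  set U := chartDom (n := n) p (s.dom ∩ s'.dom ∩ (chartAt (Fin n → ℂ) q).source) with hUdef
  have hU : IsOpen U := isOpen_chartDom p ((s.isOpen_dom.inter s'.isOpen_dom).inter
    (chartAt (Fin n → ℂ) q).open_source)
  have hUle : U ⊆ chartDom p (s.dom ∩ s'.dom) := chartDom_mono p inter_subset_left
  set V := chartDom (n := n) q s'.dom with hVdef
  have hV : IsOpen V := isOpen_chartDom q s'.isOpen_dom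
  have hinv : ∀ z ∈ U, (chartAt (Fin n → ℂ) q).symm
      ((chartAt (Fin n → ℂ) q ∘ (chartAt (Fin n → ℂ) p).symm) z) =
        (chartAt (Fin n → ℂ) p).symm z := fun z hz => (chartAt (Fin n → ℂ) q).left_inv hz.2.2
  have hmaps : MapsTo (chartAt (Fin n → ℂ) q ∘ (chartAt (Fin n → ℂ) p).symm) U V := fun z hz =>
    ⟨(chartAt (Fin n → ℂ) q).map_source hz.2.2, by
      rw [mem_preimage, hinv z hz]; exact hz.2.1.2⟩
  have hτ : ContDiffOn ℂ ω (chartAt (Fin n → ℂ) q ∘ (chartAt (Fin n → ℂ) p).symm) U :=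
    fun z hz => (contDiffAt_transition p q hz.1 hz.2.2).contDiffWithinAt
  have hH := smoothM_gram h s'.isOpen_dom s'.hol q
  have hdet : ∀ z ∈ V, (gram (fun y a b => h.form y a b) s'.sec q z).det ≠ 0 := fun z hz =>
    det_gram_ne_zero h (s'.linearIndependent _ hz.2)
  have hHH : ∀ z ∈ U, gram (fun y a b => h.form y a b) s.sec p z =
      M z * gram (fun y a b => h.form y a b) s'.sec q
        ((chartAt (Fin n → ℂ) q ∘ (chartAt (Fin n → ℂ) p).symm) z) * (M z)ᴴ := fun z hz =>
    gram_change h (hinv z hz) (hMs z (hUle hz))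
  exact ⟨hMdet z (hUle hz), fun u => trace_conn_change hU hV hH (hM.mono hUle) (fun z hz => hMdet z (hUle hz)) hτ
    hmaps hHH hz (hdet _ (hmaps hz)) u, fun u v => DonaldsonRay.curv_change hU hV hH hdet
    (hM.mono hUle) (fun z hz => hMdet z (hUle hz)) hτ hmaps hHH hz u v⟩

end Frames

/-! ## Linearity of the integral of `α ∧ ωⁿ⁻¹` -/

section Linearity

variable {n : ℕ} {X : Type*} [TopologicalSpace X] [ChartedSpace (Fin n → ℂ) X]

theorem TwoForm.IsCont.const_mul {α : TwoForm n X} (hα : α.IsCont) (c : ℂ) :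
    TwoForm.IsCont (fun x u v => c * α x u v : TwoForm n X) :=
  fun p u v => continuousOn_const.mul (hα p u v)

theorem TwoForm.IsCont.sub {α β : TwoForm n X} (hα : α.IsCont) (hβ : β.IsCont) :
    TwoForm.IsCont (fun x u v => α x u v - β x u v : TwoForm n X) :=
  fun p u v => (hα p u v).sub (hβ p u v)

variable [IsManifold 𝓘(ℂ, Fin n → ℂ) ω X] [CompactSpace X] [T2Space X]

theorem KahlerMetric.integral_wedgePow_sum (hn : 1 ≤ n) (g : KahlerMetric n X) {ι : Type*}
    (s : Finset ι) (c : ι → ℂ) {α : ι → TwoForm n X} (hα : ∀ i ∈ s, (α i).IsCont) :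
    (g.wedgePow (fun x u v => ∑ i ∈ s, c i * α i x u v)).integral =
      ∑ i ∈ s, c i * (g.wedgePow (α i)).integral := by
  rw [g.wedgePow_sum hn s (fun i x u v => c i * α i x u v), TopForm.integral_sum]
  · refine Finset.sum_congr rfl fun i _ => ?_
    rw [g.wedgePow_const_mul hn, TopForm.integral_const_mul]
  · exact fun i hi => g.wedgePow_isCont ((hα i hi).const_mul _)

theorem KahlerMetric.integral_wedgePow_sub (hn : 1 ≤ n) (g : KahlerMetric n X)
    {α β : TwoForm n X} (hα : α.IsCont) (hβ : β.IsCont) :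
    (g.wedgePow (fun x u v => α x u v - β x u v)).integral =
      (g.wedgePow α).integral - (g.wedgePow β).integral := by
  have h := g.integral_wedgePow_sum hn Finset.univ ![1, -1] (α := ![α, β]) fun i _ => by
    fin_cases i
    · exact hα
    · exact hβ
  simpa [Fin.sum_univ_two, ← sub_eq_add_neg] using h

end Linearity

/-! ## The trace of the curvature, degrees -/

section Degree

open scoped Matrix

variable {n r : ℕ} {X : Type*} [TopologicalSpace X] [ChartedSpace (Fin n → ℂ) X]
  {E : X → Type*} [∀ x, AddCommGroup (E x)] [∀ x, Module ℂ (E x)] [∀ x, TopologicalSpace (E x)]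
  [TopologicalSpace (Bundle.TotalSpace (Fin r → ℂ) E)] [FiberBundle (Fin r → ℂ) E]

theorem connForm_eq {k : ℕ} (h : ∀ x, E x → E x → ℂ) (s : Fin k → ∀ x, E x) (x : X)
    (z u : Fin n → ℂ) : connForm h s x z u = conn (gram h s x) z u := by
  unfold connForm conn
  congr 1
  ext a b
  exact del_eq_dd _ z u

theorem curvMatrix_eq {k : ℕ} (h : ∀ x, E x → E x → ℂ) (s : Fin k → ∀ x, E x) (x : X)
    (u v : Fin n → ℂ) :
    curvMatrix h s x u v = curv (gram h s x) (chartAt (Fin n → ℂ) x x) u v := by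
  ext a b
  simp only [curvMatrix, connForm_eq]
  rfl

variable [IsManifold 𝓘(ℂ, Fin n → ℂ) ω X]
  [VectorBundle ℂ (Fin r → ℂ) E] [ContMDiffVectorBundle ω (Fin r → ℂ) E 𝓘(ℂ, Fin n → ℂ)]

/-- The trace of the connection form of `h` on `S` in the frame `S.frame x` at `x`. -/
def traceConn (h : HermitianMetric n r E) (S : HolSubbundle n r E) (x : X) (u : Fin n → ℂ) : ℂ :=
  (conn (gram (fun y a b => h.form y a b) (S.frame x).sec x) (chartAt (Fin n → ℂ) x x) u).trace

theorem mem_chartDom_inter {p : X} {U V : Set X} {z : Fin n → ℂ} (hz : z ∈ chartDom p U)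
    (hV : (chartAt (Fin n → ℂ) p).symm z ∈ V) :
    z ∈ chartDom p (U ∩ V ∩
      (chartAt (Fin n → ℂ) ((chartAt (Fin n → ℂ) p).symm z)).source) :=
  ⟨hz.1, ⟨hz.2, hV⟩, mem_chart_source _ _⟩

theorem fderiv_transition_eq_coordVec {p : X} {z : Fin n → ℂ}
    (hz : z ∈ (chartAt (Fin n → ℂ) p).target) (u : Fin n → ℂ) :
    fderiv ℂ (chartAt (Fin n → ℂ) ((chartAt (Fin n → ℂ) p).symm z) ∘ (chartAt (Fin n → ℂ) p).symm)
      z u = coordVec p ((chartAt (Fin n → ℂ) p).symm z) u := by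
  unfold coordVec
  rw [(chartAt (Fin n → ℂ) p).right_inv hz]

/-- `traceCurv` uses a chart and a frame chosen separately at each point. The curvature matrix
changes by conjugation, so its trace can be computed in one frame on a whole neighbourhood. -/
theorem traceCurv_pull (h : HermitianMetric n r E) (S : HolSubbundle n r E) {k : ℕ} {x₀ : X}
    (s : HolFrame n r S.fiber k x₀) (p : X) {z : Fin n → ℂ} (hz : z ∈ chartDom p s.dom)
    (u v : Fin n → ℂ) :
    (traceCurv h S).pull p z u v =
      (curv (gram (fun y a b => h.form y a b) s.sec p) z u v).trace := by
  set x := (chartAt (Fin n → ℂ) p).symm z with hx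
  have hk : k = S.rank := s.rank_eq (S.frame x) hz.2 (S.frame x).mem_dom rfl
  subst hk
  obtain ⟨M, -, -, hM⟩ := s.curv_change (S.frame x) p x
  obtain ⟨hdet, -, hc⟩ := hM h z (mem_chartDom_inter hz (S.frame x).mem_dom)
  rw [hc, Matrix.trace_mul_comm, Matrix.nonsing_inv_mul_cancel_left _ _ hdet.isUnit,
    fderiv_transition_eq_coordVec hz.1, fderiv_transition_eq_coordVec hz.1]
  exact congrArg Matrix.trace (curvMatrix_eq _ _ _ _ _)

theorem exists_bilin_traceCurv (h : HermitianMetric n r E) (S : HolSubbundle n r E) :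
    (traceCurv h S).IsBilin := by
  intro x
  obtain ⟨b, hb⟩ := exists_bilin_curv (isOpen_chartDom x (S.frame x).isOpen_dom)
    (smoothM_gram h (S.frame x).isOpen_dom (S.frame x).hol x)
    (fun z hz => det_gram_ne_zero h ((S.frame x).linearIndependent _ hz.2))
    (z := chartAt (Fin n → ℂ) x x) ⟨mem_chart_target _ x, by
      rw [mem_preimage, (chartAt (Fin n → ℂ) x).left_inv (mem_chart_source _ x)]
      exact (S.frame x).mem_dom⟩ (Matrix.traceLinearMap (Fin S.rank) ℂ ℂ)
  exact ⟨b, fun u v => (congrArg Matrix.trace (curvMatrix_eq _ _ _ _ _)).trans (hb u v)⟩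

theorem traceCurv_isCont (h : HermitianMetric n r E) (S : HolSubbundle n r E) :
    (traceCurv h S).IsCont := by
  intro p u v z hz
  set x := (chartAt (Fin n → ℂ) p).symm z with hx
  have hU := isOpen_chartDom (n := n) p (S.frame x).isOpen_dom
  have hzU : z ∈ chartDom p (S.frame x).dom := ⟨hz, (S.frame x).mem_dom⟩
  have hs := smoothM_curv hU (smoothM_gram h (S.frame x).isOpen_dom (S.frame x).hol p)
    (fun z hz => det_gram_ne_zero h ((S.frame x).linearIndependent _ hz.2)) u v
  have hc : ContinuousOn (fun z => (curv (gram (fun y a b => h.form y a b) (S.frame x).sec p)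
      z u v).trace) (chartDom p (S.frame x).dom) :=
    continuousOn_finsetSum _ fun a _ => (hs a a).continuousOn
  refine ContinuousAt.continuousWithinAt
    (((hc.continuousAt (hU.mem_nhds hzU))).congr ?_)
  filter_upwards [hU.mem_nhds hzU] with y hy
  exact (traceCurv_pull h S (S.frame x) p hy u v).symm

/-- The trace of a single connection matrix depends on the frame, but the gauge term is the same for
both metrics, so the difference is a global one-form. -/
theorem pullOne_traceConn_sub (h h' : HermitianMetric n r E) (S : HolSubbundle n r E) {k : ℕ}
    {x₀ : X} (s : HolFrame n r S.fiber k x₀) (p : X) {z : Fin n → ℂ} (hz : z ∈ chartDom p s.dom)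
    (u : Fin n → ℂ) :
    pullOne (fun x u => traceConn h S x u - traceConn h' S x u) p z u =
      (conn (gram (fun y a b => h.form y a b) s.sec p) z u).trace -
        (conn (gram (fun y a b => h'.form y a b) s.sec p) z u).trace := by
  set x := (chartAt (Fin n → ℂ) p).symm z with hx
  have hk : k = S.rank := s.rank_eq (S.frame x) hz.2 (S.frame x).mem_dom rfl
  subst hk
  obtain ⟨M, -, -, hM⟩ := s.curv_change (S.frame x) p x
  obtain ⟨-, hc, -⟩ := hM h z (mem_chartDom_inter hz (S.frame x).mem_dom)
  obtain ⟨-, hc', -⟩ := hM h' z (mem_chartDom_inter hz (S.frame x).mem_dom)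
  rw [hc, hc', add_sub_add_left_eq_sub, fderiv_transition_eq_coordVec hz.1]
  rfl

variable [CompactSpace X] [T2Space X]

/-- The integral of the trace of the curvature does not depend on the metric. -/
theorem integral_traceCurv_eq (hn : 1 ≤ n) (g : KahlerMetric n X) (h h' : HermitianMetric n r E)
    (S : HolSubbundle n r E) :
    (g.wedgePow (traceCurv h S)).integral = (g.wedgePow (traceCurv h' S)).integral := by
  -- By `trace_curv_eq` the exterior derivative of `β` is the difference of the two traces of
  -- curvature, so Stokes' theorem applies.
  set β : X → (Fin n → ℂ) → ℂ :=
    fun x u => Complex.I * (traceConn h S x u - traceConn h' S x u) with hβdef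
  have hpull : ∀ (p x₀ : X) (s : HolFrame n r S.fiber S.rank x₀), ∀ z ∈ chartDom p s.dom, ∀ u,
      pullOne β p z u =
        Complex.I * ((conn (gram (fun y a b => h.form y a b) s.sec p) z u).trace -
        (conn (gram (fun y a b => h'.form y a b) s.sec p) z u).trace) := fun p x₀ s z hz u => by
    rw [← pullOne_traceConn_sub h h' S s p hz u]
    rfl
  have hsm : ∀ (h : HermitianMetric n r E) (p x₀ : X) (s : HolFrame n r S.fiber S.rank x₀) u,
      ContDiffOn ℝ ∞ (fun z => (conn (gram (fun y a b => h.form y a b) s.sec p) z u).trace)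
        (chartDom p s.dom) := fun h p x₀ s u => by
    have := smoothM_conn (isOpen_chartDom p s.isOpen_dom) (smoothM_gram h s.isOpen_dom s.hol p)
      (fun z hz => det_gram_ne_zero h (s.linearIndependent _ hz.2)) u
    exact ContDiffOn.sum fun a _ => this a a
  have key : (g.wedgePow (fun x u v => traceCurv h S x u v - traceCurv h' S x u v)).integral
      = 0 := by
    refine g.integral_exact hn (β := β) ?_ ?_ ?_ ?_
    · intro x
      obtain ⟨b, hb⟩ := exists_bilin_traceCurv h S x
      obtain ⟨b', hb'⟩ := exists_bilin_traceCurv h' S x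
      exact ⟨b - b', fun u v => by simp [hb, hb']⟩
    · intro x
      have hL : ∀ h : HermitianMetric n r E, ∃ L : (Fin n → ℂ) →ₗ[ℝ] ℂ, ∀ u,
          traceConn h S x u = L u := fun h =>
        ⟨{ toFun := traceConn h S x
           map_add' := fun u v => by simp [traceConn, conn_add]
           map_smul' := fun c u => (congrArg Matrix.trace (conn_smul
            (gram (fun y a b => h.form y a b) (S.frame x).sec x)
              (chartAt (Fin n → ℂ) x x) u (c : ℂ))).trans (Matrix.trace_smul _ _) }, fun _ => rfl⟩
      obtain ⟨L, hL1⟩ := hL h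
      obtain ⟨L', hL2⟩ := hL h'
      exact ⟨Complex.I • (L - L'), fun u => by simp [hβdef, hL1, hL2]⟩
    · intro p u z hz
      set x := (chartAt (Fin n → ℂ) p).symm z with hx
      have hU := isOpen_chartDom (n := n) p (S.frame x).isOpen_dom
      have hzU : z ∈ chartDom p (S.frame x).dom := ⟨hz, (S.frame x).mem_dom⟩
      have hc : ContDiffOn ℝ ∞ (fun z => pullOne β p z u) (chartDom p (S.frame x).dom) :=
        (contDiffOn_const.mul ((hsm h p x (S.frame x) u).sub (hsm h' p x (S.frame x) u))).congr
          fun y hy => hpull p x (S.frame x) y hy u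
      exact (hc.contDiffAt (hU.mem_nhds hzU)).contDiffWithinAt
    · intro p z hz u v
      set x := (chartAt (Fin n → ℂ) p).symm z with hx
      have hU := isOpen_chartDom (n := n) p (S.frame x).isOpen_dom
      have hzU : z ∈ chartDom p (S.frame x).dom := ⟨hz, (S.frame x).mem_dom⟩
      have hd : ∀ (h : HermitianMetric n r E) u, DifferentiableAt ℝ (fun z =>
          (conn (gram (fun y a b => h.form y a b) (S.frame x).sec p) z u).trace) z := fun h u =>
        ((hsm h p x (S.frame x) u).contDiffAt (hU.mem_nhds hzU)).differentiableAt (by simp)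
      have hf : ∀ u v, fderiv ℝ (fun z => pullOne β p z v) z u = Complex.I *
          (fderiv ℝ (fun z => (conn (gram (fun y a b => h.form y a b) (S.frame x).sec p)
            z v).trace) z u - fderiv ℝ (fun z => (conn (gram (fun y a b => h'.form y a b)
              (S.frame x).sec p) z v).trace) z u) := by
        intro u v
        have he : (fun z => pullOne β p z v) =ᶠ[𝓝 z] fun z => Complex.I *
            ((conn (gram (fun y a b => h.form y a b) (S.frame x).sec p) z v).trace -
            (conn (gram (fun y a b => h'.form y a b) (S.frame x).sec p) z v).trace) := by
          filter_upwards [hU.mem_nhds hzU] with y hy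
          exact hpull p x (S.frame x) y hy v
        rw [he.fderiv_eq, fderiv_const_mul ((hd h v).fun_sub (hd h' v)), fderiv_fun_sub (hd h v)
          (hd h' v)]
        rfl
      rw [hf, hf]
      change (traceCurv h S).pull p z u v - (traceCurv h' S).pull p z u v = _
      rw [traceCurv_pull h S (S.frame x) p hzU, traceCurv_pull h' S (S.frame x) p hzU,
        trace_curv_eq hU (smoothM_gram h (S.frame x).isOpen_dom (S.frame x).hol p)
          (fun z hz => det_gram_ne_zero h ((S.frame x).linearIndependent _ hz.2)) hzU,
        trace_curv_eq hU (smoothM_gram h' (S.frame x).isOpen_dom (S.frame x).hol p)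
          (fun z hz => det_gram_ne_zero h' ((S.frame x).linearIndependent _ hz.2)) hzU]
      ring
  rw [g.integral_wedgePow_sub hn (traceCurv_isCont h S) (traceCurv_isCont h' S)] at key
  exact sub_eq_zero.1 key

/-- `degree` is computed with one arbitrary metric; here every metric is allowed, in particular each
metric of the ray. -/
theorem integral_traceCurv (hn : 1 ≤ n) (g : KahlerMetric n X) (h : HermitianMetric n r E)
    (S : HolSubbundle n r E) :
    (g.wedgePow (traceCurv h S)).integral.re = 2 * Real.pi * degree g S := by
  have hne : Nonempty (HermitianMetric n r E) := ⟨h⟩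
  have h1 : g.wedgePow (chernForm hne.some S) =
      fun x v => (1 / (2 * Real.pi) : ℂ) * g.wedgePow (traceCurv hne.some S) x v :=
    g.wedgePow_const_mul hn _ _
  have h2 : (1 / (2 * Real.pi) : ℂ) = ((1 / (2 * Real.pi) : ℝ) : ℂ) := by push_cast; rfl
  rw [degree, dif_pos hne, h1, TopForm.integral_const_mul, h2, Complex.re_ofReal_mul,
    integral_traceCurv_eq hn g h hne.some S]
  field_simp

end Degree

/-! ## Orthogonal projections -/

section Projections

variable {n r : ℕ} {X : Type*} [TopologicalSpace X] [ChartedSpace (Fin n → ℂ) X]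
  {E : X → Type*} [∀ x, AddCommGroup (E x)] [∀ x, Module ℂ (E x)] [∀ x, TopologicalSpace (E x)]
  [TopologicalSpace (Bundle.TotalSpace (Fin r → ℂ) E)] [FiberBundle (Fin r → ℂ) E]
  (h : HermitianMetric n r E)

theorem orthProj_mem (S : HolSubbundle n r E) (x : X) (v : E x) :
    orthProj h S x v ∈ S.fiber x := by
  have := S.finiteDimensional x
  unfold orthProj
  rw [Submodule.projection_apply]
  exact Submodule.coe_mem _

theorem form_sub_orthProj (S : HolSubbundle n r E) (x : X) (v : E x) {t : E x}
    (ht : t ∈ S.fiber x) : h.form x (v - orthProj h S x v) t = 0 := by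
  have := S.finiteDimensional x
  have hc := isCompl_orth (h.form x) (h.pos x) (S.fiber x)
  have h1 : v - orthProj h S x v ∈ orth (h.form x) (S.fiber x) := by
    rw [← Submodule.projectionOnto_apply_eq_zero_iff hc, map_sub, sub_eq_zero]
    unfold orthProj
    rw [Submodule.projection_apply]
    exact (Submodule.projectionOnto_apply_left hc _).symm
  exact h1 t ht

theorem form_orthProj (S : HolSubbundle n r E) (x : X) (v : E x) {t : E x}
    (ht : t ∈ S.fiber x) : h.form x (orthProj h S x v) t = h.form x v t := by
  have := form_sub_orthProj h S x v ht
  rw [map_sub, LinearMap.sub_apply, sub_eq_zero] at this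
  exact this.symm

theorem form_eq_zero_iff (x : X) (v : E x) : h.form x v v = 0 ↔ v = 0 := by
  refine ⟨fun h0 => ?_, fun h0 => by simp [h0]⟩
  by_contra hne
  have := h.pos x v hne
  rw [h0] at this
  simp at this

/-- The difference of the two vectors lies in the fibre of `S` and is orthogonal to it. -/
theorem orthProj_eq (S : HolSubbundle n r E) (x : X) {v v' : E x} (hv' : v' ∈ S.fiber x)
    (hv : ∀ t ∈ S.fiber x, h.form x v' t = h.form x v t) : orthProj h S x v = v' := by
  rw [← sub_eq_zero, ← form_eq_zero_iff h]
  have hm : orthProj h S x v - v' ∈ S.fiber x := Submodule.sub_mem _ (orthProj_mem h S x v) hv'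
  have key : ∀ t ∈ S.fiber x, h.form x (orthProj h S x v - v') t = 0 := fun t ht => by
    rw [map_sub, LinearMap.sub_apply, form_orthProj h S x v ht, hv t ht, sub_self]
  exact key _ hm

theorem orthProj_of_mem (S : HolSubbundle n r E) (x : X) {v : E x} (hv : v ∈ S.fiber x) :
    orthProj h S x v = v := orthProj_eq h S x hv fun _ _ => rfl

theorem form_orthProj_comm (S : HolSubbundle n r E) (x : X) (u v : E x) :
    h.form x (orthProj h S x u) v = h.form x u (orthProj h S x v) := by
  rw [← form_orthProj h S x u (orthProj_mem h S x v), ← h.conj_symm x v,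
    ← form_orthProj h S x v (orthProj_mem h S x u), h.conj_symm]

variable {m : ℕ} (F : SubbundleFiltration n r E m)

/-- The filtration decreases, so the smaller of the two subbundles is the one with the larger index.
-/
theorem orthProj_mul {i j : ℕ} (hi : 1 ≤ i) (hj : 1 ≤ j) (him : i ≤ m + 1) (hjm : j ≤ m + 1)
    (x : X) : orthProj h (F.sub i) x * orthProj h (F.sub j) x =
      orthProj h (F.sub (max i j)) x := by
  ext v
  rw [Module.End.mul_apply]
  rcases le_total i j with hij | hij
  · rw [max_eq_right hij]
    exact orthProj_of_mem h _ x (F.fiber_le hi hij hjm x (orthProj_mem h _ x v))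
  · rw [max_eq_left hij]
    refine orthProj_eq h _ x (orthProj_mem h _ x v) fun t ht => ?_
    rw [form_orthProj h _ x v ht, form_orthProj h _ x v (F.fiber_le hj hij him x ht)]

/-- The projection onto the `i`-th graded piece of the filtration. -/
def gradedProj (i : ℕ) (x : X) : Module.End ℂ (E x) :=
  orthProj h (F.sub i) x - orthProj h (F.sub (i + 1)) x

theorem gradedProj_mul {i j : ℕ} (hi : i ∈ Finset.Icc 1 m) (hj : j ∈ Finset.Icc 1 m) (x : X) :
    gradedProj h F i x * gradedProj h F j x = if i = j then gradedProj h F i x else 0 := by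
  rw [Finset.mem_Icc] at hi hj
  unfold gradedProj
  rw [mul_sub, sub_mul, sub_mul, orthProj_mul h F hi.1 hj.1 (by omega) (by omega),
    orthProj_mul h F (by omega) hj.1 (by omega) (by omega),
    orthProj_mul h F hi.1 (by omega) (by omega) (by omega),
    orthProj_mul h F (by omega) (by omega) (by omega) (by omega)]
  rcases lt_trichotomy i j with hij | hij | hij
  · rw [if_neg hij.ne, max_eq_right hij.le, max_eq_right (by omega : i + 1 ≤ j),
      max_eq_right (by omega : i ≤ j + 1), max_eq_right (by omega : i + 1 ≤ j + 1)]
    abel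
  · subst hij
    rw [if_pos rfl, max_self, max_self, max_eq_left (by omega : i ≤ i + 1),
      max_eq_right (by omega : i ≤ i + 1)]
    abel
  · rw [if_neg hij.ne', max_eq_left hij.le, max_eq_left (by omega : j ≤ i + 1),
      max_eq_left (by omega : j + 1 ≤ i), max_eq_left (by omega : j + 1 ≤ i + 1)]
    abel

theorem sum_Icc_sub_succ {M : Type*} [AddCommGroup M] (f : ℕ → M) {k m : ℕ} (hk : k ≤ m + 1) :
    ∑ i ∈ Finset.Icc k m, (f i - f (i + 1)) = f k - f (m + 1) := by
  induction m with
  | zero =>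
    interval_cases k <;> simp
  | succ m ih =>
    rcases Nat.lt_or_ge (m + 1) k with hlt | hge
    · have : k = m + 1 + 1 := by omega
      subst this
      simp
    · rw [Finset.sum_Icc_succ_top hge, ih hge]
      abel

theorem orthProj_one (x : X) : orthProj h (F.sub 1) x = 1 := by
  ext v
  exact orthProj_of_mem h _ x (by rw [F.first]; trivial)

theorem orthProj_last (x : X) : orthProj h (F.sub (m + 1)) x = 0 := by
  ext v
  have := orthProj_mem h (F.sub (m + 1)) x v
  rw [F.last] at this
  exact this

theorem sum_gradedProj_Icc {k : ℕ} (hk : k ≤ m + 1) (x : X) :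
    ∑ i ∈ Finset.Icc k m, gradedProj h F i x = orthProj h (F.sub k) x := by
  unfold gradedProj
  rw [sum_Icc_sub_succ (fun i => orthProj h (F.sub i) x) hk, orthProj_last, sub_zero]

theorem sum_gradedProj (x : X) : ∑ i ∈ Finset.Icc 1 m, gradedProj h F i x = 1 := by
  rw [sum_gradedProj_Icc h F (by omega), orthProj_one]

theorem form_gradedProj_comm (i : ℕ) (x : X) (u v : E x) :
    h.form x (gradedProj h F i x u) v = h.form x u (gradedProj h F i x v) := by
  simp only [gradedProj, LinearMap.sub_apply, map_sub]
  rw [form_orthProj_comm, form_orthProj_comm]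

theorem form_gradedProj_self {i : ℕ} (hi : i ∈ Finset.Icc 1 m) (x : X) (u v : E x) :
    h.form x (gradedProj h F i x u) v =
      h.form x (gradedProj h F i x u) (gradedProj h F i x v) := by
  rw [← form_gradedProj_comm, ← Module.End.mul_apply, gradedProj_mul h F hi hi, if_pos rfl]

/-- The form `∑ eᵢ h(Qᵢ u, v)`. -/
def rayForm (e : ℕ → ℝ) (x : X) : E x →ₗ[ℂ] E x →ₗ⋆[ℂ] ℂ :=
  ∑ i ∈ Finset.Icc 1 m, (e i : ℂ) • (h.form x).comp (gradedProj h F i x)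

theorem rayForm_apply (e : ℕ → ℝ) (x : X) (u v : E x) :
    rayForm h F e x u v =
      ∑ i ∈ Finset.Icc 1 m, (e i : ℂ) * h.form x (gradedProj h F i x u) v := by
  simp [rayForm, LinearMap.sum_apply]

variable [IsManifold 𝓘(ℂ, Fin n → ℂ) ω X]

theorem contMDiffAt_of_chart {f : X → ℂ} {y : X}
    (hf : ContDiffAt ℝ ∞ (f ∘ (chartAt (Fin n → ℂ) y).symm) (chartAt (Fin n → ℂ) y y)) :
    ContMDiffAt 𝓘(ℝ, Fin n → ℂ) 𝓘(ℝ, ℂ) ∞ f y := by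
  have h1 : ContMDiffAt 𝓘(ℝ, Fin n → ℂ) 𝓘(ℝ, ℂ) ∞
      ((f ∘ (chartAt (Fin n → ℂ) y).symm) ∘ chartAt (Fin n → ℂ) y) y :=
    (contMDiffAt_iff_contDiffAt.2 hf).comp y
      ((contMDiffOn_chart (I := 𝓘(ℝ, Fin n → ℂ)) (n := ∞) (x := y)).contMDiffAt
        ((chartAt (Fin n → ℂ) y).open_source.mem_nhds (mem_chart_source _ y)))
  refine h1.congr_of_eventuallyEq ?_
  filter_upwards [(chartAt (Fin n → ℂ) y).open_source.mem_nhds (mem_chart_source _ y)] with x hx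
  simp [(chartAt (Fin n → ℂ) y).left_inv hx]

/-- With the Gram matrix `G` of a local frame of `S` the function is `a G⁻¹ b`, where `a` and `b`
collect the products of the frame with `s` and `t`. -/
theorem contMDiffOn_form_orthProj (S : HolSubbundle n r E) {U : Set X} (hU : IsOpen U)
    {s t : ∀ x, E x} (hs : IsHolOn n r s U) (ht : IsHolOn n r t U) :
    ContMDiffOn 𝓘(ℝ, Fin n → ℂ) 𝓘(ℝ, ℂ) ∞
      (fun x => h.form x (orthProj h S x (s x)) (t x)) U := by
  intro y hy
  refine (contMDiffAt_of_chart ?_).contMDiffWithinAt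
  set e := S.frame y
  have hV : IsOpen (U ∩ e.dom) := hU.inter e.isOpen_dom
  let D := chartDom (n := n) y (U ∩ e.dom)
  have hD : IsOpen D := isOpen_chartDom y hV
  have hyD : chartAt (Fin n → ℂ) y y ∈ D := ⟨mem_chart_target _ y, by
    rw [mem_preimage, (chartAt (Fin n → ℂ) y).left_inv (mem_chart_source _ y)]
    exact ⟨hy, e.mem_dom⟩⟩
  let a : (Fin n → ℂ) → Matrix (Fin 1) (Fin S.rank) ℂ := fun z => Matrix.of fun _ i =>
    h.form ((chartAt (Fin n → ℂ) y).symm z) (s ((chartAt (Fin n → ℂ) y).symm z))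
      (e.sec i ((chartAt (Fin n → ℂ) y).symm z))
  let b : (Fin n → ℂ) → Matrix (Fin S.rank) (Fin 1) ℂ := fun z => Matrix.of fun i _ =>
    h.form ((chartAt (Fin n → ℂ) y).symm z) (e.sec i ((chartAt (Fin n → ℂ) y).symm z))
      (t ((chartAt (Fin n → ℂ) y).symm z))
  let G := gram (n := n) (fun y a b => h.form y a b) e.sec y
  have he : ∀ i, IsHolOn n r (e.sec i) (U ∩ e.dom) := fun i => (e.hol i).mono inter_subset_right
  have ha : SmoothM a D := fun _ i => contDiffOn_comp_chart_symm
    (h.smooth _ hV _ _ (hs.mono inter_subset_left) (he i)) y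
  have hb : SmoothM b D := fun i _ => contDiffOn_comp_chart_symm
    (h.smooth _ hV _ _ (he i) (ht.mono inter_subset_left)) y
  have hG : SmoothM G D := smoothM_gram h hV he y
  have hdet : ∀ z ∈ D, (G z).det ≠ 0 := fun z hz =>
    det_gram_ne_zero h (e.linearIndependent _ hz.2.2)
  have hsm := (((ha.mul (hG.inv hdet)).mul hb) 0 0).contDiffAt (hD.mem_nhds hyD)
  refine hsm.congr_of_eventuallyEq ?_
  filter_upwards [hD.mem_nhds hyD] with z hz
  set x := (chartAt (Fin n → ℂ) y).symm z with hx
  have hP : orthProj h S x (s x) = ∑ i, (a z * (G z)⁻¹) 0 i • e.sec i x := by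
    refine orthProj_eq h S x ?_ fun t ht => ?_
    · refine Submodule.sum_mem _ fun i _ => Submodule.smul_mem _ _ ?_
      rw [← e.span_eq x hz.2.2]
      exact Submodule.subset_span ⟨i, rfl⟩
    · rw [← e.span_eq x hz.2.2] at ht
      obtain ⟨c, rfl⟩ := (Submodule.mem_span_range_iff_exists_fun ℂ).1 ht
      rw [map_sum (h.form x (∑ i, (a z * (G z)⁻¹) 0 i • e.sec i x)), map_sum (h.form x (s x))]
      refine Finset.sum_congr rfl fun j _ => ?_
      rw [LinearMap.map_smulₛₗ, LinearMap.map_smulₛₗ]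
      congr 1
      have h1 : a z * (G z)⁻¹ * G z = a z :=
        Matrix.nonsing_inv_mul_cancel_right _ _ (hdet z hz).isUnit
      have h2 := congrFun (congrFun h1 0) j
      rw [Matrix.mul_apply] at h2
      rw [map_sum (h.form x), LinearMap.sum_apply]
      simp only [map_smul, LinearMap.smul_apply, smul_eq_mul]
      exact h2
  change h.form x (orthProj h S x (s x)) (t x) = _
  rw [hP, map_sum (h.form x), LinearMap.sum_apply, Matrix.mul_apply]
  simp only [map_smul, LinearMap.smul_apply, smul_eq_mul]
  rfl

/-- The metric `∑ eᵢ h(Qᵢ u, v)`. -/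
def rayMetric (e : ℕ → ℝ) (he : ∀ i, 0 < e i) : HermitianMetric n r E where
  form := rayForm h F e
  conj_symm := by
    intro x u v
    rw [rayForm_apply, rayForm_apply, map_sum]
    refine Finset.sum_congr rfl fun i _ => ?_
    rw [map_mul, Complex.conj_ofReal, h.conj_symm, ← form_gradedProj_comm]
  pos := by
    intro x v hv
    have hQ : ∃ i ∈ Finset.Icc 1 m, gradedProj h F i x v ≠ 0 := by
      by_contra! h0
      refine hv ?_
      have := LinearMap.congr_fun (sum_gradedProj h F x) v
      rw [LinearMap.sum_apply, Finset.sum_eq_zero h0] at this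
      exact this.symm
    obtain ⟨i, hi, hne⟩ := hQ
    rw [rayForm_apply, Complex.re_sum]
    refine Finset.sum_pos' (fun j hj => ?_) ⟨i, hi, ?_⟩
    · rw [Complex.re_ofReal_mul, form_gradedProj_self h F hj]
      refine mul_nonneg (he j).le ?_
      by_cases h0 : gradedProj h F j x v = 0
      · simp [h0]
      · exact (h.pos x _ h0).le
    · rw [Complex.re_ofReal_mul, form_gradedProj_self h F hi]
      exact mul_pos (he i) (h.pos x _ hne)
  smooth := by
    intro U hU s t hs ht
    have h1 : ∀ i ∈ Finset.Icc 1 m, ContMDiffOn 𝓘(ℝ, Fin n → ℂ) 𝓘(ℝ, ℂ) ∞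
        (fun x => (e i : ℂ) * (h.form x (orthProj h (F.sub i) x (s x)) (t x) -
          h.form x (orthProj h (F.sub (i + 1)) x (s x)) (t x))) U := fun i _ =>
      (contMDiffOn_const (I' := 𝓘(ℝ, ℝ)) (c := e i)).smul ((contMDiffOn_form_orthProj h (F.sub i) hU hs ht).sub
        (contMDiffOn_form_orthProj h (F.sub (i + 1)) hU hs ht))
    refine (contMDiffOn_finsetSum h1).congr fun x hx => ?_
    rw [rayForm_apply]
    refine Finset.sum_congr rfl fun i _ => ?_
    simp [gradedProj]

theorem rayEnd_eq (lam : ℕ → ℝ) (x : X) :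
    rayEnd h F lam x = ∑ i ∈ Finset.Icc 1 m, (lam i : ℂ) • gradedProj h F i x := rfl

theorem rayEnd_pow (lam : ℕ → ℝ) (c : ℂ) (x : X) (k : ℕ) :
    (c • rayEnd h F lam x) ^ k = ∑ i ∈ Finset.Icc 1 m, (c * lam i) ^ k • gradedProj h F i x := by
  induction k with
  | zero => simp [sum_gradedProj]
  | succ k ih =>
    rw [pow_succ, ih, rayEnd_eq, Finset.smul_sum, Finset.sum_mul]
    refine Finset.sum_congr rfl fun i hi => ?_
    rw [Finset.mul_sum, Finset.sum_eq_single i]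
    · rw [smul_smul, smul_mul_smul_comm, gradedProj_mul h F hi hi, if_pos rfl, pow_succ]
    · intro j hj hji
      rw [smul_smul, smul_mul_smul_comm, gradedProj_mul h F hi hj, if_neg hji.symm, smul_zero]
    · exact fun h => absurd hi h

/-- The exponential series sums separately on each eigenspace of `w`. This identifies `e^{cw} h`
with a smooth Hermitian metric, to which all results on metrics apply. -/
theorem expForm_ray (lam : ℕ → ℝ) (c : ℝ) (x : X) (u v : E x) :
    expForm h (fun y => (c : ℂ) • rayEnd h F lam y) x u v =
      (rayMetric h F (fun i => Real.exp (c * lam i)) fun _ => Real.exp_pos _).form x u v := by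
  change _ = rayForm h F _ x u v
  rw [rayForm_apply]
  unfold expForm
  refine HasSum.tsum_eq ?_
  have h1 : ∀ i ∈ Finset.Icc 1 m, HasSum (fun k : ℕ => ((k.factorial : ℂ))⁻¹ *
      ((c : ℂ) * lam i) ^ k * h.form x (gradedProj h F i x u) v)
      ((Real.exp (c * lam i) : ℂ) * h.form x (gradedProj h F i x u) v) := fun i _ => by
    refine HasSum.mul_right _ ?_
    have := NormedSpace.expSeries_div_hasSum_exp ((c : ℂ) * lam i)
    rw [← Complex.exp_eq_exp_ℂ] at this
    push_cast
    simpa [div_eq_inv_mul] using this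
  convert hasSum_sum h1 using 1
  funext k
  rw [rayEnd_pow, LinearMap.sum_apply, map_sum (h.form x), LinearMap.sum_apply, Finset.mul_sum]
  refine Finset.sum_congr rfl fun i _ => ?_
  rw [LinearMap.smul_apply, map_smul, LinearMap.smul_apply, smul_eq_mul, mul_assoc]

end Projections

/-! ## Endomorphisms in a frame and the second fundamental form along a ray -/

section FrameMatrix

open scoped Matrix

theorem conn_congr {n k : ℕ} {U : Set (Fin n → ℂ)} (hU : IsOpen U)
    {H H' : (Fin n → ℂ) → Matrix (Fin k) (Fin k) ℂ} (h : ∀ z ∈ U, H z = H' z)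
    {z : Fin n → ℂ} (hz : z ∈ U) (u : Fin n → ℂ) : conn H z u = conn H' z u := by
  unfold conn
  rw [ddM_congr hU h _ hz, h z hz]

theorem curv_congr {n k : ℕ} {U : Set (Fin n → ℂ)} (hU : IsOpen U)
    {H H' : (Fin n → ℂ) → Matrix (Fin k) (Fin k) ℂ} (h : ∀ z ∈ U, H z = H' z)
    {z : Fin n → ℂ} (hz : z ∈ U) (u v : Fin n → ℂ) : curv H z u v = curv H' z u v := by
  unfold curv
  rw [ddM_congr hU (fun y hy => conn_congr hU h hy v) _ hz,
    ddM_congr hU (fun y hy => conn_congr hU h hy u) _ hz]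

variable {n r : ℕ} {X : Type*} [TopologicalSpace X] [ChartedSpace (Fin n → ℂ) X]
  {E : X → Type*} [∀ x, AddCommGroup (E x)] [∀ x, Module ℂ (E x)] [∀ x, TopologicalSpace (E x)]
  [TopologicalSpace (Bundle.TotalSpace (Fin r → ℂ) E)] [FiberBundle (Fin r → ℂ) E]
  (h : HermitianMetric n r E)

/-- The matrix `A s_a = ∑_b A_{ab} s_b` of the endomorphism `A` in the frame `s`. -/
def frameMat {k : ℕ} (s : Fin k → ∀ x, E x) (A : ∀ x, Module.End ℂ (E x)) (p : X)
    (z : Fin n → ℂ) : Matrix (Fin k) (Fin k) ℂ :=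
  gram (fun y a b => h.form y (A y a) b) s p z * (gram (fun y a b => h.form y a b) s p z)⁻¹

variable {h} {x₀ p : X} {z : Fin n → ℂ} (s : HolFrame n r (fun y => (⊤ : Submodule ℂ (E y))) r x₀)

theorem frameMat_mul_gram (hz : z ∈ chartDom p s.dom) (A : ∀ x, Module.End ℂ (E x)) :
    frameMat h s.sec A p z * gram (fun y a b => h.form y a b) s.sec p z =
      gram (fun y a b => h.form y (A y a) b) s.sec p z :=
  Matrix.nonsing_inv_mul_cancel_right _ _
    (det_gram_ne_zero h (s.linearIndependent _ hz.2)).isUnit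

/-- Defining `frameMat` by Gram matrices makes its smooth dependence on the point visible;
nondegeneracy of the metric shows that it is the coordinate matrix. -/
theorem frameMat_eq (hz : z ∈ chartDom p s.dom) {A : ∀ x, Module.End ℂ (E x)}
    {W : Matrix (Fin r) (Fin r) ℂ}
    (hW : ∀ a, A ((chartAt (Fin n → ℂ) p).symm z) (s.sec a ((chartAt (Fin n → ℂ) p).symm z)) =
      ∑ b, W a b • s.sec b ((chartAt (Fin n → ℂ) p).symm z)) :
    frameMat h s.sec A p z = W := by
  have h1 : gram (fun y a b => h.form y (A y a) b) s.sec p z =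
      W * gram (fun y a b => h.form y a b) s.sec p z := by
    ext a b
    simp only [gram, Matrix.of_apply, Matrix.mul_apply]
    rw [hW, map_sum (h.form _), LinearMap.sum_apply]
    simp only [map_smul, LinearMap.smul_apply, smul_eq_mul]
  unfold frameMat
  rw [h1, Matrix.mul_nonsing_inv_cancel_right _ _
    (det_gram_ne_zero h (s.linearIndependent _ hz.2)).isUnit]

theorem frameMat_spec (h : HermitianMetric n r E) (hz : z ∈ chartDom p s.dom)
    (A : ∀ x, Module.End ℂ (E x)) (a : Fin r) :
    A ((chartAt (Fin n → ℂ) p).symm z) (s.sec a ((chartAt (Fin n → ℂ) p).symm z)) =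
      ∑ b, frameMat h s.sec A p z a b • s.sec b ((chartAt (Fin n → ℂ) p).symm z) := by
  have h1 : ∀ a, ∃ c : Fin r → ℂ, ∑ b, c b • s.sec b ((chartAt (Fin n → ℂ) p).symm z) =
      A ((chartAt (Fin n → ℂ) p).symm z) (s.sec a ((chartAt (Fin n → ℂ) p).symm z)) := fun a => by
    refine (Submodule.mem_span_range_iff_exists_fun ℂ).1 ?_
    rw [s.span_eq _ hz.2]
    trivial
  choose W hW using h1
  rw [frameMat_eq s hz (W := Matrix.of W) fun a => (hW a).symm]
  exact (hW a).symm

/-- Coordinates are rows, which reverses the order of the factors. -/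
theorem frameMat_mul (hz : z ∈ chartDom p s.dom) (A B : ∀ x, Module.End ℂ (E x)) :
    frameMat h s.sec (fun x => A x * B x) p z =
      frameMat h s.sec B p z * frameMat h s.sec A p z := by
  refine frameMat_eq s hz fun a => ?_
  rw [Module.End.mul_apply, frameMat_spec s h hz B a, map_sum]
  simp only [map_smul, frameMat_spec s h hz A, Finset.smul_sum, Matrix.mul_apply, Finset.sum_smul,
    smul_smul]
  exact Finset.sum_comm

theorem frameMat_one (hz : z ∈ chartDom p s.dom) :
    frameMat h s.sec (fun _ => 1) p z = 1 :=
  frameMat_eq s hz fun a => by simp [Matrix.one_apply]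

theorem frameMat_zero (hz : z ∈ chartDom p s.dom) :
    frameMat h s.sec (fun _ => 0) p z = 0 :=
  frameMat_eq s hz fun a => by simp

theorem frameMat_sum (hz : z ∈ chartDom p s.dom) {ι : Type*} (t : Finset ι)
    (A : ι → ∀ x, Module.End ℂ (E x)) :
    frameMat h s.sec (fun x => ∑ i ∈ t, A i x) p z = ∑ i ∈ t, frameMat h s.sec (A i) p z := by
  refine frameMat_eq s hz fun a => ?_
  rw [LinearMap.sum_apply]
  simp only [frameMat_spec s h hz, Matrix.sum_apply, Finset.sum_smul]
  exact Finset.sum_comm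

theorem trace_eq_frameMat (h : HermitianMetric n r E) (hz : z ∈ chartDom p s.dom)
    (A : ∀ x, Module.End ℂ (E x)) :
    LinearMap.trace ℂ _ (A ((chartAt (Fin n → ℂ) p).symm z)) =
      (frameMat h s.sec A p z).trace := by
  set y := (chartAt (Fin n → ℂ) p).symm z with hy
  let b : Module.Basis (Fin r) ℂ (E y) :=
    Module.Basis.mk (s.linearIndependent y hz.2) (s.span_eq y hz.2).ge
  rw [LinearMap.trace_eq_matrix_trace ℂ b]
  refine Finset.sum_congr rfl fun a _ => ?_
  have h1 := frameMat_spec s h hz A a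
  have h2 : ∀ a, b a = s.sec a y := fun a => Module.Basis.mk_apply _ _ a
  rw [Matrix.diag_apply, Matrix.diag_apply, LinearMap.toMatrix_apply, h2]
  have h3 : A y (s.sec a y) = ∑ c, frameMat h s.sec A p z a c • b c :=
    h1.trans (Finset.sum_congr rfl fun c _ => by rw [h2])
  rw [h3]
  exact congrFun (b.repr_sum_self fun c => frameMat h s.sec A p z a c) a

variable [IsManifold 𝓘(ℂ, Fin n → ℂ) ω X] {m : ℕ} (F : SubbundleFiltration n r E m)

theorem smoothM_gradedProj (h : HermitianMetric n r E) (i : ℕ) (p : X) :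
    SmoothM (frameMat h s.sec (gradedProj h F i) p) (chartDom p s.dom) := by
  refine SmoothM.mul (fun a b => ?_) ((smoothM_gram h s.isOpen_dom s.hol p).inv fun z hz =>
    det_gram_ne_zero h (s.linearIndependent _ hz.2))
  refine ((contDiffOn_comp_chart_symm
    (contMDiffOn_form_orthProj h (F.sub i) s.isOpen_dom (s.hol a) (s.hol b)) p).sub
    (contDiffOn_comp_chart_symm
    (contMDiffOn_form_orthProj h (F.sub (i + 1)) s.isOpen_dom (s.hol a) (s.hol b)) p)).congr ?_
  intro z hz
  simp [gram, gradedProj]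

theorem gram_rayMetric (h : HermitianMetric n r E) (e : ℕ → ℝ) (he : ∀ i, 0 < e i)
    (hz : z ∈ chartDom p s.dom) :
    gram (fun y a b => (rayMetric h F e he).form y a b) s.sec p z =
      (∑ i ∈ Finset.Icc 1 m, (e i : ℂ) • frameMat h s.sec (gradedProj h F i) p z) *
        gram (fun y a b => h.form y a b) s.sec p z := by
  rw [Finset.sum_mul]
  simp only [Matrix.smul_mul, frameMat_mul_gram s hz]
  ext a b
  rw [Matrix.sum_apply]
  exact rayForm_apply h F e _ _ _

variable [VectorBundle ℂ (Fin r → ℂ) E] [ContMDiffVectorBundle ω (Fin r → ℂ) E 𝓘(ℂ, Fin n → ℂ)]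

/-- `curvature` is defined with the preferred frame at each point; conjugation by the transition
matrix carries it over to the fixed frame `s`. -/
theorem frameMat_curvature (h h' : HermitianMetric n r E) (hz : z ∈ chartDom p s.dom)
    (u v : Fin n → ℂ) :
    frameMat h s.sec (fun x => curvature r (fun y a b => h'.form y a b) x (coordVec p x u)
      (coordVec p x v)) p z = curv (gram (fun y a b => h'.form y a b) s.sec p) z u v := by
  refine frameMat_eq s hz fun a => ?_
  set x := (chartAt (Fin n → ℂ) p).symm z with hx
  obtain ⟨M, -, hMs, hM⟩ := s.curv_change (trivFrame (r := r) n E x) p x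
  have hzz := mem_chartDom_inter hz (trivFrame (r := r) n E x).mem_dom
  obtain ⟨hdet, -, hc⟩ := hM h' z hzz
  have h1 : ∀ b, curvature r (fun y a b => h'.form y a b) x (coordVec p x u) (coordVec p x v)
      ((trivFrame (r := r) n E x).sec b x) = ∑ c, curv (gram (fun y a b => h'.form y a b)
        (trivFrame (r := r) n E x).sec x) (chartAt (Fin n → ℂ) x x) (coordVec p x u) (coordVec p x v) b c •
          (trivFrame (r := r) n E x).sec c x := by
    intro b
    have hb : ∀ b, trivBasis (n := n) (r := r) x b = (trivFrame (r := r) n E x).sec b x := fun b =>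
      Module.Basis.mk_apply _ _ b
    rw [← hb b]
    refine (Matrix.toLin_self _ _ _ b).trans ?_
    refine Finset.sum_congr rfl fun c _ => ?_
    rw [hb, Matrix.transpose_apply]
    exact congrArg (fun A : Matrix (Fin r) (Fin r) ℂ => A b c • (trivFrame (r := r) n E x).sec c x)
      (curvMatrix_eq _ _ _ _ _)
  have h2 : curv (gram (fun y a b => h'.form y a b) s.sec p) z u v * M z =
      M z * curv (gram (fun y a b => h'.form y a b) (trivFrame (r := r) n E x).sec x)
        (chartAt (Fin n → ℂ) x x) (coordVec p x u) (coordVec p x v) := by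
    rw [hc, Matrix.nonsing_inv_mul_cancel_right _ _ hdet.isUnit,
      fderiv_transition_eq_coordVec hz.1, fderiv_transition_eq_coordVec hz.1]
    rfl
  have hs : ∀ a, s.sec a x = ∑ b, M z a b • (trivFrame (r := r) n E x).sec b x :=
    hMs z ⟨hz.1, hz.2, (trivFrame (r := r) n E x).mem_dom⟩
  rw [hs, map_sum]
  simp only [map_smul, h1, hs, Finset.smul_sum, smul_smul]
  refine Finset.sum_comm.trans (Eq.trans (Finset.sum_congr rfl fun c _ => ?_) Finset.sum_comm)
  rw [← Finset.sum_smul, ← Finset.sum_smul]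
  congr 1
  exact (congrFun (congrFun h2 a) c).symm

/-- The difference of the trace of the compressed curvature and of the curvature of the induced
metric on a step of the filtration is a fixed combination of the exponential factors. -/
theorem exists_second_form (h : HermitianMetric n r E) {k : ℕ} (hk : 1 ≤ k) (hkm : k ≤ m + 1)
    (x : X) (u v : Fin n → ℂ) : ∃ κ : ℕ → ℕ → ℂ, ∀ (e : ℕ → ℝ) (he : ∀ i, 0 < e i),
      LinearMap.trace ℂ (E x) (orthProj h (F.sub k) x *
        curvature r (fun y a b => (rayMetric h F e he).form y a b) x u v) =
      traceCurv (rayMetric h F e he) (F.sub k) x u v +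
        ∑ i ∈ Finset.Icc k m, ∑ j ∈ Finset.Icc 1 m \ Finset.Icc k m, (e i / e j : ℂ) * κ i j := by
  set f := (F.sub k).frame x with hf
  set s := trivFrame (r := r) n E x with hs
  set U := chartDom (n := n) x (f.dom ∩ s.dom) with hUdef
  have hU : IsOpen U := isOpen_chartDom x (f.isOpen_dom.inter s.isOpen_dom)
  have hUs : U ⊆ chartDom x s.dom := chartDom_mono x inter_subset_right
  have hUf : U ⊆ chartDom x f.dom := chartDom_mono x inter_subset_left
  set z := chartAt (Fin n → ℂ) x x with hz
  have hxz : (chartAt (Fin n → ℂ) x).symm z = x :=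
    (chartAt (Fin n → ℂ) x).left_inv (mem_chart_source _ x)
  have hzU : z ∈ U := ⟨mem_chart_target _ x, by
    rw [mem_preimage, hxz]; exact ⟨f.mem_dom, s.mem_dom⟩⟩
  obtain ⟨B, hB, hBs⟩ := f.exists_transition s (fun _ => le_top) x
  set H := gram (n := n) (fun y a b => h.form y a b) s.sec x with hHdef
  have hH : SmoothM H U := (smoothM_gram h s.isOpen_dom s.hol x).mono hUs
  have hdet : ∀ z ∈ U, (H z).det ≠ 0 := fun z hz =>
    det_gram_ne_zero h (s.linearIndependent _ hz.2.2)
  have hSgram : ∀ h' : HermitianMetric n r E, ∀ z ∈ U,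
      gram (fun y a b => h'.form y a b) f.sec x z =
        B z * gram (fun y a b => h'.form y a b) s.sec x z * (B z)ᴴ := fun h' z hz =>
    gram_change h' rfl (hBs z hz)
  have hSdet : ∀ h' : HermitianMetric n r E, ∀ z ∈ U,
      (B z * gram (fun y a b => h'.form y a b) s.sec x z * (B z)ᴴ).det ≠ 0 := fun h' z hz => by
    rw [← hSgram h' z hz]
    exact det_gram_ne_zero h' (f.linearIndependent _ hz.2.1)
  -- `C B` is the matrix of the orthogonal projection onto the subbundle. It is built from `h` alone
  -- and does not depend on `e`.
  set C : (Fin n → ℂ) → Matrix (Fin r) (Fin (F.sub k).rank) ℂ :=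
    fun z => H z * (B z)ᴴ * (B z * H z * (B z)ᴴ)⁻¹ with hCdef
  have hC : SmoothM C U := (hH.mul hB.smoothM.conjTranspose).mul
    (((hB.smoothM.mul hH).mul hB.smoothM.conjTranspose).inv (hSdet h))
  have hBC : ∀ z ∈ U, B z * C z = 1 := fun z hz => by
    rw [hCdef]
    simp only [← Matrix.mul_assoc]
    exact Matrix.mul_nonsing_inv _ (hSdet h z hz).isUnit
  have hCBH : ∀ z ∈ U, C z * B z * (H z * (B z)ᴴ) = H z * (B z)ᴴ := fun z hz => by
    rw [Matrix.mul_assoc, ← Matrix.mul_assoc (B z)]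
    exact Matrix.nonsing_inv_mul_cancel_right _ _ (hSdet h z hz).isUnit
  have hP : ∀ z ∈ U, frameMat h s.sec (orthProj h (F.sub k)) x z = C z * B z := fun z hz => by
    refine frameMat_eq s (hUs hz) fun a => orthProj_eq h _ _ ?_ fun t ht => ?_
    · simp only [Matrix.mul_apply, Finset.sum_smul, mul_smul]
      rw [Finset.sum_comm]
      simp only [← Finset.smul_sum]
      refine Submodule.sum_mem _ fun c _ => Submodule.smul_mem _ _ ?_
      rw [← hBs z hz, ← f.span_eq _ hz.2.1]
      exact Submodule.subset_span ⟨c, rfl⟩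
    · rw [← f.span_eq _ hz.2.1] at ht
      obtain ⟨c, rfl⟩ := (Submodule.mem_span_range_iff_exists_fun ℂ).1 ht
      rw [map_sum (h.form _ _), map_sum (h.form _ _)]
      refine Finset.sum_congr rfl fun d _ => ?_
      rw [LinearMap.map_smulₛₗ, LinearMap.map_smulₛₗ]
      congr 1
      have hd := congrFun (congrFun (hCBH z hz) a) d
      rw [hBs z hz, map_sum (h.form _), LinearMap.sum_apply]
      simp only [map_smul, LinearMap.smul_apply, map_sum, LinearMap.map_smulₛₗ]
      rw [Matrix.mul_apply] at hd
      simp only [Matrix.mul_apply (M := H z), Matrix.conjTranspose_apply, Finset.mul_sum,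
        ← mul_assoc] at hd
      simp only [smul_eq_mul, mul_comm ((starRingEnd ℂ) _)]
      exact hd
  set Q : ℕ → (Fin n → ℂ) → Matrix (Fin r) (Fin r) ℂ :=
    fun i => frameMat h s.sec (gradedProj h F i) x with hQdef
  have hQ : ∀ i, SmoothM (Q i) U := fun i => (smoothM_gradedProj s F h i x).mono hUs
  have hQQ : ∀ z ∈ U, ∀ i ∈ Finset.Icc 1 m, ∀ j ∈ Finset.Icc 1 m,
      Q i z * Q j z = if i = j then Q i z else 0 := fun z hz i hi j hj => by
    rw [hQdef, ← frameMat_mul s (hUs hz)]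
    simp only [gradedProj_mul h F hj hi]
    by_cases hij : i = j
    · subst hij
      simp
    · simp only [if_neg hij, if_neg (Ne.symm hij)]
      exact frameMat_zero s (hUs hz)
  have hsum : ∀ z ∈ U, ∑ i ∈ Finset.Icc 1 m, Q i z = 1 := fun z hz => by
    rw [hQdef, ← frameMat_sum s (hUs hz)]
    simp only [sum_gradedProj]
    exact frameMat_one s (hUs hz)
  have hT : Finset.Icc k m ⊆ Finset.Icc 1 m := Finset.Icc_subset_Icc_left hk
  have hPsum : ∀ z ∈ U, C z * B z = ∑ i ∈ Finset.Icc k m, Q i z := fun z hz => by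
    rw [← hP z hz, hQdef, ← frameMat_sum s (hUs hz)]
    congr 1
    funext y
    exact (sum_gradedProj_Icc h F hkm y).symm
  have hQP : ∀ z ∈ U, ∀ i ∈ Finset.Icc k m, Q i z * (C z * B z) = Q i z := fun z hz i hi => by
    rw [hPsum z hz, Finset.mul_sum, Finset.sum_eq_single i]
    · rw [hQQ z hz i (hT hi) i (hT hi), if_pos rfl]
    · intro j hj hji
      rw [hQQ z hz i (hT hi) j (hT hj), if_neg hji.symm]
    · exact fun h => absurd hi h
  have hBQ : ∀ z ∈ U, ∀ i ∈ Finset.Icc 1 m \ Finset.Icc k m, B z * Q i z = 0 := fun z hz i hi => by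
    have h1 : C z * B z * Q i z = 0 := by
      rw [hPsum z hz, Finset.sum_mul]
      refine Finset.sum_eq_zero fun j hj => ?_
      rw [hQQ z hz j (hT hj) i (Finset.sdiff_subset hi), if_neg]
      rintro rfl
      exact (Finset.mem_sdiff.1 hi).2 hj
    calc B z * Q i z = B z * C z * (B z * Q i z) := by rw [hBC z hz, Matrix.one_mul]
      _ = B z * (C z * B z * Q i z) := by simp only [Matrix.mul_assoc]
      _ = 0 := by rw [h1, Matrix.mul_zero]
  -- For `i` in the block of the subbundle `Qᵢ = Qᵢ C B`, and `B` annihilates `∂̄C`.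
  have hY : ∀ u, ∀ i ∈ Finset.Icc k m, Q i z * ddM Complex.I C z u = 0 := fun u i hi => by
    rw [← hQP z hzU i hi, Matrix.mul_assoc, Matrix.mul_assoc, delbar_section hU hB hC hBC hzU,
      Matrix.mul_zero, Matrix.mul_zero]
  -- The coefficients are formed from `h` before `e` enters, so that the whole dependence on the ray
  -- sits in the quotients `eᵢ / eⱼ`.
  let c : ℕ → ℕ → (Fin n → ℂ) → (Fin n → ℂ) → ℂ := fun i j u v =>
    (B z * (ddM (-Complex.I) (Q i) z v + Q i z * conn H z v) * Q j z * ddM Complex.I C z u).trace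
  refine ⟨fun i j => -(Complex.I * (c i j u v - c i j v u)), fun e he => ?_⟩
  set h' := rayMetric h F e he with hh'
  have he' : ∀ i ∈ Finset.Icc 1 m, (e i : ℂ) ≠ 0 := fun i _ =>
    Complex.ofReal_ne_zero.2 (he i).ne'
  set K : (Fin n → ℂ) → Matrix (Fin r) (Fin r) ℂ :=
    fun z => ∑ i ∈ Finset.Icc 1 m, (e i : ℂ) • Q i z with hK
  have hH' : ∀ z ∈ U, gram (fun y a b => h'.form y a b) s.sec x z = K z * H z := fun z hz =>
    gram_rayMetric s F h e he (hUs hz)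
  have hsec : ∀ u v, ((ddM (-Complex.I) B z v + B z * conn (fun z => K z * H z) z v) *
      ddM Complex.I C z u).trace = ∑ i ∈ Finset.Icc k m, ∑ j ∈ Finset.Icc 1 m \ Finset.Icc k m,
        (e i / e j : ℂ) * c i j u v := fun u v => by
    rw [second_form_ray hU hH hdet (fun i _ => hQ i) hQQ hsum (fun i => (e i : ℂ)) he' hB hT hBQ
      hzU (hY u) v]
    simp only [Matrix.trace_sum, Matrix.trace_smul, smul_eq_mul]
    rfl
  have hKH : SmoothM (fun z => K z * H z) U := (SmoothM.sum fun i _ => (hQ i).const_smul _).mul hH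
  -- `K` commutes with `C B`, so the same `C` gives the orthogonal projection for the metric with
  -- Gram matrix `K H`, and `trace_curv_sub` can be used with it.
  have hCK : ∀ z ∈ U, C z * (B z * (K z * H z) * (B z)ᴴ) = K z * H z * (B z)ᴴ := fun z hz => by
    have hcomm : C z * B z * K z = K z * (C z * B z) := by
      rw [hPsum z hz, hK]
      simp only [Finset.sum_mul, Finset.mul_sum, Matrix.smul_mul, Matrix.mul_smul]
      refine Finset.sum_comm.trans (Finset.sum_congr rfl fun i hi => Finset.sum_congr rfl
        fun j hj => ?_)
      rw [hQQ z hz i (hT hi) j hj, hQQ z hz j hj i (hT hi)]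
      by_cases hij : i = j
      · subst hij; rfl
      · rw [if_neg hij, if_neg (Ne.symm hij)]
    calc C z * (B z * (K z * H z) * (B z)ᴴ) = C z * B z * K z * (H z * (B z)ᴴ) := by
          simp only [Matrix.mul_assoc]
      _ = K z * (C z * B z * (H z * (B z)ᴴ)) := by rw [hcomm]; simp only [Matrix.mul_assoc]
      _ = K z * H z * (B z)ᴴ := by rw [hCBH z hz, Matrix.mul_assoc]
  have hmain := trace_curv_sub hU hKH (fun z hz => by
      rw [← hH' z hz]
      exact det_gram_ne_zero h' (s.linearIndependent _ hz.2.2)) hB (fun z hz => by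
      have := hSdet h' z hz
      rwa [hH' z hz] at this) hC hCK hzU u v
  have htc : traceCurv h' (F.sub k) x u v =
      (curv (fun z => B z * (K z * H z) * (B z)ᴴ) z u v).trace := by
    refine (congrArg Matrix.trace (curvMatrix_eq _ _ _ _ _)).trans ?_
    rw [curv_congr hU (fun z hz => (hSgram h' z hz).trans (by rw [hH' z hz])) hzU]
  have htr : LinearMap.trace ℂ (E x) (orthProj h (F.sub k) x *
        curvature r (fun y a b => h'.form y a b) x u v) =
      (curv (fun z => K z * H z) z u v * (C z * B z)).trace := by
    have h1 := trace_eq_frameMat s h (hUs hzU) (fun y => orthProj h (F.sub k) y *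
        curvature r (fun y a b => h'.form y a b) y (coordVec x y u) (coordVec x y v))
    rw [frameMat_mul s (hUs hzU) (orthProj h (F.sub k)), frameMat_curvature s h h' (hUs hzU),
      hP z hzU, curv_congr hU hH' hzU] at h1
    rw [← h1, hxz, coordVec_self, coordVec_self]
  rw [htr, htc, hmain, hsec, hsec]
  simp only [mul_neg, Finset.sum_neg_distrib, mul_sub, Finset.sum_sub_distrib, Finset.mul_sum]
  have hcc : ∀ a b : ℂ, a * (Complex.I * b) = Complex.I * (a * b) := fun a b => by ring
  simp only [hcc]
  ring

end FrameMatrix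

/-! ## The slope of the Donaldson functional along a ray -/

section Slope

open scoped Matrix

variable {n r : ℕ} {X : Type*} [TopologicalSpace X] [ChartedSpace (Fin n → ℂ) X]
  {E : X → Type*} [∀ x, AddCommGroup (E x)] [∀ x, Module ℂ (E x)] [∀ x, TopologicalSpace (E x)]
  [TopologicalSpace (Bundle.TotalSpace (Fin r → ℂ) E)] [FiberBundle (Fin r → ℂ) E]
  (h : HermitianMetric n r E)

theorem HolSubbundle.finrank_fiber (S : HolSubbundle n r E) (x : X) :
    Module.finrank ℂ (S.fiber x) = S.rank := by
  rw [← (S.frame x).span_eq x (S.frame x).mem_dom,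
    finrank_span_eq_card ((S.frame x).linearIndependent x (S.frame x).mem_dom), Fintype.card_fin]

theorem TwoForm.pull_self (α : TwoForm n X) (x : X) (u v : Fin n → ℂ) :
    α.pull x (chartAt (Fin n → ℂ) x x) u v = α x u v := by
  unfold TwoForm.pull
  rw [(chartAt (Fin n → ℂ) x).left_inv (mem_chart_source _ x), coordVec_self, coordVec_self]

theorem mem_chartDom_self {x : X} {U : Set X} (hx : x ∈ U) :
    chartAt (Fin n → ℂ) x x ∈ chartDom x U :=
  ⟨mem_chart_target _ x, by
    rwa [mem_preimage, (chartAt (Fin n → ℂ) x).left_inv (mem_chart_source _ x)]⟩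

/-- Abel summation; it isolates the increments of the weights, whose sign is known. -/
theorem sum_by_parts (lam x : ℕ → ℝ) {m : ℕ} (hm : 1 ≤ m) :
    ∑ k ∈ Finset.Icc 1 m, lam k * (x k - x (k + 1)) =
      lam 1 * x 1 - lam m * x (m + 1) +
        ∑ k ∈ Finset.Ico 1 m, (lam (k + 1) - lam k) * x (k + 1) := by
  induction m, hm using Nat.le_induction with
  | base => simp; ring
  | succ m hm ih =>
    rw [Finset.sum_Icc_succ_top (by omega), ih, Finset.sum_Ico_succ_top hm]
    ring

variable [IsManifold 𝓘(ℂ, Fin n → ℂ) ω X] {m : ℕ} (F : SubbundleFiltration n r E m)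

theorem SubbundleFiltration.rank_pos [Nonempty X] {i : ℕ} (hi : 1 ≤ i) (him : i ≤ m) :
    0 < (F.sub i).rank := by
  obtain ⟨x⟩ := ‹Nonempty X›
  have := (F.sub i).finiteDimensional x
  have h1 := Submodule.finrank_lt_finrank_of_lt (F.strict i hi him x)
  rw [(F.sub i).finrank_fiber] at h1
  omega

variable [VectorBundle ℂ (Fin r → ℂ) E] [ContMDiffVectorBundle ω (Fin r → ℂ) E 𝓘(ℂ, Fin n → ℂ)]

theorem trace_orthProj (S : HolSubbundle n r E) (x : X) :
    LinearMap.trace ℂ (E x) (orthProj h S x) = S.rank := by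
  have := S.finiteDimensional x
  have : Module.Finite ℂ (E x) := Module.Finite.of_basis (trivBasis (n := n) (r := r) x)
  have hp : LinearMap.IsProj (S.fiber x) (orthProj h S x) :=
    ⟨orthProj_mem h S x, fun v hv => orthProj_of_mem h S x hv⟩
  rw [hp.trace, S.finrank_fiber]

/-- Two subbundles with the same fibres may come with different frames; `traceCurv_pull` permits any
of them. This serves to identify the first step of the filtration with the whole bundle. -/
theorem traceCurv_congr {S S' : HolSubbundle n r E} (hS : S.fiber = S'.fiber) :
    traceCurv h S = traceCurv h S' := by
  obtain ⟨fib, k, hk⟩ := S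
  obtain ⟨fib', k', hk'⟩ := S'
  obtain rfl : fib = fib' := hS
  funext x u v
  refine (TwoForm.pull_self (traceCurv h _) x u v).symm.trans ((traceCurv_pull h ⟨fib, k, hk⟩
    (HolSubbundle.frame ⟨fib, k', hk'⟩ x) x (mem_chartDom_self (HolFrame.mem_dom _)) u v).trans ?_)
  exact (congrArg Matrix.trace (curvMatrix_eq _ _ _ _ _)).symm

variable {F}

theorem trace_curvature_isCont {k : ℕ} (hkm : k ≤ m + 1) (h' : HermitianMetric n r E) :
    TwoForm.IsCont (fun x u v => LinearMap.trace ℂ (E x) (orthProj h (F.sub k) x *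
      curvature r (fun y a b => h'.form y a b) x u v) : TwoForm n X) := by
  intro p u v z hz
  set x := (chartAt (Fin n → ℂ) p).symm z with hx
  set s := trivFrame (r := r) n E x with hs
  have hU := isOpen_chartDom (n := n) p s.isOpen_dom
  have hzU : z ∈ chartDom p s.dom := ⟨hz, s.mem_dom⟩
  have hcurv := smoothM_curv hU (smoothM_gram h' s.isOpen_dom s.hol p)
    (fun z hz => det_gram_ne_zero h' (s.linearIndependent _ hz.2)) u v
  have hsm := hcurv.mul (SmoothM.sum fun i (_ : i ∈ Finset.Icc k m) =>
    smoothM_gradedProj s F h i p)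
  have hc : ContinuousOn (fun z => (curv (gram (fun y a b => h'.form y a b) s.sec p) z u v *
      ∑ i ∈ Finset.Icc k m, frameMat h s.sec (gradedProj h F i) p z).trace)
      (chartDom p s.dom) := continuousOn_finsetSum _ fun a _ => (hsm a a).continuousOn
  refine ContinuousAt.continuousWithinAt ((hc.continuousAt (hU.mem_nhds hzU)).congr ?_)
  filter_upwards [hU.mem_nhds hzU] with y hy
  have h1 := trace_eq_frameMat s h hy (fun y => orthProj h (F.sub k) y *
    curvature r (fun y a b => h'.form y a b) y (coordVec p y u) (coordVec p y v))
  rw [frameMat_mul s hy (orthProj h (F.sub k)), frameMat_curvature s h h' hy] at h1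
  refine Eq.trans ?_ h1.symm
  rw [← frameMat_sum s hy]
  simp only [sum_gradedProj_Icc h F hkm]

/-- With `eᵢ = a`, `eⱼ = b⁻¹` and all other entries `1`, the quotient belonging to `(i, j)` is `ab`,
and every other quotient depends on at most one of `a` and `b`. The mixed second difference removes
the latter, and leaves `κ i j` with coefficient `(4 - 2) - (2 - 1) = 1`. -/
theorem sum_mixed_difference {T T' : Finset ℕ} (hT : Disjoint T T') (κ : ℕ → ℕ → ℂ) {i j : ℕ}
    (hi : i ∈ T) (hj : j ∈ T') (f : ℝ → ℝ → ℕ → ℝ)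
    (hf : f = fun a b l => if l = i then a else if l = j then b⁻¹ else 1) :
    ∑ k ∈ T, ∑ l ∈ T', (f 2 2 k / f 2 2 l : ℂ) * κ k l -
      ∑ k ∈ T, ∑ l ∈ T', (f 2 1 k / f 2 1 l : ℂ) * κ k l -
      (∑ k ∈ T, ∑ l ∈ T', (f 1 2 k / f 1 2 l : ℂ) * κ k l -
      ∑ k ∈ T, ∑ l ∈ T', (f 1 1 k / f 1 1 l : ℂ) * κ k l) = κ i j := by
  simp only [← Finset.sum_sub_distrib]
  rw [Finset.sum_eq_single_of_mem i hi, Finset.sum_eq_single_of_mem j hj]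
  · have hji : j ≠ i := fun h => Finset.disjoint_left.1 hT hi (h ▸ hj)
    simp only [hf, if_true, if_neg hji]
    push_cast
    norm_num
    ring
  · intro l hl hlj
    have hli : l ≠ i := fun h => Finset.disjoint_left.1 hT hi (h ▸ hl)
    simp only [hf, ↓reduceIte, if_neg hlj, if_neg hli]
    ring
  · intro k hk hki
    have hkj : k ≠ j := fun h => Finset.disjoint_left.1 hT hk (h ▸ hj)
    refine Finset.sum_eq_zero fun l hl => ?_
    have hli : l ≠ i := fun h => Finset.disjoint_left.1 hT hi (h ▸ hl)
    simp only [hf, if_neg hki, if_neg hkj, if_neg hli]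
    ring

variable (F) [CompactSpace X] [T2Space X]

/-- The integral of the compressed curvature along the rays of metrics defined by a filtration. -/
theorem exists_integral_trace_curvature (hn : 1 ≤ n) (g : KahlerMetric n X) {k : ℕ} (hk : 1 ≤ k)
    (hkm : k ≤ m + 1) : ∃ c : ℕ → ℕ → ℝ, ∀ (e : ℕ → ℝ) (he : ∀ i, 0 < e i),
      (g.wedgePow fun x u v => LinearMap.trace ℂ (E x) (orthProj h (F.sub k) x *
        curvature r (fun y a b => (rayMetric h F e he).form y a b) x u v)).integral.re =
      2 * Real.pi * degree g (F.sub k) +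
        ∑ i ∈ Finset.Icc k m, ∑ j ∈ Finset.Icc 1 m \ Finset.Icc k m, e i / e j * c i j := by
  choose κ hκ using exists_second_form F h hk hkm
  set T := Finset.Icc k m
  set T' := Finset.Icc 1 m \ Finset.Icc k m
  have hTT' : Disjoint T T' := Finset.disjoint_sdiff
  let α : ∀ e : ℕ → ℝ, (∀ i, 0 < e i) → TwoForm n X := fun e he x u v =>
    LinearMap.trace ℂ (E x) (orthProj h (F.sub k) x *
      curvature r (fun y a b => (rayMetric h F e he).form y a b) x u v)
  let δ : ∀ e : ℕ → ℝ, (∀ i, 0 < e i) → TwoForm n X := fun e he x u v =>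
    α e he x u v - traceCurv (rayMetric h F e he) (F.sub k) x u v
  have hα : ∀ e he, (α e he).IsCont := fun e he => trace_curvature_isCont h hkm _
  have hδ : ∀ e he, (δ e he).IsCont := fun e he => (hα e he).sub (traceCurv_isCont _ _)
  have hδκ : ∀ e he x u v, δ e he x u v = ∑ i ∈ T, ∑ j ∈ T', (e i / e j : ℂ) * κ x u v i j :=
    fun e he x u v => by
      change α e he x u v - _ = _
      exact sub_eq_of_eq_add' (hκ x u v e he)
  -- The coefficients `κ` were chosen point by point, with no control in `x`. Each is nevertheless a
  -- mixed difference of four of the continuous forms `δ`, hence continuous and integrable term by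
  -- term.
  have hcont : ∀ i ∈ T, ∀ j ∈ T', TwoForm.IsCont (fun x u v => κ x u v i j : TwoForm n X) := by
    intro i hi j hj
    let f : ℝ → ℝ → ℕ → ℝ := fun a b l => if l = i then a else if l = j then b⁻¹ else 1
    have hf : ∀ a b : ℝ, 0 < a → 0 < b → ∀ l, 0 < f a b l := fun a b ha hb l => by
      simp only [f]
      split_ifs
      · exact ha
      · exact inv_pos.2 hb
      · exact one_pos
    have h22 := hδ (f 2 2) (hf 2 2 two_pos two_pos)
    have h21 := hδ (f 2 1) (hf 2 1 two_pos one_pos)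
    have h12 := hδ (f 1 2) (hf 1 2 one_pos two_pos)
    have h11 := hδ (f 1 1) (hf 1 1 one_pos one_pos)
    have hc := (h22.sub h21).sub (h12.sub h11)
    simp only [hδκ] at hc
    convert hc using 4 with x u v
    exact (sum_mixed_difference hTT' (κ x u v) hi hj f rfl).symm
  refine ⟨fun i j => (g.wedgePow fun x u v => κ x u v i j).integral.re, fun e he => ?_⟩
  have h1 := g.integral_wedgePow_sub hn (hα e he)
    (traceCurv_isCont (rayMetric h F e he) (F.sub k))
  have h2 : (fun x u v => α e he x u v - traceCurv (rayMetric h F e he) (F.sub k) x u v :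
      TwoForm n X) = fun x u v => ∑ p ∈ T ×ˢ T', (e p.1 / e p.2 : ℂ) * κ x u v p.1 p.2 := by
    funext x u v
    rw [Finset.sum_product]
    exact hδκ e he x u v
  have h4 := g.integral_wedgePow_sum hn (T ×ˢ T') (fun p => (e p.1 / e p.2 : ℂ))
    (α := fun p x u v => κ x u v p.1 p.2) fun p hp =>
      hcont _ (Finset.mem_product.1 hp).1 _ (Finset.mem_product.1 hp).2
  have h5 := h1.symm.trans ((congrArg (fun β => (g.wedgePow β).integral) h2).trans h4)
  have h3 := congrArg Complex.re (eq_add_of_sub_eq' h5)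
  refine h3.trans ?_
  rw [Complex.add_re, integral_traceCurv hn, Complex.re_sum, Finset.sum_product]
  congr 1
  refine Finset.sum_congr rfl fun i _ => Finset.sum_congr rfl fun j _ => ?_
  rw [← Complex.ofReal_div, Complex.re_ofReal_mul]

/-- The Donaldson functional along the ray of a filtration and the limit of its derivative. -/
theorem exists_donaldson_ray (hn : 1 ≤ n) (g : KahlerMetric n X) {lam : ℕ → ℝ}
    (hlam : ∀ i j, 1 ≤ i → i < j → j ≤ m → lam j < lam i) :
    ∃ Φ : ℝ → ℝ, Continuous Φ ∧
      Tendsto Φ atTop (𝓝 (∑ k ∈ Finset.Icc 1 m, lam k *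
        (2 * Real.pi * degree g (F.sub k) - 2 * Real.pi * degree g (F.sub (k + 1))))) ∧
      ∀ t : ℝ, donaldson g h (fun x => (t : ℂ) • rayEnd h F lam x) = (∫ s in (0 : ℝ)..t, Φ s) -
        heConst g r E * (t * (∑ k ∈ Finset.Icc 1 m, lam k *
          ((F.sub k).rank - (F.sub (k + 1)).rank)) * g.top.integral.re) := by
  have hD : ∀ k, ∃ c : ℕ → ℕ → ℝ, 1 ≤ k → k ≤ m + 1 → ∀ (e : ℕ → ℝ) (he : ∀ i, 0 < e i),
      (g.wedgePow fun x u v => LinearMap.trace ℂ (E x) (orthProj h (F.sub k) x *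
        curvature r (fun y a b => (rayMetric h F e he).form y a b) x u v)).integral.re =
      2 * Real.pi * degree g (F.sub k) +
        ∑ i ∈ Finset.Icc k m, ∑ j ∈ Finset.Icc 1 m \ Finset.Icc k m, e i / e j * c i j := by
    intro k
    by_cases hk : 1 ≤ k ∧ k ≤ m + 1
    · obtain ⟨c, hc⟩ := exists_integral_trace_curvature h F hn g hk.1 hk.2
      exact ⟨c, fun _ _ => hc⟩
    · exact ⟨0, fun h1 h2 => absurd ⟨h1, h2⟩ hk⟩
  choose c hc using hD
  -- By `hc`, for `1 ≤ k ≤ m + 1` this is the integral of `tr(P_k Θ(h_t)) ∧ ωⁿ⁻¹`.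
  let D : ℕ → ℝ → ℝ := fun k t => 2 * Real.pi * degree g (F.sub k) +
    ∑ i ∈ Finset.Icc k m, ∑ j ∈ Finset.Icc 1 m \ Finset.Icc k m,
      Real.exp (t * lam i) / Real.exp (t * lam j) * c k i j
  have hDc : ∀ k, Continuous (D k) := fun k => by
    refine continuous_const.add (continuous_finsetSum _ fun i _ => continuous_finsetSum _
      fun j _ => ?_)
    refine Continuous.mul (Continuous.div (by fun_prop) (by fun_prop) fun t => ?_) continuous_const
    exact (Real.exp_pos _).ne'
  have hDl : ∀ k, Tendsto (D k) atTop (𝓝 (2 * Real.pi * degree g (F.sub k))) := fun k => by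
    have h0 : Tendsto (fun t : ℝ => ∑ i ∈ Finset.Icc k m, ∑ j ∈ Finset.Icc 1 m \ Finset.Icc k m,
        Real.exp (t * lam i) / Real.exp (t * lam j) * c k i j) atTop
        (𝓝 (∑ i ∈ Finset.Icc k m, ∑ j ∈ Finset.Icc 1 m \ Finset.Icc k m, 0 * c k i j)) := by
      refine tendsto_finsetSum _ fun i hi => tendsto_finsetSum _ fun j hj => ?_
      refine Tendsto.mul_const _ ?_
      rw [Finset.mem_sdiff, Finset.mem_Icc, Finset.mem_Icc] at hj
      rw [Finset.mem_Icc] at hi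
      -- Here `j < k ≤ i`, so `λᵢ < λⱼ` and the exponential factor decays.
      have hlt : lam i - lam j < 0 := sub_neg.2 (hlam j i hj.1.1 (by omega) hi.2)
      have he : ∀ t : ℝ, Real.exp (t * lam i) / Real.exp (t * lam j) =
          Real.exp (t * (lam i - lam j)) := fun t => by
        rw [← Real.exp_sub, mul_sub]
      simp only [he]
      exact Real.tendsto_exp_atBot.comp (tendsto_id.atTop_mul_const_of_neg hlt)
    simpa using tendsto_const_nhds.add h0
  refine ⟨fun t => ∑ k ∈ Finset.Icc 1 m, lam k * (D k t - D (k + 1) t), ?_, ?_, fun t => ?_⟩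
  · exact continuous_finsetSum _ fun k _ => continuous_const.mul ((hDc k).sub (hDc (k + 1)))
  · exact tendsto_finsetSum _ fun k _ => ((hDl k).sub (hDl (k + 1))).const_mul _
  · unfold donaldson
    congr 1
    · have hint : ∀ s : ℝ, (g.wedgePow fun x u v => LinearMap.trace ℂ (E x)
          (((t : ℂ) • rayEnd h F lam x) * curvature r (expForm h fun y =>
            (s : ℂ) • (t : ℂ) • rayEnd h F lam y) x u v)).integral.re =
          t * ∑ k ∈ Finset.Icc 1 m, lam k * (D k (s * t) - D (k + 1) (s * t)) := by
        intro s
        have hexp : (expForm h fun y => (s : ℂ) • (t : ℂ) • rayEnd h F lam y) =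
            fun y a b => (rayMetric h F (fun i => Real.exp (s * t * lam i))
              fun _ => Real.exp_pos _).form y a b := by
          funext y a b
          rw [← expForm_ray]
          simp only [smul_smul, Complex.ofReal_mul]
        set h' := rayMetric h F (fun i => Real.exp (s * t * lam i)) fun _ => Real.exp_pos _
        let α : ℕ → TwoForm n X := fun k x u v => LinearMap.trace ℂ (E x)
          (orthProj h (F.sub k) x * curvature r (fun y a b => h'.form y a b) x u v)
        have hα : ∀ k ≤ m + 1, (α k).IsCont := fun k hk => trace_curvature_isCont h hk h'
        have hform : (fun x u v => LinearMap.trace ℂ (E x)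
            (((t : ℂ) • rayEnd h F lam x) * curvature r (expForm h fun y =>
            (s : ℂ) • (t : ℂ) • rayEnd h F lam y) x u v) : TwoForm n X) =
            fun x u v => ∑ k ∈ Finset.Icc 1 m, ((t * lam k : ℝ) : ℂ) *
              (α k x u v - α (k + 1) x u v) := by
          funext x u v
          rw [hexp]
          simp only [rayEnd, Finset.smul_sum, Finset.sum_mul, map_sum, smul_smul, smul_mul_assoc,
            map_smul, sub_mul, map_sub, smul_eq_mul, α, Complex.ofReal_mul]
        rw [hform, g.integral_wedgePow_sum hn _ (fun k => ((t * lam k : ℝ) : ℂ))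
          (α := fun k x u v => α k x u v - α (k + 1) x u v), Complex.re_sum, Finset.mul_sum]
        · refine Finset.sum_congr rfl fun k hk => ?_
          rw [Finset.mem_Icc] at hk
          rw [Complex.re_ofReal_mul, g.integral_wedgePow_sub hn (hα k (by omega))
            (hα (k + 1) (by omega)), Complex.sub_re, mul_assoc]
          congr 2
          exact congrArg₂ _ (hc k hk.1 (by omega) _ _) (hc (k + 1) (by omega) (by omega) _ _)
        · intro k hk
          rw [Finset.mem_Icc] at hk
          exact (hα k (by omega)).sub (hα (k + 1) (by omega))
      simp only [hint]
      -- The substitution `s ↦ st` turns `t` times the integral over `[0, 1]` into the integral from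
      -- `0` to `t`.
      rw [intervalIntegral.integral_const_mul]
      have := intervalIntegral.smul_integral_comp_mul_right (a := 0) (b := 1)
        (fun s => ∑ k ∈ Finset.Icc 1 m, lam k * (D k s - D (k + 1) s)) t
      rw [zero_mul, one_mul] at this
      exact this
    · congr 1
      have htr : ∀ x, LinearMap.trace ℂ (E x) ((t : ℂ) • rayEnd h F lam x) =
          ((t * ∑ k ∈ Finset.Icc 1 m, lam k *
            (((F.sub k).rank : ℝ) - (F.sub (k + 1)).rank) : ℝ) : ℂ) := fun x => by
        simp only [rayEnd, map_smul, map_sum, map_sub, trace_orthProj, smul_eq_mul]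
        push_cast
        rfl
      simp only [htr]
      rw [TopForm.integral_const_mul, Complex.re_ofReal_mul]

end Slope

/-! ## Degrees of the trivial steps of a filtration -/

section Ends

variable {n r : ℕ} {X : Type*} [TopologicalSpace X] [ChartedSpace (Fin n → ℂ) X]
  {E : X → Type*} [∀ x, AddCommGroup (E x)] [∀ x, Module ℂ (E x)] [∀ x, TopologicalSpace (E x)]
  [TopologicalSpace (Bundle.TotalSpace (Fin r → ℂ) E)] [FiberBundle (Fin r → ℂ) E]
  [IsManifold 𝓘(ℂ, Fin n → ℂ) ω X] [VectorBundle ℂ (Fin r → ℂ) E]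
  [ContMDiffVectorBundle ω (Fin r → ℂ) E 𝓘(ℂ, Fin n → ℂ)] [CompactSpace X] [T2Space X]

theorem degree_congr (hn : 1 ≤ n) (g : KahlerMetric n X) (h : HermitianMetric n r E)
    {S S' : HolSubbundle n r E} (hS : S.fiber = S'.fiber) : degree g S = degree g S' := by
  have h1 := integral_traceCurv hn g h S
  rw [traceCurv_congr h hS, integral_traceCurv hn g h S'] at h1
  exact (mul_left_cancel₀ (by positivity) h1).symm

theorem degree_eq_zero_of_rank_eq_zero (hn : 1 ≤ n) (g : KahlerMetric n X)
    (h : HermitianMetric n r E) {S : HolSubbundle n r E} (hS : S.rank = 0) : degree g S = 0 := by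
  have : IsEmpty (Fin S.rank) := by rw [hS]; infer_instance
  have h0 : traceCurv h S = fun _ _ _ => 0 := by
    funext x u v
    exact Fintype.sum_empty (ι := Fin S.rank) _
  have h1 := integral_traceCurv hn g h S
  have h2 := TopForm.integral_const_mul 0 (g.wedgePow (traceCurv h S))
  simp only [zero_mul] at h2
  rw [h0, g.wedgePow_zero hn, h2, Complex.zero_re] at h1
  exact (mul_eq_zero.1 h1.symm).resolve_left (by positivity)

theorem SubbundleFiltration.rank_first [Nonempty X] {m : ℕ} (F : SubbundleFiltration n r E m) :
    (F.sub 1).rank = r := by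
  obtain ⟨x⟩ := ‹Nonempty X›
  exact ((F.sub 1).frame x).rank_eq ((HolSubbundle.whole n r E).frame x)
    ((F.sub 1).frame x).mem_dom ((HolSubbundle.whole n r E).frame x).mem_dom (F.first x)

theorem SubbundleFiltration.rank_last [Nonempty X] {m : ℕ} (F : SubbundleFiltration n r E m) :
    (F.sub (m + 1)).rank = 0 := by
  obtain ⟨x⟩ := ‹Nonempty X›
  rw [← (F.sub (m + 1)).finrank_fiber x, F.last, finrank_bot]

end Ends

end DonaldsonRay

end

/-! ### The limiting slope and the slopes of the filtration -/

theorem corollary3p5 {n r m : ℕ} (hn : 1 ≤ n) (hm : 2 ≤ m)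
    {X : Type*} [TopologicalSpace X] [T2Space X] [CompactSpace X] [ConnectedSpace X]
    [ChartedSpace (Fin n → ℂ) X] [IsManifold 𝓘(ℂ, Fin n → ℂ) ω X]
    (g : DonaldsonRay.KahlerMetric n X)
    {E : X → Type*} [∀ x, AddCommGroup (E x)] [∀ x, Module ℂ (E x)] [∀ x, TopologicalSpace (E x)]
    [TopologicalSpace (Bundle.TotalSpace (Fin r → ℂ) E)] [FiberBundle (Fin r → ℂ) E]
    [VectorBundle ℂ (Fin r → ℂ) E] [ContMDiffVectorBundle ω (Fin r → ℂ) E 𝓘(ℂ, Fin n → ℂ)]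
    (h₀ : DonaldsonRay.HermitianMetric n r E)
    (F : DonaldsonRay.SubbundleFiltration n r E m)
    (lam : ℕ → ℝ) (hlam : ∀ i j, 1 ≤ i → i < j → j ≤ m → lam j < lam i)
    (L : ℝ)
    (hL : DonaldsonRay.HasAsymptoticSlope
      (fun t : ℝ => DonaldsonRay.donaldson g h₀ fun x =>
        (t : ℂ) • DonaldsonRay.rayEnd h₀ F lam x) L)
    (hL0 : L ≤ 0) :
    ∃ i, 2 ≤ i ∧ i ≤ m ∧
      DonaldsonRay.slope g (DonaldsonRay.HolSubbundle.whole n r E) ≤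
        DonaldsonRay.slope g (F.sub i) := by
  obtain ⟨Φ, hΦ, hΦlim, hdon⟩ := DonaldsonRay.exists_donaldson_ray h₀ F hn g hlam
  obtain ⟨vol, hvol, htop⟩ := g.integral_top_pos
  have htop' : g.top.integral.re = vol := by rw [htop, Complex.ofReal_re]
  set R : ℝ := ∑ k ∈ Finset.Icc 1 m, lam k * (((F.sub k).rank : ℝ) - (F.sub (k + 1)).rank) with hR
  set γ := DonaldsonRay.heConst g r E with hγ
  -- The fundamental theorem of calculus; the term with `γ` is linear in `t`.
  have hderiv : ∀ t, HasDerivAt (fun t : ℝ => DonaldsonRay.donaldson g h₀ fun x =>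
      (t : ℂ) • DonaldsonRay.rayEnd h₀ F lam x) (Φ t - γ * (R * vol)) t := by
    intro t
    have h1 : HasDerivAt (fun t : ℝ => ∫ s in (0 : ℝ)..t, Φ s) (Φ t) t :=
      intervalIntegral.integral_hasDerivAt_right (hΦ.intervalIntegrable _ _)
        (hΦ.stronglyMeasurableAtFilter _ _) hΦ.continuousAt
    have h2 : HasDerivAt (fun t : ℝ => γ * (t * R * vol)) (γ * (R * vol)) t := by
      have := (((hasDerivAt_id t).mul_const R).mul_const vol).const_mul γ
      simpa using this
    simp only [hdon, htop']
    exact h1.sub h2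
  have hderiv' : deriv (fun t : ℝ => DonaldsonRay.donaldson g h₀ fun x =>
      (t : ℂ) • DonaldsonRay.rayEnd h₀ F lam x) = fun t => Φ t - γ * (R * vol) :=
    funext fun t => (hderiv t).deriv
  have hlim := hL.2
  rw [hderiv'] at hlim
  have hLeq := tendsto_nhds_unique hlim (hΦlim.sub_const (γ * (R * vol)))
  set μ := DonaldsonRay.slope g (DonaldsonRay.HolSubbundle.whole n r E) with hμ
  have hγvol : γ * vol = 2 * Real.pi * μ := by
    rw [hγ, DonaldsonRay.heConst, htop', div_mul_cancel₀ _ hvol.ne']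
  -- `y k` is the rank of `E_k` times `μ_{E_k} - μ_E`. It vanishes for `k = 1` and for `k = m + 1`,
  -- so Abel summation leaves no boundary terms.
  let y : ℕ → ℝ := fun k => DonaldsonRay.degree g (F.sub k) - μ * (F.sub k).rank
  have hLy : L = 2 * Real.pi * ∑ k ∈ Finset.Icc 1 m, lam k * (y k - y (k + 1)) := by
    have h1 : γ * (R * vol) = 2 * Real.pi * μ * R := by rw [← hγvol]; ring
    rw [hLeq, h1, hR, Finset.mul_sum, Finset.mul_sum, ← Finset.sum_sub_distrib]
    refine Finset.sum_congr rfl fun k _ => ?_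
    simp only [y]
    ring
  have hrpos : 0 < r := F.rank_first ▸ F.rank_pos le_rfl (by omega)
  have hy1 : y 1 = 0 := by
    have h1 : DonaldsonRay.degree g (F.sub 1) =
        DonaldsonRay.degree g (DonaldsonRay.HolSubbundle.whole n r E) :=
      DonaldsonRay.degree_congr hn g h₀ (funext F.first)
    have hr : (r : ℝ) ≠ 0 := by positivity
    simp only [y, F.rank_first, h1, hμ, DonaldsonRay.slope]
    change _ - _ / (r : ℝ) * r = 0
    rw [div_mul_cancel₀ _ hr, sub_self]
  have hylast : y (m + 1) = 0 := by
    simp [y, F.rank_last, DonaldsonRay.degree_eq_zero_of_rank_eq_zero hn g h₀ F.rank_last]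
  by_contra! hcon
  have hyneg : ∀ k, 2 ≤ k → k ≤ m → y k < 0 := by
    intro k hk hkm
    have hpos : (0 : ℝ) < (F.sub k).rank := Nat.cast_pos.2 (F.rank_pos (by omega) hkm)
    have := hcon k hk hkm
    rw [DonaldsonRay.slope, div_lt_iff₀ hpos] at this
    exact sub_neg.2 this
  rw [DonaldsonRay.sum_by_parts lam y (by omega : 1 ≤ m), hy1, hylast] at hLy
  have hsum : 0 < ∑ k ∈ Finset.Ico 1 m, (lam (k + 1) - lam k) * y (k + 1) := by
    -- The index `1` lies in the range because `m ≥ 2`, so the sum is not empty.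
    refine Finset.sum_pos (fun k hk => ?_) ⟨1, Finset.mem_Ico.2 ⟨le_rfl, by omega⟩⟩
    rw [Finset.mem_Ico] at hk
    exact mul_pos_of_neg_of_neg (sub_neg.2 (hlam k (k + 1) hk.1 (by omega) (by omega)))
      (hyneg (k + 1) (by omega) (by omega))
  have : 0 < L := by
    rw [hLy, mul_zero, mul_zero, sub_zero, zero_add]
    exact mul_pos Real.two_pi_pos hsum
  exact absurd hL0 (not_le.2 this)
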